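/- Fix an integer $k\ge 1$, let $\mathbb N$ be the set of positive integers and $[n]=\{1,\dots,n\}$. An $r$-dimensional ray in $\mathbb N^k\times[n]$ is a set $\{(y,i) : y_j\ge x_j \text{ for } j\in T,\ y_j=x_j \text{ for } j\notin T\}$ with $i\in[n]$, $x\in\mathbb N^k$ and $T\subset\{1,\dots,k\}$, $|T|=r$; a translation on a ray is a map of the form $(y,i)\mapsto(y+d,i+d_0)$ with $d\in\mathbb Z^k$, $d_0\in\mathbb Z$. Let $\tilde{\mathcal H}_{k,n}$ be the group of all permutations of $\mathbb N^k\times[n]$ that are translations on every ray of some finite partition of $\mathbb N^k\times[n]$ into rays. The Houghton homogeneous category $\mathcal C_{\mathcal H}$ has the non-negative integers as objects, $\mathrm{Hom}(m,n)=\tilde{\mathcal H}_{k,n}/\tilde{\mathcal H}_{k,n-m}$ for $m\le n$ (where $\tilde{\mathcal H}_{k,n-m}$ acts on the last $n-m$ copies of $\mathbb N^k$), and $\mathrm{Hom}(m,n)=\emptyset$ for $m>n$. The composite of the classes of $f\in\tilde{\mathcal H}_{k,n}$ and $g\in\tilde{\mathcal H}_{k,o}$ is the class of $g\circ(f\oplus\mathrm{id})$.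 The monoidal structure $\oplus$ is addition on objects and is induced by the block sum of permutations on morphisms; its unit $0$ is initial. For objects $A,X$ of a monoidal category with initial unit $0$ and for $n\ge1$, let $S_n(A,X)$ be the simplicial complex whose vertices are the morphisms $X\to A\oplus X^{\oplus n}$ and whose $p$-simplices are the sets of $p+1$ vertices which, in some order, are of the form $f\circ i_0,\dots,f\circ i_p$ for a morphism $f:X^{\oplus p+1}\to A\oplus X^{\oplus n}$; here $i_j: X=0\oplus X\oplus 0\to X^{\oplus j}\oplus X\oplus X^{\oplus p-j}$ is given by the identity of $X$ and the unique morphisms out of $0$. For a rational number $q$, a complex is called $q$-connected if it is non-empty in case $q\ge-1$ and every map from the sphere $S^i$ to its geometric realization is homotopic to a constant map for all integers $0\le i\le q$. Write $S_n=S_n(0,1)$ for the complex of $\mathcal C_{\mathcal H}$ formed from the morphisms $1\to n$. Then the following hold. 1. For every $n\ge1$, $S_n$ is $\left(\frac{n-3}{2}\right)$-connected. 2. For every $n\ge 1$ and every vertex $f$ of $S_n$ there is exactly one $\pi(f)\in[n]$ such that (the injection $\mathbb N^k\to\mathbb N^k\times[n]$ underlying) $f$ maps some $k$-dimensional ray of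 $\mathbb N^k$ by a translation into $\mathbb N^k\times\{\pi(f)\}$. The restriction of $\pi$ to $(n-2)$-skeleta, $S_n^{(n-2)}\to(\Delta^{n-1})^{(n-2)}$, where $\Delta^{n-1}$ is the simplex with vertex set $[n]$, is a fin-retraction. Here a fin-retraction is a surjective simplicial map $\pi:Y\to X$ such that for every finite set $S$ of vertices of $Y$ there is a simplicial section $\rho:X\to Y$ of $\pi$ with the property that, for all simplices $\sigma$ of $Y$ with vertices in $S$ and all simplices $\tau$ of $X$, $\tau$ lies in the link of $\pi\sigma$ in $X$ if and only if $\rho\tau$ lies in the link of $\sigma$ in $Y$. 3. $\mathcal C_{\mathcal H}$ satisfies condition LH3 at $(A,X)=(1,1)$ with slope $2$: for every $n\ge1$, $S_n(1,1)$ is $\left(\frac{n-2}{2}\right)$-connected. -/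

import Mathlib

open CategoryTheory MonoidalCategory

/-! ### The twisted Houghton groups -/

/-- `n` copies of the lattice orthant `ℕ^k`. (Coordinates start at `0`; a shift by one identifies
this with the convention in which `ℕ` is the set of positive integers.) -/
abbrev Cells (k n : ℕ) : Type := (Fin k → ℕ) × Fin n

/-- An `r`-dimensional ray in `ℕ^k × [n]`: a ray with corner `x` and free directions `T`
(with `T` of cardinality `r`) in one copy of `ℕ^k`. -/
def IsRayOfDim {k n : ℕ} (r : ℕ) (X : Set (Cells k n)) : Prop :=
  ∃ (i : Fin n) (x : Fin k → ℕ) (T : Finset (Fin k)), T.card = r ∧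
    X = {p | p.2 = i ∧ (∀ j ∈ T, x j ≤ p.1 j) ∧ ∀ j ∉ T, p.1 j = x j}

/-- A ray of some dimension. -/
def IsRay {k n : ℕ} (X : Set (Cells k n)) : Prop := ∃ r, IsRayOfDim r X

/-- `f` is given on `X` by `(x, i) ↦ (x + d, i + d₀)`. -/
def IsTranslationOn {k m n : ℕ} (f : Cells k m → Cells k n) (X : Set (Cells k m)) : Prop :=
  ∃ (d : Fin k → ℤ) (d₀ : ℤ), ∀ p ∈ X,
    (∀ j, ((f p).1 j : ℤ) = (p.1 j : ℤ) + d j) ∧ (((f p).2 : ℕ) : ℤ) = ((p.2 : ℕ) : ℤ) + d₀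

/-- `f` is a translation on every ray of some finite partition of its domain into rays. -/
def IsPiecewiseTranslation {k m n : ℕ} (f : Cells k m → Cells k n) : Prop :=
  ∃ P : Set (Set (Cells k m)), P.Finite ∧ Setoid.IsPartition P ∧
    ∀ X ∈ P, IsRay X ∧ IsTranslationOn f X

section PiecewiseTranslations

theorem IsRay.nonempty {k n : ℕ} {X : Set (Cells k n)} (h : IsRay X) : X.Nonempty := by
  obtain ⟨r, i, x, T, -, rfl⟩ := h
  exact ⟨(x, i), rfl, fun _ _ => le_rfl, fun _ _ => rfl⟩

theorem IsRay.image {k m n : ℕ} {f : Cells k m → Cells k n} {X : Set (Cells k m)}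
    (hX : IsRay X) (hf : IsTranslationOn f X) : IsRay (f '' X) := by
  obtain ⟨r, i, x, T, hr, rfl⟩ := hX
  obtain ⟨d, d₀, h⟩ := hf
  have hc := h (x, i) ⟨rfl, fun _ _ => le_rfl, fun _ _ => rfl⟩
  refine ⟨r, (f (x, i)).2, (f (x, i)).1, T, hr, ?_⟩
  ext q
  simp only [Set.mem_image, Set.mem_ofPred_eq]
  constructor
  · rintro ⟨p, hp, rfl⟩
    have hp1 := h p hp
    obtain ⟨h1, h2, h3⟩ := hp
    refine ⟨?_, fun j hj => ?_, fun j hj => ?_⟩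
    · apply Fin.ext
      have := hp1.2
      have := hc.2
      rw [h1] at *
      simp only at *
      omega
    · have := hp1.1 j
      have := hc.1 j
      have := h2 j hj
      simp only at *
      omega
    · have := hp1.1 j
      have := hc.1 j
      have := h3 j hj
      simp only at *
      omega
  · rintro ⟨h1, h2, h3⟩
    have hmem : ((fun j => ((q.1 j : ℤ) - d j).toNat, i) : Cells k m).2 = i ∧
        (∀ j ∈ T, x j ≤ ((fun j => ((q.1 j : ℤ) - d j).toNat, i) : Cells k m).1 j) ∧
        ∀ j ∉ T, ((fun j => ((q.1 j : ℤ) - d j).toNat, i) : Cells k m).1 j = x j := by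
      refine ⟨rfl, fun j hj => ?_, fun j hj => ?_⟩
      · have := hc.1 j
        have := h2 j hj
        simp only at *
        omega
      · have := hc.1 j
        have := h3 j hj
        simp only at *
        omega
    refine ⟨(fun j => ((q.1 j : ℤ) - d j).toNat, i), hmem, ?_⟩
    have hp := h _ hmem
    refine Prod.ext (funext fun j => ?_) (Fin.ext ?_)
    · have e1 := hp.1 j
      have e2 := hc.1 j
      have e3 : x j ≤ ((q.1 j : ℤ) - d j).toNat := by
        by_cases hj : j ∈ T
        · exact hmem.2.1 j hj
        · exact (hmem.2.2 j hj).ge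
      have e4 : (f (x, i)).1 j ≤ q.1 j := by
        by_cases hj : j ∈ T
        · exact h2 j hj
        · exact (h3 j hj).ge
      simp only at *
      omega
    · have e1 := hp.2
      have e2 := hc.2
      rw [h1]
      simp only at *
      omega

theorem IsRay.inter_preimage {k m n : ℕ} {f : Cells k m → Cells k n} {X : Set (Cells k m)}
    {Y : Set (Cells k n)} (hX : IsRay X) (hY : IsRay Y) (hf : IsTranslationOn f X)
    (hne : (X ∩ f ⁻¹' Y).Nonempty) : IsRay (X ∩ f ⁻¹' Y) := by
  obtain ⟨r, i, x, T, -, rfl⟩ := hX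
  obtain ⟨r', i', y, U, -, rfl⟩ := hY
  obtain ⟨d, d₀, h⟩ := hf
  obtain ⟨w, hw, hw'⟩ := hne
  refine ⟨_, i, fun j => if j ∈ T ∩ U then max (x j) ((y j : ℤ) - d j).toNat else w.1 j,
    T ∩ U, rfl, ?_⟩
  have hwd := h w hw
  obtain ⟨w1, w2, w3⟩ := hw
  obtain ⟨w1', w2', w3'⟩ := hw'
  ext p
  constructor
  · rintro ⟨hp, hp'⟩
    have hpd := h p hp
    obtain ⟨p1, p2, p3⟩ := hp
    obtain ⟨p1', p2', p3'⟩ := hp'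
    refine ⟨p1, fun j hj => ?_, fun j hj => ?_⟩
    · have hj' := Finset.mem_inter.1 hj
      have := p2 j hj'.1
      have := p2' j hj'.2
      have := hpd.1 j
      simp only [hj, if_true]
      omega
    · simp only [hj, if_false]
      have := hpd.1 j
      have := hwd.1 j
      by_cases hT : j ∈ T
      · have hU : j ∉ U := fun hU => hj (Finset.mem_inter.2 ⟨hT, hU⟩)
        have := p3' j hU
        have := w3' j hU
        omega
      · have := p3 j hT
        have := w3 j hT
        omega
  · rintro ⟨p1, p2, p3⟩
    have hp : p.2 = i ∧ (∀ j ∈ T, x j ≤ p.1 j) ∧ ∀ j ∉ T, p.1 j = x j := by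
      refine ⟨p1, fun j hj => ?_, fun j hj => ?_⟩
      · by_cases hU : j ∈ U
        · have := p2 j (Finset.mem_inter.2 ⟨hj, hU⟩)
          simp only [Finset.mem_inter, hj, hU, and_self, if_true] at this
          omega
        · have := p3 j (by simp [hU])
          simp only [Finset.mem_inter, hj, hU, and_false, if_false] at this
          have := w2 j hj
          omega
      · have := p3 j (by simp [hj])
        simp only [Finset.mem_inter, hj, false_and, if_false] at this
        have := w3 j hj
        omega
    have hpd := h p hp
    refine ⟨hp, ?_, fun j hj => ?_, fun j hj => ?_⟩
    · rw [← w1']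
      apply Fin.ext
      have := hpd.2
      have := hwd.2
      rw [p1] at *
      rw [w1] at *
      omega
    · have := hpd.1 j
      have := hwd.1 j
      by_cases hT : j ∈ T
      · have := p2 j (Finset.mem_inter.2 ⟨hT, hj⟩)
        simp only [Finset.mem_inter, hj, hT, and_self, if_true] at this
        omega
      · have := p3 j (by simp [hT])
        simp only [Finset.mem_inter, hj, hT, false_and, if_false] at this
        have := w2' j hj
        omega
    · have := hpd.1 j
      have := hwd.1 j
      have := p3 j (by simp [hj])
      simp only [Finset.mem_inter, hj, and_false, if_false] at this
      have := w3' j hj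
      omega

theorem IsPiecewiseTranslation.comp {k m n o : ℕ} {g : Cells k n → Cells k o}
    {f : Cells k m → Cells k n} (hg : IsPiecewiseTranslation g) (hf : IsPiecewiseTranslation f) :
    IsPiecewiseTranslation (g ∘ f) := by
  obtain ⟨P, Pfin, Ppart, hP⟩ := hf
  obtain ⟨Q, Qfin, Qpart, hQ⟩ := hg
  refine ⟨{Z | Z.Nonempty ∧ ∃ X ∈ P, ∃ Y ∈ Q, X ∩ f ⁻¹' Y = Z}, ?_, ⟨?_, ?_⟩, ?_⟩
  · refine (Set.Finite.image2 (fun X Y => X ∩ f ⁻¹' Y) Pfin Qfin).subset ?_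
    rintro Z ⟨-, X, hX, Y, hY, rfl⟩
    exact ⟨X, hX, Y, hY, rfl⟩
  · rintro ⟨h, -⟩
    exact Set.not_nonempty_empty h
  · intro a
    obtain ⟨X, ⟨hX, haX⟩, uX⟩ := Ppart.2 a
    obtain ⟨Y, ⟨hY, haY⟩, uY⟩ := Qpart.2 (f a)
    refine ⟨X ∩ f ⁻¹' Y, ⟨⟨⟨a, haX, haY⟩, X, hX, Y, hY, rfl⟩, haX, haY⟩, ?_⟩
    rintro Z ⟨⟨-, X', hX', Y', hY', rfl⟩, haX', haY'⟩
    rw [uX X' ⟨hX', haX'⟩, uY Y' ⟨hY', haY'⟩]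
  · rintro Z ⟨hne, X, hX, Y, hY, rfl⟩
    refine ⟨(hP X hX).1.inter_preimage (hQ Y hY).1 (hP X hX).2 hne, ?_⟩
    obtain ⟨d, d₀, h⟩ := (hP X hX).2
    obtain ⟨d', d₀', h'⟩ := (hQ Y hY).2
    refine ⟨d + d', d₀ + d₀', ?_⟩
    rintro p ⟨hp, hp'⟩
    have e := h p hp
    have e' := h' _ hp'
    refine ⟨fun j => ?_, ?_⟩
    · rw [Function.comp_apply, e'.1 j, e.1 j, Pi.add_apply, add_assoc]
    · rw [Function.comp_apply, e'.2, e.2, add_assoc]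

/-- Moving whole copies of `ℕ^k` around is a piecewise translation. -/
theorem isPiecewiseTranslation_copy {k m n : ℕ} (c : Fin m → Fin n) :
    IsPiecewiseTranslation (fun p : Cells k m => ((p.1, c p.2) : Cells k n)) := by
  refine ⟨Set.range fun i : Fin m => {p : Cells k m | p.2 = i}, Set.finite_range _, ⟨?_, ?_⟩, ?_⟩
  · rintro ⟨i, hi⟩
    have : ((0, i) : Cells k m) ∈ ({p : Cells k m | p.2 = i} : Set _) := rfl
    simp only at hi
    rw [hi] at this
    exact this
  · intro a
    refine ⟨{p | p.2 = a.2}, ⟨⟨a.2, rfl⟩, rfl⟩, ?_⟩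
    rintro Z ⟨⟨i, rfl⟩, ha⟩
    have : a.2 = i := ha
    rw [this]
  · rintro Z ⟨i, rfl⟩
    refine ⟨⟨_, i, 0, Finset.univ, rfl, ?_⟩, 0, ((c i : ℕ) : ℤ) - ((i : ℕ) : ℤ), ?_⟩
    · ext p
      simp
    · rintro p hp
      have : p.2 = i := hp
      simp [this]

theorem IsPiecewiseTranslation.symm {k n : ℕ} {g : Equiv.Perm (Cells k n)}
    (hg : IsPiecewiseTranslation g) : IsPiecewiseTranslation g.symm := by
  obtain ⟨P, Pfin, Ppart, hP⟩ := hg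
  refine ⟨(fun X => g '' X) '' P, Pfin.image _, ⟨?_, ?_⟩, ?_⟩
  · rintro ⟨X, hX, h⟩
    have := (hP X hX).1.nonempty.image g
    simp only at h
    rw [h] at this
    exact Set.not_nonempty_empty this
  · intro a
    obtain ⟨X, ⟨hX, haX⟩, uX⟩ := Ppart.2 (g.symm a)
    refine ⟨g '' X, ⟨⟨X, hX, rfl⟩, ⟨_, haX, by simp⟩⟩, ?_⟩
    rintro Z ⟨⟨X', hX', rfl⟩, b, hb, hba⟩
    have : X' = X := uX X' ⟨hX', by rw [← hba]; simpa using hb⟩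
    rw [this]
  · rintro Z ⟨X, hX, rfl⟩
    refine ⟨(hP X hX).1.image (hP X hX).2, ?_⟩
    obtain ⟨d, d₀, h⟩ := (hP X hX).2
    refine ⟨-d, -d₀, ?_⟩
    rintro q ⟨p, hp, rfl⟩
    have := h p hp
    refine ⟨fun j => ?_, ?_⟩
    · rw [Equiv.symm_apply_apply, this.1 j]
      simp
    · rw [Equiv.symm_apply_apply, this.2]
      simp

end PiecewiseTranslations

/-- The `k`-dimensional twisted Houghton group on `n` copies of `ℕ^k`. -/
def TwistedHoughton (k n : ℕ) : Subgroup (Equiv.Perm (Cells k n)) where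
  carrier := {g | IsPiecewiseTranslation g}
  mul_mem' hg hh := hg.comp hh
  one_mem' := isPiecewiseTranslation_copy (fun i => i)
  inv_mem' hg := hg.symm

/-! ### Block sums -/

/-- The inclusion of the first `m` copies. -/
def cellsInl {k m : ℕ} (n : ℕ) (p : Cells k m) : Cells k (m + n) := (p.1, Fin.castAdd n p.2)

/-- The inclusion of the last `n` copies. -/
def cellsInr {k : ℕ} (m : ℕ) {n : ℕ} (p : Cells k n) : Cells k (m + n) := (p.1, Fin.natAdd m p.2)

/-- The first `m` copies together with the last `n` copies make up all `m + n` copies. -/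
def cellsSum (k m n : ℕ) : Cells k m ⊕ Cells k n ≃ Cells k (m + n) :=
  (Equiv.prodSumDistrib _ _ _).symm.trans (Equiv.prodCongr (Equiv.refl _) finSumFinEquiv)

theorem cellsSum_inl {k m n : ℕ} (p : Cells k m) : cellsSum k m n (Sum.inl p) = cellsInl n p := by
  simp [cellsSum, cellsInl]

theorem cellsSum_inr {k m n : ℕ} (p : Cells k n) : cellsSum k m n (Sum.inr p) = cellsInr m p := by
  simp [cellsSum, cellsInr]

theorem cells_cases {k m n : ℕ} {C : Cells k (m + n) → Prop} (hl : ∀ p, C (cellsInl n p))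
    (hr : ∀ p, C (cellsInr m p)) (q : Cells k (m + n)) : C q := by
  rw [← (cellsSum k m n).apply_symm_apply q]
  cases (cellsSum k m n).symm q with
  | inl p => rw [cellsSum_inl]; exact hl p
  | inr p => rw [cellsSum_inr]; exact hr p

theorem cellsInr_injective {k m n : ℕ} : Function.Injective (cellsInr (k := k) m (n := n)) := by
  intro p q h
  have := (cellsSum k m n).injective.comp Sum.inr_injective
  apply this
  simpa [cellsSum_inr] using h

theorem cellsInl_injective {k m n : ℕ} : Function.Injective (cellsInl (k := k) (m := m) n) := by
  intro p q h
  have := (cellsSum k m n).injective.comp Sum.inl_injective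
  apply this
  simpa [cellsSum_inl] using h

theorem cellsInl_ne_cellsInr {k m n : ℕ} (p : Cells k m) (q : Cells k n) :
    cellsInl n p ≠ cellsInr m q := by
  rw [← cellsSum_inl, ← cellsSum_inr]
  exact fun h => Sum.inl_ne_inr ((cellsSum k m n).injective h)

theorem isTranslationOn_cellsInl {k m : ℕ} (n : ℕ) (X : Set (Cells k m)) :
    IsTranslationOn (cellsInl n) X :=
  ⟨0, 0, fun p _ => by simp [cellsInl]⟩

theorem isTranslationOn_cellsInr {k : ℕ} (m : ℕ) {n : ℕ} (X : Set (Cells k n)) :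
    IsTranslationOn (cellsInr m) X :=
  ⟨0, m, fun p _ => by simp [cellsInr, add_comm]⟩

theorem IsPiecewiseTranslation.sum {k m n m' n' : ℕ} {f : Cells k m → Cells k m'}
    {g : Cells k n → Cells k n'} {F : Cells k (m + n) → Cells k (m' + n')}
    (hf : IsPiecewiseTranslation f) (hg : IsPiecewiseTranslation g)
    (hl : ∀ p, F (cellsInl n p) = cellsInl n' (f p))
    (hr : ∀ p, F (cellsInr m p) = cellsInr m' (g p)) : IsPiecewiseTranslation F := by
  obtain ⟨P, Pfin, Ppart, hP⟩ := hf
  obtain ⟨Q, Qfin, Qpart, hQ⟩ := hg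
  refine ⟨(fun X => cellsInl n '' X) '' P ∪ (fun X => cellsInr m '' X) '' Q,
    (Pfin.image _).union (Qfin.image _), ⟨?_, ?_⟩, ?_⟩
  · rintro (⟨X, hX, h⟩ | ⟨X, hX, h⟩)
    · exact ((hP X hX).1.nonempty.image (cellsInl n)).ne_empty h
    · exact ((hQ X hX).1.nonempty.image (cellsInr m)).ne_empty h
  · intro a
    induction a using cells_cases with
    | hl p =>
      obtain ⟨X, ⟨hX, hpX⟩, uX⟩ := Ppart.2 p
      refine ⟨cellsInl n '' X, ⟨Or.inl ⟨X, hX, rfl⟩, p, hpX, rfl⟩, ?_⟩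
      rintro Z ⟨⟨X', hX', rfl⟩ | ⟨X', hX', rfl⟩, b, hb, hbp⟩
      · rw [cellsInl_injective hbp] at hb
        rw [uX X' ⟨hX', hb⟩]
      · exact absurd hbp.symm (cellsInl_ne_cellsInr _ _)
    | hr p =>
      obtain ⟨X, ⟨hX, hpX⟩, uX⟩ := Qpart.2 p
      refine ⟨cellsInr m '' X, ⟨Or.inr ⟨X, hX, rfl⟩, p, hpX, rfl⟩, ?_⟩
      rintro Z ⟨⟨X', hX', rfl⟩ | ⟨X', hX', rfl⟩, b, hb, hbp⟩
      · exact absurd hbp (cellsInl_ne_cellsInr _ _)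
      · rw [cellsInr_injective hbp] at hb
        rw [uX X' ⟨hX', hb⟩]
  · rintro Z (⟨X, hX, rfl⟩ | ⟨X, hX, rfl⟩)
    · refine ⟨(hP X hX).1.image (isTranslationOn_cellsInl _ _), ?_⟩
      obtain ⟨d, d₀, h⟩ := (hP X hX).2
      refine ⟨d, d₀, ?_⟩
      rintro _ ⟨p, hp, rfl⟩
      have := h p hp
      rw [hl]
      exact ⟨this.1, this.2⟩
    · refine ⟨(hQ X hX).1.image (isTranslationOn_cellsInr _ _), ?_⟩
      obtain ⟨d, d₀, h⟩ := (hQ X hX).2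
      refine ⟨d, d₀ + m' - m, ?_⟩
      rintro _ ⟨p, hp, rfl⟩
      have := h p hp
      rw [hr]
      refine ⟨this.1, ?_⟩
      have := this.2
      simp only [cellsInr, Fin.val_natAdd]
      push_cast
      omega

/-- The block sum: `g` acts on the first `m` copies and `h` acts on the last `n` copies. -/
def blockSum (k m n : ℕ) :
    TwistedHoughton k m × TwistedHoughton k n →* TwistedHoughton k (m + n) where
  toFun gh := ⟨(cellsSum k m n).permCongr (Equiv.sumCongr gh.1.1 gh.2.1),
    IsPiecewiseTranslation.sum gh.1.2 gh.2.2
      (fun p => by simp [← cellsSum_inl, Equiv.permCongr_apply])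
      (fun p => by simp [← cellsSum_inr, Equiv.permCongr_apply])⟩
  map_one' := by
    ext1
    simp only [Prod.fst_one, Prod.snd_one, OneMemClass.coe_one]
    ext1 q
    simp [Equiv.permCongr_apply, Equiv.Perm.sumCongr_one]
  map_mul' a b := by
    ext1
    apply Equiv.ext
    intro q
    induction q using cells_cases with
    | hl p => simp [← cellsSum_inl, Equiv.permCongr_apply]
    | hr p => simp [← cellsSum_inr, Equiv.permCongr_apply]

theorem blockSum_inl {k m n : ℕ} (g : TwistedHoughton k m) (h : TwistedHoughton k n)
    (p : Cells k m) : (blockSum k m n (g, h)).1 (cellsInl n p) = cellsInl n (g.1 p) := by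
  simp [blockSum, ← cellsSum_inl, Equiv.permCongr_apply]

theorem blockSum_inr {k m n : ℕ} (g : TwistedHoughton k m) (h : TwistedHoughton k n)
    (p : Cells k n) : (blockSum k m n (g, h)).1 (cellsInr m p) = cellsInr m (h.1 p) := by
  simp [blockSum, ← cellsSum_inr, Equiv.permCongr_apply]

/-- Transport along an equality of numbers of copies. -/
def recount (k : ℕ) {m n : ℕ} (e : m = n) : TwistedHoughton k m ≃* TwistedHoughton k n :=
  e ▸ MulEquiv.refl _

/-- The inclusion of the first `m` of `n` copies. -/
def cellsUp {k m n : ℕ} (h : m ≤ n) (p : Cells k m) : Cells k n := (p.1, Fin.castLE h p.2)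

/-- For `m + l = n`, the automorphisms of `l` act on the last `l` of `n` copies. -/
def actOnLast (k : ℕ) {m l n : ℕ} (e : m + l = n) : TwistedHoughton k l →* TwistedHoughton k n :=
  (recount k e).toMonoidHom.comp
    ((blockSum k m l).comp (MonoidHom.inr (TwistedHoughton k m) (TwistedHoughton k l)))

/-- For `m + l = n`, the automorphisms of `m` act on the first `m` of `n` copies. -/
def actOnFirst (k : ℕ) {m l n : ℕ} (e : m + l = n) : TwistedHoughton k m →* TwistedHoughton k n :=
  (recount k e).toMonoidHom.comp
    ((blockSum k m l).comp (MonoidHom.inl (TwistedHoughton k m) (TwistedHoughton k l)))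

theorem actOnFirst_apply {k m l n : ℕ} (e : m + l = n) (h : m ≤ n) (g : TwistedHoughton k m)
    (p : Cells k m) : (actOnFirst k e g).1 (cellsUp h p) = cellsUp h (g.1 p) := by
  subst e
  exact blockSum_inl g 1 p

theorem mem_range_actOnLast {k m l n : ℕ} (e : m + l = n) (h : m ≤ n) (g : TwistedHoughton k n) :
    g ∈ (actOnLast k e).range ↔ ∀ p : Cells k m, g.1 (cellsUp h p) = cellsUp h p := by
  subst e
  constructor
  · rintro ⟨t, rfl⟩ p
    exact blockSum_inl 1 t p
  · intro hg
    have hg' : ∀ p : Cells k m, g.1 (cellsInl l p) = cellsInl l p := hg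
    have hgi : ∀ p : Cells k m, g.1.symm (cellsInl l p) = cellsInl l p := fun p => by
      rw [Equiv.symm_apply_eq, hg']
    have key : ∀ t : Equiv.Perm (Cells k (m + l)), (∀ p, t.symm (cellsInl l p) = cellsInl l p) →
        ∀ q : Cells k l, ∃ q' : Cells k l, t (cellsInr m q) = cellsInr m q' := by
      intro t ht q
      have : ∀ r, t (cellsInr m q) = r → ∃ q' : Cells k l, r = cellsInr m q' := by
        intro r
        induction r using cells_cases with
        | hl p =>
          intro hr
          exact absurd ((ht p).symm.trans ((Equiv.symm_apply_eq t).2 hr.symm))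
            (cellsInl_ne_cellsInr _ _)
        | hr p => exact fun _ => ⟨p, rfl⟩
      exact this _ rfl
    choose a ha using key g.1 hgi
    choose b hb using key g.1.symm hg'
    have hpw : IsPiecewiseTranslation a := by
      obtain ⟨P, h1, h2, h3⟩ := IsPiecewiseTranslation.comp g.2
        (isPiecewiseTranslation_copy (k := k) (fun i : Fin l => Fin.natAdd m i))
      refine ⟨P, h1, h2, fun X hX => ⟨(h3 X hX).1, ?_⟩⟩
      obtain ⟨d, d₀, h⟩ := (h3 X hX).2
      refine ⟨d, d₀ - m, fun p hp => ?_⟩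
      have := h p hp
      have e : (g.1 ∘ fun p : Cells k l => ((p.1, Fin.natAdd m p.2) : Cells k (m + l))) p =
          cellsInr m (a p) := ha p
      rw [e] at this
      refine ⟨this.1, ?_⟩
      have := this.2
      simp only [cellsInr, Fin.val_natAdd] at this
      push_cast at this
      omega
    refine ⟨⟨⟨a, b, fun p => ?_, fun p => ?_⟩, hpw⟩, ?_⟩
    · apply cellsInr_injective (m := m)
      rw [← hb, ← ha, Equiv.symm_apply_apply]
    · apply cellsInr_injective (m := m)
      rw [← ha, ← hb, Equiv.apply_symm_apply]
    · ext1
      apply Equiv.ext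
      intro q
      induction q using cells_cases with
      | hl p => exact (blockSum_inl _ _ p).trans (hg' p).symm
      | hr p => exact (blockSum_inr _ _ p).trans (ha p).symm

/-! ### The Houghton category -/

/-- The copy of the automorphism group of `n - m` inside that of `n`, acting on the last `n - m`
copies. -/
def restSubgroup (k : ℕ) {m n : ℕ} (h : m ≤ n) : Subgroup (TwistedHoughton k n) :=
  (actOnLast k (Nat.add_sub_of_le h)).range

theorem mem_restSubgroup {k m n : ℕ} (h : m ≤ n) (g : TwistedHoughton k n) :
    g ∈ restSubgroup k h ↔ ∀ p : Cells k m, g.1 (cellsUp h p) = cellsUp h p :=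
  mem_range_actOnLast _ h g

/-- The set of morphisms from `m` to `n`: empty unless `m ≤ n`, and then the set of cosets
`Aut(n) / Aut(n - m)`. -/
structure HoughtonHom (k m n : ℕ) : Type where
  le : m ≤ n
  cls : TwistedHoughton k n ⧸ restSubgroup k le

namespace HoughtonHom

variable {k m n o m' n' : ℕ}

/-- The morphism represented by an automorphism of the target. -/
def of (h : m ≤ n) (g : TwistedHoughton k n) : HoughtonHom k m n := ⟨h, QuotientGroup.mk g⟩

theorem of_eq_of_iff (h : m ≤ n) (g g' : TwistedHoughton k n) :
    of h g = of h g' ↔ ∀ p, g.1 (cellsUp h p) = g'.1 (cellsUp h p) := by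
  have : of h g = of h g' ↔
      (QuotientGroup.mk g : TwistedHoughton k n ⧸ restSubgroup k h) = QuotientGroup.mk g' := by
    simp [of]
  rw [this, QuotientGroup.eq, mem_restSubgroup]
  refine forall_congr' fun p => ?_
  change g.1.symm (g'.1 (cellsUp h p)) = cellsUp h p ↔ _
  rw [Equiv.symm_apply_eq, eq_comm]

theorem exists_of (f : HoughtonHom k m n) : ∃ h g, f = of h g := by
  obtain ⟨h, q⟩ := f
  induction q using QuotientGroup.induction_on with
  | H g => exact ⟨h, g, rfl⟩

/-- The injection `ℕ^k × [m] → ℕ^k × [n]` underlying a morphism: restrict a representative to the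
first `m` copies. -/
def toFun (f : HoughtonHom k m n) : Cells k m → Cells k n :=
  Quotient.liftOn' f.cls (fun g p => g.1 (cellsUp f.le p)) (fun g g' hgg => by
    funext p
    exact (of_eq_of_iff f.le g g').1 (by simpa [of] using Quotient.sound' hgg) p)

theorem toFun_of (h : m ≤ n) (g : TwistedHoughton k n) (p : Cells k m) :
    (of h g).toFun p = g.1 (cellsUp h p) := rfl

theorem ext_toFun {f f' : HoughtonHom k m n} (h : ∀ p, f.toFun p = f'.toFun p) : f = f' := by
  obtain ⟨hle, g, rfl⟩ := f.exists_of
  obtain ⟨_, g', rfl⟩ := f'.exists_of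
  exact (of_eq_of_iff hle g g').2 h

/-- Composition (in diagrammatic order) of the classes of `f` and `g` is the class of
`g ∘ (f ⊕ id)`. -/
def comp (f : HoughtonHom k m n) (g : HoughtonHom k n o) : HoughtonHom k m o :=
  Quotient.liftOn₂' f.cls g.cls
    (fun a b => of (f.le.trans g.le) (b * actOnFirst k (Nat.add_sub_of_le g.le) a))
    (fun a b a' b' ha hb => by
      rw [of_eq_of_iff]
      intro p
      have h1 := (of_eq_of_iff f.le a a').1 (by simpa [of] using Quotient.sound' ha) p
      have h2 := (of_eq_of_iff g.le b b').1 (by simpa [of] using Quotient.sound' hb)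
      have e : ∀ a : TwistedHoughton k n,
          (actOnFirst k (Nat.add_sub_of_le g.le) a).1 (cellsUp (f.le.trans g.le) p) =
            cellsUp g.le (a.1 (cellsUp f.le p)) :=
        fun a => actOnFirst_apply _ g.le a (cellsUp f.le p)
      change b.1 ((actOnFirst k (Nat.add_sub_of_le g.le) a).1 _) =
        b'.1 ((actOnFirst k (Nat.add_sub_of_le g.le) a').1 _)
      rw [e, e, h1, h2])

theorem toFun_comp (f : HoughtonHom k m n) (g : HoughtonHom k n o) (p : Cells k m) :
    (f.comp g).toFun p = g.toFun (f.toFun p) := by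
  obtain ⟨hf, a, rfl⟩ := f.exists_of
  obtain ⟨hg, b, rfl⟩ := g.exists_of
  exact congrArg b.1 (actOnFirst_apply _ hg a (cellsUp hf p))

/-- A permutation of `[n]` acts on `ℕ^k × [n]` by permuting the copies. -/
def permuteCopies (k : ℕ) {n : ℕ} (c : Equiv.Perm (Fin n)) : TwistedHoughton k n :=
  ⟨Equiv.prodCongr (Equiv.refl _) c, isPiecewiseTranslation_copy c⟩

/-- For `m ≤ m'` and `n ≤ n'`, the permutation of `[m' + n']` that exchanges the second and the
third of the four consecutive blocks of lengths `m`, `n`, `m' - m` and `n' - n`. -/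
def shuffle (hm : m ≤ m') (hn : n ≤ n') : Equiv.Perm (Fin (m' + n')) where
  toFun v := if v.1 < m then v else if h : v.1 < m + n then ⟨v.1 + (m' - m), by omega⟩ else
    if h : v.1 < m' + n then ⟨v.1 - n, by omega⟩ else v
  invFun v := if v.1 < m then v else if h : v.1 < m' then ⟨v.1 + n, by omega⟩ else
    if h : v.1 < m' + n then ⟨v.1 - (m' - m), by omega⟩ else v
  left_inv v := by
    apply Fin.ext
    by_cases h1 : v.1 < m <;> by_cases h2 : v.1 < m + n <;> by_cases h3 : v.1 < m' + n <;>
      by_cases h4 : v.1 < m' <;> grind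
  right_inv v := by
    apply Fin.ext
    by_cases h1 : v.1 < m <;> by_cases h2 : v.1 < m + n <;> by_cases h3 : v.1 < m' + n <;>
      by_cases h4 : v.1 < m' <;> grind

theorem shuffle_inl (hm : m ≤ m') (hn : n ≤ n') (p : Cells k m) :
    (permuteCopies k (shuffle hm hn)).1 (cellsUp (Nat.add_le_add hm hn) (cellsInl n p)) =
      cellsInl n' (cellsUp hm p) := by
  refine Prod.ext rfl (Fin.ext ?_)
  simp [permuteCopies, shuffle, cellsUp, cellsInl]

theorem shuffle_inr (hm : m ≤ m') (hn : n ≤ n') (p : Cells k n) :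
    (permuteCopies k (shuffle hm hn)).1 (cellsUp (Nat.add_le_add hm hn) (cellsInr m p)) =
      cellsInr m' (cellsUp hn p) := by
  refine Prod.ext rfl (Fin.ext ?_)
  simp [permuteCopies, shuffle, cellsUp, cellsInr]
  omega

/-- The sum of two morphisms: the block sum of representatives, composed with the permutation of
the copies that brings the `m + n` copies of the source to their places. -/
def tensor (f : HoughtonHom k m m') (g : HoughtonHom k n n') : HoughtonHom k (m + n) (m' + n') :=
  Quotient.liftOn₂' f.cls g.cls
    (fun a b => of (Nat.add_le_add f.le g.le)
      (blockSum k m' n' (a, b) * permuteCopies k (shuffle f.le g.le)))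
    (fun a b a' b' ha hb => by
      rw [of_eq_of_iff]
      intro p
      have h1 := (of_eq_of_iff f.le a a').1 (by simpa [of] using Quotient.sound' ha)
      have h2 := (of_eq_of_iff g.le b b').1 (by simpa [of] using Quotient.sound' hb)
      change (blockSum k m' n' (a, b)).1 ((permuteCopies k (shuffle f.le g.le)).1 _) =
        (blockSum k m' n' (a', b')).1 ((permuteCopies k (shuffle f.le g.le)).1 _)
      induction p using cells_cases with
      | hl p => rw [shuffle_inl, blockSum_inl, blockSum_inl, h1]
      | hr p => rw [shuffle_inr, blockSum_inr, blockSum_inr, h2])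

theorem toFun_tensor_inl (f : HoughtonHom k m m') (g : HoughtonHom k n n') (p : Cells k m) :
    (f.tensor g).toFun (cellsInl n p) = cellsInl n' (f.toFun p) := by
  obtain ⟨hf, a, rfl⟩ := f.exists_of
  obtain ⟨hg, b, rfl⟩ := g.exists_of
  change (blockSum k m' n' (a, b)).1 ((permuteCopies k (shuffle hf hg)).1 _) = _
  rw [shuffle_inl, blockSum_inl]
  rfl

theorem toFun_tensor_inr (f : HoughtonHom k m m') (g : HoughtonHom k n n') (p : Cells k n) :
    (f.tensor g).toFun (cellsInr m p) = cellsInr m' (g.toFun p) := by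
  obtain ⟨hf, a, rfl⟩ := f.exists_of
  obtain ⟨hg, b, rfl⟩ := g.exists_of
  change (blockSum k m' n' (a, b)).1 ((permuteCopies k (shuffle hf hg)).1 _) = _
  rw [shuffle_inr, blockSum_inr]
  rfl

end HoughtonHom

/-- The Houghton category in dimension `k`: its objects are the natural numbers. -/
structure HoughtonCat (k : ℕ) : Type where
  rank : ℕ

namespace HoughtonCat

variable {k : ℕ}

instance : Category (HoughtonCat k) where
  Hom X Y := HoughtonHom k X.rank Y.rank
  id X := HoughtonHom.of le_rfl 1
  comp f g := f.comp g
  id_comp f := HoughtonHom.ext_toFun fun p => by rw [HoughtonHom.toFun_comp]; rfl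
  comp_id f := HoughtonHom.ext_toFun fun p => by rw [HoughtonHom.toFun_comp]; rfl
  assoc f g h := HoughtonHom.ext_toFun fun p => by simp only [HoughtonHom.toFun_comp]

/-- The map `ℕ^k × [m] → ℕ^k × [n]` underlying a morphism. -/
def map {X Y : HoughtonCat k} (f : X ⟶ Y) : Cells k X.rank → Cells k Y.rank :=
  HoughtonHom.toFun f

theorem hom_ext {X Y : HoughtonCat k} {f g : X ⟶ Y} (h : ∀ p, map f p = map g p) : f = g :=
  HoughtonHom.ext_toFun h

theorem map_comp {X Y Z : HoughtonCat k} (f : X ⟶ Y) (g : Y ⟶ Z) (p : Cells k X.rank) :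
    map (f ≫ g) p = map g (map f p) := HoughtonHom.toFun_comp f g p

theorem map_id (X : HoughtonCat k) (p : Cells k X.rank) : map (𝟙 X) p = p := rfl

/-- The isomorphism coming from an equality of ranks. -/
def isoOfEq {X Y : HoughtonCat k} (h : X.rank = Y.rank) : X ≅ Y where
  hom := HoughtonHom.of h.le 1
  inv := HoughtonHom.of h.ge 1
  hom_inv_id := hom_ext fun p => by rw [map_comp]; rfl
  inv_hom_id := hom_ext fun p => by rw [map_comp]; rfl

theorem map_isoOfEq_hom {X Y : HoughtonCat k} (h : X.rank = Y.rank) (p : Cells k X.rank) :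
    map (isoOfEq h).hom p = (p.1, Fin.cast h p.2) := rfl

theorem map_isoOfEq_inv {X Y : HoughtonCat k} (h : X.rank = Y.rank) (p : Cells k Y.rank) :
    map (isoOfEq h).inv p = (p.1, Fin.cast h.symm p.2) := rfl

/-- The strict monoidal structure given by addition on objects and by sums of morphisms. -/
instance : MonoidalCategoryStruct (HoughtonCat k) where
  tensorObj X Y := ⟨X.rank + Y.rank⟩
  tensorUnit := ⟨0⟩
  tensorHom f g := HoughtonHom.tensor f g
  whiskerLeft X _ _ g := HoughtonHom.tensor (𝟙 X) g
  whiskerRight f Y := HoughtonHom.tensor f (𝟙 Y)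
  associator X Y Z := isoOfEq (Nat.add_assoc X.rank Y.rank Z.rank)
  leftUnitor X := isoOfEq (Nat.zero_add X.rank)
  rightUnitor X := isoOfEq (Nat.add_zero X.rank)

/-- The inclusion of the copies of the first summand. -/
def inl {X : HoughtonCat k} (Y : HoughtonCat k) (p : Cells k X.rank) : Cells k (X ⊗ Y).rank :=
  cellsInl Y.rank p

/-- The inclusion of the copies of the second summand. -/
def inr (X : HoughtonCat k) {Y : HoughtonCat k} (p : Cells k Y.rank) : Cells k (X ⊗ Y).rank :=
  cellsInr X.rank p

theorem inl_inr_cases {X Y : HoughtonCat k} {C : Cells k (X ⊗ Y).rank → Prop}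
    (hl : ∀ p, C (inl Y p)) (hr : ∀ p, C (inr X p)) (q : Cells k (X ⊗ Y).rank) : C q :=
  cells_cases (C := C) hl hr q

variable {X X' Y Y' Z : HoughtonCat k}

theorem map_tensorHom_inl (f : X ⟶ X') (g : Y ⟶ Y') (p : Cells k X.rank) :
    map (f ⊗ₘ g) (inl Y p) = inl Y' (map f p) :=
  HoughtonHom.toFun_tensor_inl f g p

theorem map_tensorHom_inr (f : X ⟶ X') (g : Y ⟶ Y') (p : Cells k Y.rank) :
    map (f ⊗ₘ g) (inr X p) = inr X' (map g p) :=
  HoughtonHom.toFun_tensor_inr f g p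

theorem map_associator_inl_inl (p : Cells k X.rank) :
    map (α_ X Y Z).hom (inl Z (inl Y p)) = inl (Y ⊗ Z) p := rfl

theorem map_associator_inl_inr (p : Cells k Y.rank) :
    map (α_ X Y Z).hom (inl Z (inr X p)) = inr X (inl Z p) := rfl

theorem map_associator_inr (p : Cells k Z.rank) :
    map (α_ X Y Z).hom (inr (X ⊗ Y) p) = inr X (inr Y p) :=
  Prod.ext rfl (Fin.ext (Nat.add_assoc X.rank Y.rank p.2))

theorem map_leftUnitor_inr (p : Cells k X.rank) :
    map (λ_ X).hom (inr (𝟙_ (HoughtonCat k)) p) = p :=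
  Prod.ext rfl (Fin.ext (Nat.zero_add p.2))

theorem map_rightUnitor_inl (p : Cells k X.rank) :
    map (ρ_ X).hom (inl (𝟙_ (HoughtonCat k)) p) = p := rfl

instance : MonoidalCategory (HoughtonCat k) :=
  MonoidalCategory.ofTensorHom
    (id_tensorHom_id := fun X Y => hom_ext fun p => by
      induction p using inl_inr_cases with
      | hl p => rw [map_tensorHom_inl]; rfl
      | hr p => rw [map_tensorHom_inr]; rfl)
    (id_tensorHom := fun X _ _ f => rfl)
    (tensorHom_id := fun f Y => rfl)
    (tensorHom_comp_tensorHom := fun f₁ f₂ g₁ g₂ => hom_ext fun p => by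
      induction p using inl_inr_cases with
      | hl p => simp only [map_comp, map_tensorHom_inl]
      | hr p => simp only [map_comp, map_tensorHom_inr])
    (associator_naturality := fun f₁ f₂ f₃ => hom_ext fun p => by
      induction p using inl_inr_cases with
      | hl p =>
        induction p using inl_inr_cases with
        | hl p => simp only [map_comp, map_tensorHom_inl, map_associator_inl_inl]
        | hr p => simp only [map_comp, map_tensorHom_inl, map_tensorHom_inr,
            map_associator_inl_inr]
      | hr p => simp only [map_comp, map_tensorHom_inr, map_associator_inr])
    (leftUnitor_naturality := fun f => hom_ext fun p => by
      induction p using inl_inr_cases with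
      | hl p => exact Fin.elim0 p.2
      | hr p => simp only [map_comp, map_tensorHom_inr, map_leftUnitor_inr])
    (rightUnitor_naturality := fun f => hom_ext fun p => by
      induction p using inl_inr_cases with
      | hl p => simp only [map_comp, map_tensorHom_inl, map_rightUnitor_inl]
      | hr p => exact Fin.elim0 p.2)
    (pentagon := fun W X Y Z => hom_ext fun p => by
      induction p using inl_inr_cases with
      | hl p =>
        induction p using inl_inr_cases with
        | hl p =>
          induction p using inl_inr_cases with
          | hl p => simp only [map_comp, map_id, map_tensorHom_inl, map_associator_inl_inl]
          | hr p => simp only [map_comp, map_tensorHom_inl, map_tensorHom_inr,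
              map_associator_inl_inl, map_associator_inl_inr]
        | hr p => simp only [map_comp, map_tensorHom_inl, map_tensorHom_inr,
              map_associator_inl_inr, map_associator_inr]
      | hr p => simp only [map_comp, map_id, map_tensorHom_inr, map_associator_inr])
    (triangle := fun X Y => hom_ext fun p => by
      induction p using inl_inr_cases with
      | hl p =>
        induction p using inl_inr_cases with
        | hl p => simp only [map_comp, map_id, map_tensorHom_inl, map_associator_inl_inl,
            map_rightUnitor_inl]
        | hr p => exact Fin.elim0 p.2
      | hr p => simp only [map_comp, map_id, map_tensorHom_inr, map_associator_inr,
            map_leftUnitor_inr])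

/-- The unit object `0` is initial. -/
def isInitialUnit (k : ℕ) : Limits.IsInitial (𝟙_ (HoughtonCat k)) :=
  Limits.IsInitial.ofUniqueHom (fun X => HoughtonHom.of (Nat.zero_le X.rank) 1)
    (fun _ _ => hom_ext fun p => Fin.elim0 p.2)

end HoughtonCat

/-! ### The simplicial complexes `S_n(A, X)` of a monoidal category with initial unit -/

section SComplex

variable {C : Type*} [Category C] [MonoidalCategory C]

/-- The `n`-fold sum `X ⊕ ⋯ ⊕ X`. -/
def tensorPow (X : C) : ℕ → C
  | 0 => 𝟙_ C
  | n + 1 => tensorPow X n ⊗ X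

/-- The morphism `i_j = ι ⊕ id ⊕ ι : X = 0 ⊕ X ⊕ 0 ⟶ X ⊕ ⋯ ⊕ X` onto the `j`-th summand, where
`ι` stands for the unique morphisms from the initial object `0`. -/
def summand (hI : Limits.IsInitial (𝟙_ C)) (X : C) : (n : ℕ) → Fin n → (X ⟶ tensorPow X n)
  | 0, j => Fin.elim0 j
  | n + 1, j => Fin.lastCases (motive := fun _ => X ⟶ tensorPow X n ⊗ X)
      ((λ_ X).inv ≫ (hI.to (tensorPow X n) ⊗ₘ 𝟙 X))
      (fun i => summand hI X n i ≫ (ρ_ (tensorPow X n)).inv ≫ (𝟙 (tensorPow X n) ⊗ₘ hI.to X)) j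

theorem summand_last (hI : Limits.IsInitial (𝟙_ C)) (X : C) (n : ℕ) :
    summand hI X (n + 1) (Fin.last n) = (λ_ X).inv ≫ (hI.to (tensorPow X n) ⊗ₘ 𝟙 X) := by
  simp only [summand, Fin.lastCases_last]
  rfl

theorem summand_castSucc (hI : Limits.IsInitial (𝟙_ C)) (X : C) (n : ℕ) (i : Fin n) :
    summand hI X (n + 1) i.castSucc =
      summand hI X n i ≫ (ρ_ (tensorPow X n)).inv ≫ (𝟙 (tensorPow X n) ⊗ₘ hI.to X) := by
  simp only [summand, Fin.lastCases_castSucc]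
  rfl

theorem last_comp_tensor (hI : Limits.IsInitial (𝟙_ C)) (X : C) {P Q : C} (φ : P ⟶ Q) :
    ((λ_ X).inv ≫ (hI.to P ⊗ₘ 𝟙 X)) ≫ (φ ⊗ₘ 𝟙 X) = (λ_ X).inv ≫ (hI.to Q ⊗ₘ 𝟙 X) := by
  rw [Category.assoc, MonoidalCategory.tensorHom_comp_tensorHom, Category.comp_id,
    hI.hom_ext (hI.to P ≫ φ) (hI.to Q)]

theorem castSucc_comp_tensor (hI : Limits.IsInitial (𝟙_ C)) (X : C) {P Q : C} (φ : P ⟶ Q)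
    (s : X ⟶ P) :
    (s ≫ (ρ_ P).inv ≫ (𝟙 P ⊗ₘ hI.to X)) ≫ (φ ⊗ₘ 𝟙 X) =
      (s ≫ φ) ≫ (ρ_ Q).inv ≫ (𝟙 Q ⊗ₘ hI.to X) := by
  simp only [Category.assoc]
  congr 1
  rw [MonoidalCategory.tensorHom_comp_tensorHom, Category.id_comp, Category.comp_id,
    MonoidalCategory.rightUnitor_inv_naturality_assoc, ← MonoidalCategory.tensorHom_id,
    MonoidalCategory.tensorHom_comp_tensorHom, Category.comp_id, Category.id_comp]

theorem exists_select_summands (hI : Limits.IsInitial (𝟙_ C)) (X : C) (n : ℕ)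
    (J : Set (Fin n)) : ∃ (m : ℕ) (φ : tensorPow X m ⟶ tensorPow X n) (e : Fin m → Fin n),
      Function.Injective e ∧ Set.range e = J ∧
        ∀ j, summand hI X m j ≫ φ = summand hI X n (e j) := by
  induction n with
  | zero =>
    refine ⟨0, 𝟙 _, id, Function.injective_id, ?_, fun j => Fin.elim0 j⟩
    ext j
    exact Fin.elim0 j
  | succ n ih =>
    obtain ⟨m, φ, e, he, hr, h⟩ := ih {i | i.castSucc ∈ J}
    by_cases hl : Fin.last n ∈ J
    · refine ⟨m + 1, φ ⊗ₘ 𝟙 X,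
        Fin.lastCases (motive := fun _ => Fin (n + 1)) (Fin.last n) (fun j => (e j).castSucc),
        ?_, ?_, ?_⟩
      · intro a b
        induction a using Fin.lastCases <;> induction b using Fin.lastCases <;>
          simp [he.eq_iff, Fin.castSucc_ne_last, (Fin.castSucc_ne_last _).symm]
      · ext i
        constructor
        · rintro ⟨a, rfl⟩
          induction a using Fin.lastCases with
          | last => simpa using hl
          | cast a =>
            have : e a ∈ {i | Fin.castSucc i ∈ J} := hr ▸ Set.mem_range_self a
            simpa using this
        · intro hi
          induction i using Fin.lastCases with
          | last => exact ⟨Fin.last m, by simp⟩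
          | cast i =>
            have : i ∈ Set.range e := hr ▸ hi
            obtain ⟨a, rfl⟩ := this
            exact ⟨a.castSucc, by simp⟩
      · intro j
        induction j using Fin.lastCases with
        | last =>
          rw [Fin.lastCases_last, summand_last, summand_last]
          exact last_comp_tensor hI X φ
        | cast j =>
          rw [Fin.lastCases_castSucc, summand_castSucc, summand_castSucc, ← h]
          exact castSucc_comp_tensor hI X φ _
    · refine ⟨m, φ ≫ (ρ_ (tensorPow X n)).inv ≫ (𝟙 (tensorPow X n) ⊗ₘ hI.to X),
        fun j => (e j).castSucc, ?_, ?_, ?_⟩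
      · exact (Fin.castSucc_injective n).comp he
      · ext i
        constructor
        · rintro ⟨a, rfl⟩
          have : e a ∈ {i | Fin.castSucc i ∈ J} := hr ▸ Set.mem_range_self a
          exact this
        · intro hi
          induction i using Fin.lastCases with
          | last => exact absurd hi hl
          | cast i =>
            have : i ∈ Set.range e := hr ▸ hi
            obtain ⟨a, rfl⟩ := this
            exact ⟨a, rfl⟩
      · intro j
        rw [summand_castSucc, ← h, Category.assoc]
        rfl

/-- The simplicial complex `S_n(A, X)`: its vertices are the morphisms `X ⟶ A ⊕ X^{⊕n}`, and a
set of `p + 1` vertices is a `p`-simplex if, in some order, it is `f ∘ i_0, …, f ∘ i_p` for a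
morphism `f : X^{⊕(p+1)} ⟶ A ⊕ X^{⊕n}`. -/
def sComplex (hI : Limits.IsInitial (𝟙_ C)) (A X : C) (n : ℕ) :
    AbstractSimplicialComplex (X ⟶ A ⊗ tensorPow X n) where
  faces := {s | ∃ (p : ℕ) (f : tensorPow X (p + 1) ⟶ A ⊗ tensorPow X n),
    s.card = p + 1 ∧ (s : Set (X ⟶ A ⊗ tensorPow X n)) =
      Set.range fun j => summand hI X (p + 1) j ≫ f}
  isRelLowerSet_faces := by
    classical
    rintro s ⟨p, f, hs, hsf⟩
    refine ⟨Finset.card_pos.1 (by omega), ?_⟩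
    intro t hts hne
    obtain ⟨m, φ, e, he, hr, h⟩ :=
      exists_select_summands hI X (p + 1) {j | summand hI X (p + 1) j ≫ f ∈ t}
    have hs' : s = Finset.univ.image fun j => summand hI X (p + 1) j ≫ f := by
      apply Finset.coe_injective
      rw [hsf]
      simp
    have hinj : Function.Injective fun j => summand hI X (p + 1) j ≫ f := by
      rw [← Set.injOn_univ, ← Finset.coe_univ]
      apply Finset.card_image_iff.1
      rw [← hs', hs, Finset.card_univ, Fintype.card_fin]
    have hφ : ∀ j, summand hI X m j ≫ φ ≫ f = summand hI X (p + 1) (e j) ≫ f := fun j => by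
      rw [← Category.assoc, h]
    have ht : t = Finset.univ.image fun j => summand hI X m j ≫ φ ≫ f := by
      ext v
      simp only [Finset.mem_image, Finset.mem_univ, true_and, hφ]
      constructor
      · intro hv
        have hvs : v ∈ Set.range fun j => summand hI X (p + 1) j ≫ f := hsf ▸ hts hv
        obtain ⟨j, rfl⟩ := hvs
        have hj : j ∈ Set.range e := hr ▸ hv
        obtain ⟨a, rfl⟩ := hj
        exact ⟨a, rfl⟩
      · rintro ⟨a, rfl⟩
        have : e a ∈ {j | summand hI X (p + 1) j ≫ f ∈ t} := hr ▸ Set.mem_range_self a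
        exact this
    have hcard : t.card = m := by
      rw [ht, Finset.card_image_of_injective, Finset.card_univ, Fintype.card_fin]
      intro a b hab
      simp only [hφ] at hab
      exact he (hinj hab)
    obtain ⟨q, rfl⟩ : ∃ q, m = q + 1 :=
      ⟨m - 1, by have := Finset.card_pos.2 hne; omega⟩
    refine ⟨q, φ ≫ f, hcard, ?_⟩
    conv_lhs => rw [ht]
    simp
  singleton_mem g := by
    refine ⟨0, (λ_ X).hom ≫ g, rfl, ?_⟩
    have : ∀ j : Fin 1, summand hI X 1 j ≫ (λ_ X).hom ≫ g = g := by
      intro j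
      obtain rfl : j = Fin.last 0 := Subsingleton.elim _ _
      rw [summand_last]
      have : hI.to (tensorPow X 0) = 𝟙 (𝟙_ C) := hI.hom_ext _ _
      rw [this]
      change ((λ_ X).inv ≫ (𝟙 (𝟙_ C) ⊗ₘ 𝟙 X)) ≫ (λ_ X).hom ≫ g = g
      simp
    ext v
    simp [this, eq_comm]

end SComplex

/-! ### Connectivity of simplicial complexes -/

/-- The geometric realization of a simplicial complex, as a set of barycentric coordinates. -/
def Realization {ι : Type*} (K : PreAbstractSimplicialComplex ι) : Type _ :=
  {w : ι →₀ ℝ // (∀ i, 0 ≤ w i) ∧ (w.sum fun _ x => x) = 1 ∧ w.support ∈ K.faces}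

/-- The closed simplex of the realization that is spanned by `s`, with its Euclidean topology. -/
def Realization.ClosedSimplex {ι : Type*} (K : PreAbstractSimplicialComplex ι) (s : Finset ι) :
    Type _ :=
  {w : Realization K // w.1.support ⊆ s}

instance {ι : Type*} (K : PreAbstractSimplicialComplex ι) (s : Finset ι) :
    TopologicalSpace (Realization.ClosedSimplex K s) :=
  TopologicalSpace.induced (fun w (i : ι) => w.1.1 i) Pi.topologicalSpace

/-- The weak topology: a set is open if and only if it meets every closed simplex in an open
subset of that simplex. -/
instance {ι : Type*} (K : PreAbstractSimplicialComplex ι) : TopologicalSpace (Realization K) :=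
  ⨆ s : K.faces, TopologicalSpace.coinduced
    (fun w : Realization.ClosedSimplex K s.1 => w.1) inferInstance

/-- A space is `q`-connected (for a rational number `q`) if it is non-empty in case `-1 ≤ q`, and
every map from the `i`-sphere to it is homotopic to a constant map, for all `0 ≤ i ≤ q`. -/
def IsConnectedUpTo (q : ℚ) (Z : Type*) [TopologicalSpace Z] : Prop :=
  (-1 ≤ q → Nonempty Z) ∧ ∀ i : ℕ, (i : ℚ) ≤ q →
    ∀ f : C(Metric.sphere (0 : EuclideanSpace ℝ (Fin (i + 1))) 1, Z), f.Nullhomotopic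

/-- Condition LH3 at `(A, X)` for a given slope: for all `n ≥ 1`, the complex `S_n(A, X)` is
`((n - 2) / slope)`-connected. -/
def LH3 {C : Type*} [Category C] [MonoidalCategory C] (hI : Limits.IsInitial (𝟙_ C)) (A X : C)
    (slope : ℕ) : Prop :=
  ∀ n : ℕ, 1 ≤ n → IsConnectedUpTo (((n : ℚ) - 2) / slope)
    (Realization (sComplex hI A X n).toPreAbstractSimplicialComplex)

/-! ### Fin-retractions -/

section FinRetraction

variable {ι κ : Type*}

/-- The `d`-skeleton: all simplices of dimension at most `d`. -/
def skeleton (d : ℤ) (K : PreAbstractSimplicialComplex ι) : PreAbstractSimplicialComplex ι where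
  faces := {s | s ∈ K.faces ∧ (s.card : ℤ) ≤ d + 1}
  isRelLowerSet_faces := by
    rintro s ⟨hs, hd⟩
    refine ⟨(K.isRelLowerSet_faces hs).1, fun t hts hne =>
      ⟨(K.isRelLowerSet_faces hs).2 hts hne, ?_⟩⟩
    have := Finset.card_le_card hts
    omega

open Classical in
/-- `τ` is a simplex of the link of the simplex `σ` in `K`. -/
def InLink (K : PreAbstractSimplicialComplex ι) (σ τ : Finset ι) : Prop :=
  τ ∈ K.faces ∧ Disjoint σ τ ∧ σ ∪ τ ∈ K.faces

open Classical in
/-- A map on vertices is simplicial if it maps simplices to simplices. -/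
def IsSimplicialMap (K : PreAbstractSimplicialComplex ι) (L : PreAbstractSimplicialComplex κ)
    (π : ι → κ) : Prop :=
  ∀ σ ∈ K.faces, σ.image π ∈ L.faces

open Classical in
/-- `ρ` is an `S`-section of `π : K → L`: a simplicial section such that a simplex `τ` of `L` lies
in the link of `π σ` if and only if `ρ τ` lies in the link of `σ`, for all simplices `σ` of `K`
with vertices in `S`. -/
structure IsSSection (K : PreAbstractSimplicialComplex ι) (L : PreAbstractSimplicialComplex κ)
    (π : ι → κ) (S : Set ι) (ρ : κ → ι) : Prop where
  simplicial : IsSimplicialMap L K ρ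
  right_inv : ∀ v, {v} ∈ L.faces → π (ρ v) = v
  link_iff : ∀ σ ∈ K.faces, (σ : Set ι) ⊆ S → ∀ τ ∈ L.faces,
    (InLink L (σ.image π) τ ↔ InLink K σ (τ.image ρ))

open Classical in
/-- `π : K → L` is a fin-retraction: a surjective simplicial map that has an `S`-section for every
finite set `S` of vertices of `K`. -/
structure IsFinRetraction (K : PreAbstractSimplicialComplex ι) (L : PreAbstractSimplicialComplex κ)
    (π : ι → κ) : Prop where
  simplicial : IsSimplicialMap K L π
  surjective : ∀ τ ∈ L.faces, ∃ σ ∈ K.faces, σ.image π = τ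
  exists_section : ∀ S : Set ι, S.Finite → (∀ v ∈ S, {v} ∈ K.faces) →
    ∃ ρ : κ → ι, IsSSection K L π S ρ

end FinRetraction

/-! ### The complexes of the Houghton category -/

namespace HoughtonCat

/-- The complex `S_n(A, X)` of the Houghton category for `A = a` and `X = 1`. -/
abbrev houghtonComplex (k a n : ℕ) :=
  sComplex (isInitialUnit k) (⟨a⟩ : HoughtonCat k) ⟨1⟩ n

/-- A morphism `f` with source `1` sends a `k`-dimensional ray of `ℕ^k` by a translation to the
copy of `ℕ^k` with index `i` (counted from `0`). -/
def IsLeadingCopy {k : ℕ} {Y : HoughtonCat k} (f : (⟨1⟩ : HoughtonCat k) ⟶ Y) (i : ℕ) : Prop :=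
  ∃ R : Set (Cells k 1), IsRayOfDim k R ∧ IsTranslationOn (map f) R ∧
    ∀ p ∈ R, ((map f p).2 : ℕ) = i

end HoughtonCat

/-! A morphism is determined by its underlying injection. Conversely, every tame injection of `m`
copies of `ℕ^k` into `N > m` copies underlies one (`IsTame.exists_extension`): the complement of its
image consists of deep orthants in `N - m ≥ 1` copies and of finitely many classes of lower
dimension, and one orthant swallows those classes one by one, as in Hilbert's hotel. Hence, if the
target has `N = a + n` copies, a non-empty set of fewer than `N` vertices is a simplex exactly when
the images are pairwise disjoint (`pairwise_of_mem_faces`, `mem_faces_of_pairwise`). Only simplices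
with `N` vertices, the largest possible, are subject to a further condition.

A vertex `f` sends its deep points to a single copy, `vertexCopy f`, and vertices with disjoint
images have different copies. For a finite set `S` of vertices, let `ρ i` translate `ℕ^k` far out
into copy `i`. The `ρ i` are disjoint from one another, and `ρ i` is disjoint from every `f ∈ S`
whose copy is not `i` (`exists_deep_vertices`). This `ρ` is the section that a fin-retraction asks
for.

The same `ρ` gives connectivity. By compactness a sphere in the realization involves finitely many
vertices, to which the `ρ i` may be added. Every vertex of the resulting finite complex is disjoint
from all but at most one `ρ i`. Adding vertices one at a time cones off links, which are complexes
of the same kind with one dimension less; by induction the complex of disjoint families of size at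
most `N - 1` is `(N - 3)`-connected (`fills_geo_pairwiseFaces`). The simplices with `N` vertices are
attached along `(N - 2)`-spheres and do not disturb this. The argument thus reaches beyond the
degree `(N - 3) / 2` that is recorded.

The homotopy theory is elementary: connectivity is phrased as extension of maps from boundaries of
cubes, and the gluing theorem `Fills.of_open_cover` comes from a fine cubical subdivision of a
collar. -/

section CubesAndRealizations

/-! ### Connectivity as extension of maps from boundaries of cubes -/

open Metric Set

/-- Every map to `A` from the boundary of a cube of dimension at most `m` extends to the cube; in
other words, `A` is `(m - 1)`-connected. Cubes are unit balls for the supremum norm. -/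
def Fills {E : Type*} [TopologicalSpace E] (m : ℕ) (A : Set E) : Prop :=
  ∀ (κ : Type) [Fintype κ], Fintype.card κ ≤ m → ∀ f : (κ → ℝ) → E,
    ContinuousOn f (sphere 0 1) → MapsTo f (sphere 0 1) A →
      ∃ F : (κ → ℝ) → E, ContinuousOn F (closedBall 0 1) ∧ MapsTo F (closedBall 0 1) A ∧
        EqOn F f (sphere 0 1)

section Fills

variable {E E' : Type*} [TopologicalSpace E] [TopologicalSpace E']

theorem Fills.mono {m m' : ℕ} (h : m' ≤ m) {A : Set E} (hA : Fills m A) : Fills m' A :=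
  fun κ _ hκ => hA κ (hκ.trans h)

theorem fills_singleton (m : ℕ) (a : E) : Fills m {a} := fun _ _ _ _ _ hf =>
  ⟨fun _ => a, continuousOn_const, fun _ _ => rfl, fun _ hx => (hf hx).symm⟩

/-- A map on the boundary of a cube extends if it extends to a collar, and from the inner boundary
of the collar to the inner cube. -/
theorem exists_fill_of_annulus {κ : Type} [Fintype κ] {A : Set E} {f F G : (κ → ℝ) → E}
    (hF : ContinuousOn F {x | 1 / 2 ≤ ‖x‖ ∧ ‖x‖ ≤ 1})
    (hFA : MapsTo F {x | 1 / 2 ≤ ‖x‖ ∧ ‖x‖ ≤ 1} A) (hFf : EqOn F f (sphere 0 1))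
    (hG : ContinuousOn G (closedBall 0 1)) (hGA : MapsTo G (closedBall 0 1) A)
    (hGF : ∀ x ∈ sphere (0 : κ → ℝ) 1, G x = F ((1 / 2 : ℝ) • x)) :
    ∃ F' : (κ → ℝ) → E, ContinuousOn F' (closedBall 0 1) ∧ MapsTo F' (closedBall 0 1) A ∧
        EqOn F' f (sphere 0 1) := by
  classical
  have hn : ∀ x : κ → ℝ, ‖(2 : ℝ) • x‖ = 2 * ‖x‖ := fun x => by rw [norm_smul]; norm_num
  have hin : EqOn (fun x => if ‖x‖ ≤ 1 / 2 then G ((2 : ℝ) • x) else F x)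
      (fun x => G ((2 : ℝ) • x)) (closedBall 0 (1 / 2)) := fun x hx => by
    have : ‖x‖ ≤ 1 / 2 := by simpa using hx
    simp only [this, if_true]
  have hout : EqOn (fun x => if ‖x‖ ≤ 1 / 2 then G ((2 : ℝ) • x) else F x) F
      {x | 1 / 2 ≤ ‖x‖ ∧ ‖x‖ ≤ 1} := by
    rintro x ⟨h1, h2⟩
    by_cases h : ‖x‖ ≤ 1 / 2
    · have hx : (2 : ℝ) • x ∈ sphere (0 : κ → ℝ) 1 := by
        rw [mem_sphere_zero_iff_norm, hn]; linarith
      simp only [h, if_true]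
      rw [hGF _ hx, smul_smul]
      norm_num
    · simp only [h, if_false]
  have hcov : closedBall (0 : κ → ℝ) 1 =
      closedBall 0 (1 / 2) ∪ {x | 1 / 2 ≤ ‖x‖ ∧ ‖x‖ ≤ 1} := by
    ext x
    simp only [mem_closedBall_zero_iff, mem_union, mem_ofPred_eq]
    constructor
    · intro h
      rcases le_total ‖x‖ (1 / 2) with h' | h'
      · exact Or.inl h'
      · exact Or.inr ⟨h', h⟩
    · rintro (h | h)
      · linarith
      · exact h.2
  have hmaps : MapsTo (fun x : κ → ℝ => (2 : ℝ) • x) (closedBall 0 (1 / 2)) (closedBall 0 1) := by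
    intro x hx
    rw [mem_closedBall_zero_iff] at hx ⊢
    rw [hn]; linarith
  refine ⟨fun x => if ‖x‖ ≤ 1 / 2 then G ((2 : ℝ) • x) else F x, ?_, ?_, ?_⟩
  · rw [hcov]
    refine ContinuousOn.union_of_isClosed ?_ (hF.congr hout) isClosed_closedBall ?_
    · exact (hG.comp (by fun_prop) hmaps).congr hin
    · exact (isClosed_le continuous_const continuous_norm).inter
        (isClosed_le continuous_norm continuous_const)
  · rw [hcov]
    rintro x (hx | hx)
    · rw [hin hx]; exact hGA (hmaps hx)
    · rw [hout hx]; exact hFA hx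
  · intro x hx
    have h1 : ‖x‖ = 1 := by simpa using hx
    rw [hout ⟨by rw [h1]; norm_num, h1.le⟩, hFf hx]

theorem norm_inv_smul_mem_sphere {κ : Type*} [Fintype κ] {x : κ → ℝ} (hx : x ≠ 0) :
    ‖x‖⁻¹ • x ∈ sphere (0 : κ → ℝ) 1 := by
  rw [mem_sphere_zero_iff_norm, norm_smul, norm_inv, norm_norm, inv_mul_cancel₀ (norm_ne_zero_iff.2 hx)]

/-- `A` inherits the filling property from `B` if the identity of `A` is homotopic, along
segments, to a map that factors through `B`. -/
theorem Fills.of_dominated [AddCommGroup E] [Module ℝ E] [ContinuousAdd E] [ContinuousSMul ℝ E]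
    {m : ℕ} {A : Set E} {B : Set E'} (hB : Fills m B) (r : E → E') (s : E' → E)
    (hr : ContinuousOn r A) (hrA : MapsTo r A B) (hs : ContinuousOn s B)
    (hseg : ∀ w ∈ A, ∀ t : ℝ, 0 ≤ t → t ≤ 1 → (1 - t) • w + t • s (r w) ∈ A)
    (hsB : MapsTo s B A) : Fills m A := by
  intro κ _ hκ f hf hfA
  obtain ⟨G, hG, hGB, hGf⟩ := hB κ hκ (r ∘ f) (hr.comp hf hfA) (hrA.comp hfA)
  have hne : ∀ x ∈ {x : κ → ℝ | 1 / 2 ≤ ‖x‖ ∧ ‖x‖ ≤ 1}, x ≠ 0 := by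
    rintro x hx rfl
    have := hx.1
    norm_num at this
  have hcont : ContinuousOn (fun x : κ → ℝ => ‖x‖⁻¹ • x) {x : κ → ℝ | 1 / 2 ≤ ‖x‖ ∧ ‖x‖ ≤ 1} := by
    exact (continuous_norm.continuousOn.inv₀ fun x hx => norm_ne_zero_iff.2 (hne x hx)).smul
      continuousOn_id
  have hmaps : MapsTo (fun x : κ → ℝ => ‖x‖⁻¹ • x) {x : κ → ℝ | 1 / 2 ≤ ‖x‖ ∧ ‖x‖ ≤ 1}
      (sphere 0 1) := fun x hx => norm_inv_smul_mem_sphere (hne x hx)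
  refine exists_fill_of_annulus
    -- The homotopy parameter `2 - 2 * ‖x‖` is `0` on the outer boundary of the collar and `1` on
    -- the inner one, where the map is `s ∘ r ∘ f` and the filling in `B` takes over.
    (F := fun x => (1 - (2 - 2 * ‖x‖)) • f (‖x‖⁻¹ • x) + (2 - 2 * ‖x‖) • s (r (f (‖x‖⁻¹ • x))))
    (G := s ∘ G) ?_ ?_ ?_ (hs.comp hG hGB) (hsB.comp hGB) ?_
  · have h1 := hf.comp hcont hmaps
    have h2 := hs.comp (hr.comp h1 (hfA.comp hmaps)) (hrA.comp (hfA.comp hmaps))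
    have h3 : Continuous fun x : κ → ℝ => 2 - 2 * ‖x‖ := by fun_prop
    exact ((continuous_const.sub h3).continuousOn.smul h1).add (h3.continuousOn.smul h2)
  · rintro x hx
    exact hseg _ (hfA (hmaps hx)) _ (by linarith [hx.2]) (by linarith [hx.1])
  · intro x hx
    have h1 : ‖x‖ = 1 := by simpa using hx
    simp [h1]
  · intro x hx
    have h1 : ‖x‖ = 1 := by simpa using hx
    have h2 : ‖(1 / 2 : ℝ) • x‖ = 1 / 2 := by rw [norm_smul, h1]; norm_num
    simp only [h2, Function.comp_apply, hGf hx, smul_smul]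
    norm_num

end Fills

/-! ### The cubical grid on `ℝ^κ` -/

section Grid

variable {κ : Type*}

/-- The closed cells of the cubical decomposition of `ℝ^κ` with vertices in `ℤ^κ`; the cell `c` has
centre `c / 2`, and its free coordinates are those for which `c` is odd. -/
def gridCell (c : κ → ℤ) : Set (κ → ℝ) := {z | ∀ i, |2 * z i - c i| ≤ ((c i % 2 : ℤ) : ℝ)}

/-- The cell whose relative interior contains a given point. -/
noncomputable def cellOf (z : κ → ℝ) : κ → ℤ := fun i => ⌊z i⌋ + ⌈z i⌉

/-- The quotients are rounded down: an even `c i` gives the single point `c i / 2`, an odd one the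
unit interval around it. Inclusions of cells thereby become comparisons of integers. -/
theorem mem_gridCell_iff {c : κ → ℤ} {z : κ → ℝ} :
    z ∈ gridCell c ↔ ∀ i, ((c i / 2 : ℤ) : ℝ) ≤ z i ∧ z i ≤ (((c i + 1) / 2 : ℤ) : ℝ) := by
  refine forall_congr' fun i => ?_
  rcases Int.even_or_odd' (c i) with ⟨a, h | h⟩
  · have h1 : c i % 2 = 0 := by omega
    have h2 : c i / 2 = a := by omega
    have h3 : (c i + 1) / 2 = a := by omega
    rw [h1, h2, h3, abs_le, h]
    push_cast
    constructor <;> rintro ⟨h4, h5⟩ <;> constructor <;> linarith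
  · have h1 : c i % 2 = 1 := by omega
    have h2 : c i / 2 = a := by omega
    have h3 : (c i + 1) / 2 = a + 1 := by omega
    rw [h1, h2, h3, abs_le, h]
    push_cast
    constructor <;> rintro ⟨h4, h5⟩ <;> constructor <;> linarith

theorem mem_gridCell_cellOf (z : κ → ℝ) : z ∈ gridCell (cellOf z) := by
  rw [mem_gridCell_iff]
  intro i
  have h1 := Int.floor_le_ceil (z i)
  have h2 := Int.ceil_le_floor_add_one (z i)
  have h3 : cellOf z i / 2 = ⌊z i⌋ := by simp only [cellOf]; omega
  have h4 : (cellOf z i + 1) / 2 = ⌈z i⌉ := by simp only [cellOf]; omega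
  rw [h3, h4]
  exact ⟨Int.floor_le _, Int.le_ceil _⟩

theorem gridCell_subset_iff {c c' : κ → ℤ} :
    gridCell c ⊆ gridCell c' ↔ ∀ i, c' i / 2 ≤ c i / 2 ∧ (c i + 1) / 2 ≤ (c' i + 1) / 2 := by
  constructor
  · intro h i
    have h1 : (fun j => ((c j / 2 : ℤ) : ℝ)) ∈ gridCell c := by
      rw [mem_gridCell_iff]
      exact fun j => ⟨le_rfl, by exact_mod_cast (by omega)⟩
    have h2 : (fun j => (((c j + 1) / 2 : ℤ) : ℝ)) ∈ gridCell c := by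
      rw [mem_gridCell_iff]
      exact fun j => ⟨by exact_mod_cast (by omega), le_rfl⟩
    exact ⟨by exact_mod_cast (mem_gridCell_iff.1 (h h1) i).1,
      by exact_mod_cast (mem_gridCell_iff.1 (h h2) i).2⟩
  · intro h z hz
    rw [mem_gridCell_iff] at hz ⊢
    intro i
    have h1 : ((c' i / 2 : ℤ) : ℝ) ≤ ((c i / 2 : ℤ) : ℝ) := by exact_mod_cast (h i).1
    have h2 : (((c i + 1) / 2 : ℤ) : ℝ) ≤ (((c' i + 1) / 2 : ℤ) : ℝ) := by exact_mod_cast (h i).2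
    exact ⟨h1.trans (hz i).1, (hz i).2.trans h2⟩

theorem gridCell_injective : Function.Injective (gridCell (κ := κ)) := by
  intro c c' h
  have h1 := gridCell_subset_iff.1 h.subset
  have h2 := gridCell_subset_iff.1 h.superset
  funext i
  have := h1 i
  have := h2 i
  omega

/-- Floor and ceiling respect integer bounds, so `cellOf z` is the smallest cell that contains `z`.
-/
theorem gridCell_cellOf_subset {c : κ → ℤ} {z : κ → ℝ} (hz : z ∈ gridCell c) :
    gridCell (cellOf z) ⊆ gridCell c := by
  rw [gridCell_subset_iff]
  rw [mem_gridCell_iff] at hz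
  intro i
  have h1 := Int.floor_le_ceil (z i)
  have h2 := Int.ceil_le_floor_add_one (z i)
  have h3 := Int.le_floor.2 (hz i).1
  have h4 := Int.ceil_le.2 (hz i).2
  simp only [cellOf]
  omega

theorem centre_mem_gridCell (c : κ → ℤ) : (fun i => (c i : ℝ) / 2) ∈ gridCell c := by
  intro i
  have : (0 : ℝ) ≤ ((c i % 2 : ℤ) : ℝ) := by exact_mod_cast Int.emod_nonneg _ two_ne_zero
  simpa [mul_div_cancel₀] using this

theorem isClosed_gridCell (c : κ → ℤ) : IsClosed (gridCell c) := by
  have : gridCell c = ⋂ i, {z : κ → ℝ | |2 * z i - c i| ≤ ((c i % 2 : ℤ) : ℝ)} := by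
    ext z
    simp [gridCell]
  rw [this]
  exact isClosed_iInter fun i => isClosed_le (by fun_prop) continuous_const

/-- A point of a cell lies in its relative interior if and only if no free coordinate is extremal. -/
theorem cellOf_eq_iff {c : κ → ℤ} {z : κ → ℝ} (hz : z ∈ gridCell c) :
    cellOf z = c ↔ ∀ i, Odd (c i) → |2 * z i - c i| < 1 := by
  constructor
  · rintro h i ⟨a, ha⟩
    have h1 := congrFun h i
    simp only [cellOf] at h1
    have h2 := Int.floor_le (z i)
    have h3 := Int.le_ceil (z i)
    have h4 := Int.lt_floor_add_one (z i)
    have h5 := Int.ceil_lt_add_one (z i)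
    have h6 := Int.floor_le_ceil (z i)
    have h7 := Int.ceil_le_floor_add_one (z i)
    have h8 : ⌊z i⌋ = a := by omega
    have h9 : ⌈z i⌉ = a + 1 := by omega
    rw [h8] at h4
    rw [h9] at h5
    have h10 : (a : ℝ) < z i := by push_cast at h5; linarith
    rw [abs_lt, ha]
    push_cast
    constructor <;> linarith
  · intro h
    funext i
    have hzi := hz i
    rcases Int.even_or_odd' (c i) with ⟨a, ha | ha⟩
    · have h1 : c i % 2 = 0 := by omega
      rw [h1, ha, Int.cast_zero] at hzi
      have h2 : z i = a := by
        have := abs_nonpos_iff.1 hzi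
        push_cast at this
        linarith
      simp only [cellOf, h2, Int.floor_intCast, Int.ceil_intCast]
      omega
    · have h1 := h i ⟨a, ha⟩
      rw [ha, abs_lt] at h1
      push_cast at h1
      have h2 : ⌊z i⌋ = a := Int.floor_eq_iff.2 ⟨by linarith, by linarith⟩
      have h3 : ⌈z i⌉ = a + 1 := Int.ceil_eq_iff.2 ⟨by push_cast; linarith, by push_cast; linarith⟩
      simp only [cellOf, h2, h3]
      omega

end Grid

/-! ### Extension over finite cubical complexes -/

section CellFilling

variable {κ : Type} [Fintype κ] {E : Type*} [TopologicalSpace E]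

/-- The dimension of a cell. -/
noncomputable def cellDim (c : κ → ℤ) : ℕ := Fintype.card {i // Odd (c i)}

/-- The odd coordinates, rescaled to `[-1, 1]`, identify the cell with a unit ball for the supremum
norm and its relative boundary with the unit sphere, so the filling property applies directly. -/
theorem Fills.exists_extend_cell {c : κ → ℤ} {W : Set E} (hW : Fills (cellDim c) W)
    {g : (κ → ℝ) → E} (hg : ContinuousOn g {z ∈ gridCell c | cellOf z ≠ c})
    (hgW : MapsTo g {z ∈ gridCell c | cellOf z ≠ c} W) :
    ∃ G : (κ → ℝ) → E, ContinuousOn G (gridCell c) ∧ MapsTo G (gridCell c) W ∧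
      EqOn G g {z ∈ gridCell c | cellOf z ≠ c} := by
  classical
  let φ : ({i // Odd (c i)} → ℝ) → κ → ℝ := fun x i =>
    if h : Odd (c i) then ((c i : ℝ) + x ⟨i, h⟩) / 2 else (c i : ℝ) / 2
  let ψ : (κ → ℝ) → {i // Odd (c i)} → ℝ := fun z i => 2 * z i.1 - c i.1
  have hφ : Continuous φ := by
    refine continuous_pi fun i => ?_
    by_cases h : Odd (c i)
    · simp only [φ, h, dif_pos]
      fun_prop
    · simp only [φ, h, dif_neg, not_false_eq_true]
      fun_prop
  have hψ : Continuous ψ := by fun_prop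
  have hodd : ∀ i, Odd (c i) → ((c i % 2 : ℤ) : ℝ) = 1 := fun i h => by
    rw [Int.odd_iff.1 h, Int.cast_one]
  have heven : ∀ i, ¬ Odd (c i) → ((c i % 2 : ℤ) : ℝ) = 0 := fun i h => by
    rw [Int.even_iff.1 (Int.not_odd_iff_even.1 h), Int.cast_zero]
  have hψφ : ∀ x, ψ (φ x) = x := fun x => by
    funext i
    simp only [ψ, φ, i.2, dif_pos]
    ring
  have hφψ : ∀ z ∈ gridCell c, φ (ψ z) = z := fun z hz => by
    funext i
    by_cases h : Odd (c i)
    · simp only [ψ, φ, h, dif_pos]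
      ring
    · have := hz i
      rw [heven i h] at this
      have := abs_nonpos_iff.1 this
      simp only [φ, h, dif_neg, not_false_eq_true]
      linarith
  have hφmem : ∀ x ∈ closedBall (0 : {i // Odd (c i)} → ℝ) 1, φ x ∈ gridCell c := by
    intro x hx i
    rw [mem_closedBall_zero_iff, pi_norm_le_iff_of_nonneg zero_le_one] at hx
    by_cases h : Odd (c i)
    · rw [hodd i h]
      have := congrFun (hψφ x) ⟨i, h⟩
      simp only [ψ] at this
      rw [this]
      exact hx ⟨i, h⟩
    · rw [heven i h]
      simp only [φ, h, dif_neg, not_false_eq_true]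
      rw [mul_div_cancel₀ _ two_ne_zero, sub_self, abs_zero]
  have hψmem : MapsTo ψ (gridCell c) (closedBall 0 1) := by
    intro z hz
    rw [mem_closedBall_zero_iff, pi_norm_le_iff_of_nonneg zero_le_one]
    intro i
    have := hz i.1
    rwa [hodd _ i.2] at this
  have hint : ∀ z ∈ gridCell c, (cellOf z = c ↔ ‖ψ z‖ < 1) := by
    intro z hz
    rw [cellOf_eq_iff hz, pi_norm_lt_iff zero_lt_one]
    exact ⟨fun h i => h i.1 i.2, fun h i hi => h ⟨i, hi⟩⟩
  have hφs : MapsTo φ (sphere 0 1) {z ∈ gridCell c | cellOf z ≠ c} := by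
    intro x hx
    refine ⟨hφmem x (sphere_subset_closedBall hx), ?_⟩
    rw [Ne, hint _ (hφmem x (sphere_subset_closedBall hx)), hψφ, not_lt]
    exact (mem_sphere_zero_iff_norm.1 hx).ge
  obtain ⟨F, hF, hFW, hFg⟩ := hW {i // Odd (c i)} le_rfl (g ∘ φ) (hg.comp hφ.continuousOn hφs)
    (hgW.comp hφs)
  refine ⟨F ∘ ψ, hF.comp hψ.continuousOn hψmem, hFW.comp hψmem, ?_⟩
  rintro z ⟨hz, hzc⟩
  have : ψ z ∈ sphere (0 : {i // Odd (c i)} → ℝ) 1 := by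
    rw [mem_sphere_zero_iff_norm]
    refine le_antisymm (mem_closedBall_zero_iff.1 (hψmem hz)) ?_
    rw [Ne, hint z hz, not_lt] at hzc
    exact hzc
  rw [Function.comp_apply, hFg this, Function.comp_apply, hφψ z hz]

/-- Extension of a map over a finite cubical complex, subject to a carrier `W`: on the cells in
`C₀`, the map is prescribed to be `f₀`. -/
theorem exists_extension_of_carrier (W : (κ → ℤ) → Set E)
    (hWmono : ∀ c c', gridCell c ⊆ gridCell c' → W c ⊆ W c') (f₀ : (κ → ℝ) → E)
    (C₀ : Set (κ → ℤ)) (hC₀ : ∀ c c', gridCell c ⊆ gridCell c' → c' ∈ C₀ → c ∈ C₀)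
    (hf₀ : ∀ c ∈ C₀, ContinuousOn f₀ (gridCell c)) (hf₀W : ∀ c ∈ C₀, MapsTo f₀ (gridCell c) (W c))
    (C : Finset (κ → ℤ)) (hC : ∀ c c', gridCell c ⊆ gridCell c' → c' ∈ C → c ∈ C)
    (hW : ∀ c ∈ C, c ∉ C₀ → Fills (cellDim c) (W c)) :
    ∃ F : (κ → ℝ) → E, ContinuousOn F (⋃ c ∈ C, gridCell c) ∧
      (∀ c ∈ C, MapsTo F (gridCell c) (W c)) ∧ ∀ c ∈ C, c ∈ C₀ → EqOn F f₀ (gridCell c) := by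
  classical
  induction hn : C.card generalizing C with
  | zero =>
    rw [Finset.card_eq_zero] at hn
    subst hn
    exact ⟨f₀, by simp, by simp, by simp⟩
  | succ n ih =>
    have hne : C.Nonempty := Finset.card_pos.1 (by omega)
    -- Without a maximal cell the family is still closed under faces, and its union meets that cell
    -- exactly in the relative boundary. The map on the smaller family thus prescribes boundary
    -- values and nothing else.
    obtain ⟨c, hcC, hmax⟩ := C.exists_maximalFor gridCell hne
    have hmax' : ∀ c' ∈ C, gridCell c ⊆ gridCell c' → c' = c := fun c' hc' h =>
      gridCell_injective ((hmax hc' h).antisymm h)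
    obtain ⟨F, hF, hFW, hFf⟩ := ih (C.erase c)
      (fun a b hab hb => by
        rw [Finset.mem_erase] at hb ⊢
        refine ⟨?_, hC a b hab hb.2⟩
        rintro rfl
        exact hb.1 (hmax' b hb.2 hab))
      (fun a ha => hW a (Finset.mem_of_mem_erase ha))
      (by rw [Finset.card_erase_of_mem hcC, hn]; rfl)
    have hcell : ∀ z ∈ gridCell c, cellOf z ≠ c → cellOf z ∈ C.erase c := fun z hz hzc =>
      Finset.mem_erase.2 ⟨hzc, hC _ c (gridCell_cellOf_subset hz) hcC⟩
    have hbd : {z ∈ gridCell c | cellOf z ≠ c} ⊆ ⋃ a ∈ C.erase c, gridCell a := fun z hz =>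
      mem_iUnion₂.2 ⟨cellOf z, hcell z hz.1 hz.2, mem_gridCell_cellOf z⟩
    have hinter : ∀ z ∈ gridCell c, z ∈ ⋃ a ∈ C.erase c, gridCell a → cellOf z ≠ c := by
      rintro z hz hz' rfl
      obtain ⟨c', hc', hzc'⟩ := mem_iUnion₂.1 hz'
      rw [Finset.mem_erase] at hc'
      exact hc'.1 (hmax' c' hc'.2 (gridCell_cellOf_subset hzc'))
    obtain ⟨G, hG, hGW, hGF, hGf⟩ : ∃ G : (κ → ℝ) → E, ContinuousOn G (gridCell c) ∧
        MapsTo G (gridCell c) (W c) ∧ EqOn G F {z ∈ gridCell c | cellOf z ≠ c} ∧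
        (c ∈ C₀ → EqOn G f₀ (gridCell c)) := by
      by_cases hc : c ∈ C₀
      · refine ⟨f₀, hf₀ c hc, hf₀W c hc, ?_, fun _ _ _ => rfl⟩
        rintro z ⟨hz, hzc⟩
        exact (hFf _ (hcell z hz hzc) (hC₀ _ c (gridCell_cellOf_subset hz) hc)
          (mem_gridCell_cellOf z)).symm
      · obtain ⟨G, h1, h2, h3⟩ := (hW c hcC hc).exists_extend_cell (hF.mono hbd)
          (fun z hz => hWmono _ c (gridCell_cellOf_subset hz.1)
            (hFW _ (hcell z hz.1 hz.2) (mem_gridCell_cellOf z)))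
        exact ⟨G, h1, h2, h3, fun h => absurd h hc⟩
    have e1 : EqOn ((gridCell c).piecewise G F) G (gridCell c) := piecewise_eqOn _ _ _
    have e2 : EqOn ((gridCell c).piecewise G F) F (⋃ a ∈ C.erase c, gridCell a) := by
      intro z hz
      by_cases hzc : z ∈ gridCell c
      · rw [piecewise_eq_of_mem _ _ _ hzc]
        exact hGF ⟨hzc, hinter z hzc hz⟩
      · exact piecewise_eq_of_notMem _ _ _ hzc
    have e2' : ∀ c' ∈ C, c' ≠ c → EqOn ((gridCell c).piecewise G F) F (gridCell c') :=
      fun c' hc' hcc z hz => e2 (mem_iUnion₂.2 ⟨c', Finset.mem_erase.2 ⟨hcc, hc'⟩, hz⟩)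
    refine ⟨(gridCell c).piecewise G F, ?_, fun c' hc' => ?_, fun c' hc' hc₀ => ?_⟩
    · have hU : (⋃ c' ∈ C, gridCell c') = gridCell c ∪ ⋃ c' ∈ C.erase c, gridCell c' := by
        conv_lhs => rw [← Finset.insert_erase hcC]
        exact Finset.set_biUnion_insert _ _ _
      rw [hU]
      exact (hG.congr e1).union_of_isClosed (hF.congr e2) (isClosed_gridCell c)
        (isClosed_biUnion_finset fun _ _ => isClosed_gridCell _)
    · by_cases h : c' = c
      · subst h
        exact hGW.congr e1.symm
      · exact (hFW c' (Finset.mem_erase.2 ⟨h, hc'⟩)).congr (e2' c' hc' h).symm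
    · by_cases h : c' = c
      · subst h
        exact e1.trans (hGf hc₀)
      · exact (e2' c' hc' h).trans (hFf c' (Finset.mem_erase.2 ⟨h, hc'⟩) hc₀)

end CellFilling

/-! ### The gluing theorem for open covers -/

section Gluing

variable {κ : Type} [Fintype κ] {E : Type*} [TopologicalSpace E]

theorem dist_le_one_of_mem_gridCell {c : κ → ℤ} {z z' : κ → ℝ} (hz : z ∈ gridCell c)
    (hz' : z' ∈ gridCell c) : dist z z' ≤ 1 := by
  rw [dist_pi_le_iff zero_le_one]
  intro i
  have h1 := abs_le.1 (hz i)
  have h2 := abs_le.1 (hz' i)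
  have h3 : ((c i % 2 : ℤ) : ℝ) ≤ 1 := by
    exact_mod_cast (by have := Int.emod_lt_of_pos (c i) two_pos; omega : c i % 2 ≤ 1)
  rw [Real.dist_eq, abs_le]
  constructor <;> linarith

theorem exists_norm_le_abs_apply {z : κ → ℝ} {r : ℝ} (hr : 0 < r) (hz : r ≤ ‖z‖) :
    ∃ i, r ≤ |z i| := by
  by_contra! h
  exact absurd ((pi_norm_lt_iff hr).2 h) (not_lt.2 hz)

/-- As `N` is an integer, the hyperplanes `z i = ± N` are unions of cells, so a bound by `N` passes
from a point to its whole smallest cell. -/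
theorem le_abs_of_mem_gridCell_cellOf {κ : Type*} {z z' : κ → ℝ} (hz' : z' ∈ gridCell (cellOf z)) (N : ℕ)
    {i : κ} (hi : (N : ℝ) ≤ |z i|) : (N : ℝ) ≤ |z' i| := by
  have h := (mem_gridCell_iff.1 hz') i
  have h1 := Int.floor_le_ceil (z i)
  have h2 := Int.ceil_le_floor_add_one (z i)
  have h3 : cellOf z i / 2 = ⌊z i⌋ := by simp only [cellOf]; omega
  have h4 : (cellOf z i + 1) / 2 = ⌈z i⌉ := by simp only [cellOf]; omega
  rw [h3, h4] at h
  rcases le_abs.1 hi with h5 | h5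
  · have : (N : ℤ) ≤ ⌊z i⌋ := Int.le_floor.2 (by exact_mod_cast h5)
    have : (N : ℝ) ≤ ⌊z i⌋ := by exact_mod_cast this
    exact le_abs.2 (Or.inl (by linarith))
  · have : ⌈z i⌉ ≤ -(N : ℤ) := Int.ceil_le.2 (by push_cast; linarith)
    have : (⌈z i⌉ : ℝ) ≤ -(N : ℝ) := by exact_mod_cast this
    exact le_abs.2 (Or.inr (by linarith))

theorem abs_le_of_mem_gridCell_cellOf {κ : Type*} {z z' : κ → ℝ} (hz' : z' ∈ gridCell (cellOf z)) (N : ℕ)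
    {i : κ} (hi : |z i| ≤ N) : |z' i| ≤ N := by
  have h := (mem_gridCell_iff.1 hz') i
  have h1 := Int.floor_le_ceil (z i)
  have h2 := Int.ceil_le_floor_add_one (z i)
  have h3 : cellOf z i / 2 = ⌊z i⌋ := by simp only [cellOf]; omega
  have h4 : (cellOf z i + 1) / 2 = ⌈z i⌉ := by simp only [cellOf]; omega
  rw [h3, h4] at h
  rw [abs_le] at hi ⊢
  have h5 : -(N : ℤ) ≤ ⌊z i⌋ := Int.le_floor.2 (by push_cast; linarith)
  have h6 : ⌈z i⌉ ≤ (N : ℤ) := Int.ceil_le.2 (by push_cast; linarith)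
  have h7 : -(N : ℝ) ≤ ⌊z i⌋ := by exact_mod_cast h5
  have h8 : (⌈z i⌉ : ℝ) ≤ N := by exact_mod_cast h6
  constructor <;> linarith

theorem gridCell_cellOf_subset_annulus {N : ℕ} (hN : 0 < N) {z : κ → ℝ} (h1 : (N : ℝ) ≤ ‖z‖)
    (h2 : ‖z‖ ≤ (2 * N : ℕ)) :
    gridCell (cellOf z) ⊆ {z : κ → ℝ | (N : ℝ) ≤ ‖z‖ ∧ ‖z‖ ≤ (2 * N : ℕ)} := by
  intro z' hz'
  have hN' : (0 : ℝ) < N := by exact_mod_cast hN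
  obtain ⟨i, hi⟩ := exists_norm_le_abs_apply hN' h1
  refine ⟨(le_abs_of_mem_gridCell_cellOf hz' N hi).trans (norm_le_pi_norm z' i), ?_⟩
  rw [pi_norm_le_iff_of_nonneg (by positivity)] at h2 ⊢
  exact fun i => abs_le_of_mem_gridCell_cellOf hz' (2 * N) (h2 i)

theorem cellDim_le (c : κ → ℤ) : cellDim c ≤ Fintype.card κ := Fintype.card_subtype_le _

theorem cellDim_lt {c : κ → ℤ} {i : κ} (h : ∀ z ∈ gridCell c, ∀ z' ∈ gridCell c, z i = z' i) :
    cellDim c < Fintype.card κ := by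
  refine Fintype.card_subtype_lt (x := i) ?_
  rintro ⟨a, ha⟩
  have h1 := h (fun j => ((c j / 2 : ℤ) : ℝ))
    (mem_gridCell_iff.2 fun j => ⟨le_rfl, by exact_mod_cast (by omega)⟩)
    (fun j => (((c j + 1) / 2 : ℤ) : ℝ))
    (mem_gridCell_iff.2 fun j => ⟨by exact_mod_cast (by omega), le_rfl⟩)
  have h2 : c i / 2 = (c i + 1) / 2 := by exact_mod_cast h1
  omega

theorem apply_eq_of_mem_gridCell_cellOf {κ : Type*} {z : κ → ℝ} {N : ℕ} {i : κ} (hi : |z i| = N) :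
    ∀ a ∈ gridCell (cellOf z), ∀ b ∈ gridCell (cellOf z), a i = b i := by
  have key : ∃ t : ℤ, z i = t := by
    rcases (abs_eq (by positivity)).1 hi with h | h
    · exact ⟨N, by rw [h]; simp⟩
    · exact ⟨-N, by rw [h]; simp⟩
  obtain ⟨t, ht⟩ := key
  have h1 : cellOf z i = 2 * t := by
    simp only [cellOf, ht, Int.floor_intCast, Int.ceil_intCast]
    omega
  have h2 : ∀ a ∈ gridCell (cellOf z), a i = t := by
    intro a ha
    have := ha i
    rw [h1] at this
    have e : (2 * t) % 2 = 0 := by omega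
    rw [e, Int.cast_zero] at this
    have := abs_nonpos_iff.1 this
    push_cast at this
    linarith
  intro a ha b hb
  rw [h2 a ha, h2 b hb]

/-- A fine cubical decomposition of a collar is subordinate to an open cover by two sets. -/
theorem exists_subordinate_grid {g : (κ → ℝ) → E} (hg : ContinuousOn g {0}ᶜ)
    (hscale : ∀ (t : ℝ) (x : κ → ℝ), 0 < t → g (t • x) = g x) {O₁ O₂ : Set E} (h₁ : IsOpen O₁)
    (h₂ : IsOpen O₂) (hcov : ∀ x ≠ 0, g x ∈ O₁ ∪ O₂) :
    ∃ N : ℕ, 0 < N ∧ ∀ c : κ → ℤ,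
      gridCell c ⊆ {z : κ → ℝ | (N : ℝ) ≤ ‖z‖ ∧ ‖z‖ ≤ (2 * N : ℕ)} →
      MapsTo g (gridCell c) O₁ ∨ MapsTo g (gridCell c) O₂ := by
  have hK : IsCompact {x : κ → ℝ | 1 / 2 ≤ ‖x‖ ∧ ‖x‖ ≤ 1} := by
    have : {x : κ → ℝ | 1 / 2 ≤ ‖x‖ ∧ ‖x‖ ≤ 1} = closedBall 0 1 ∩ {x | 1 / 2 ≤ ‖x‖} := by
      ext x
      simp [and_comm]
    rw [this]
    exact (isCompact_closedBall _ _).inter_right (isClosed_le continuous_const continuous_norm)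
  obtain ⟨δ, hδ, hball⟩ := lebesgue_number_lemma_of_metric
    (c := fun b : Bool => {0}ᶜ ∩ g ⁻¹' (if b then O₁ else O₂)) hK
    (fun b => hg.isOpen_inter_preimage isOpen_compl_singleton (by cases b <;> simpa))
    (fun x hx => by
      have hx0 : x ≠ 0 := by
        rintro rfl
        have := hx.1
        norm_num at this
      rcases hcov x hx0 with h | h
      · exact mem_iUnion.2 ⟨true, hx0, by simpa using h⟩
      · exact mem_iUnion.2 ⟨false, hx0, by simpa using h⟩)
  -- A cell of the collar `N ≤ ‖z‖ ≤ 2 * N`, scaled by `1 / (2 * N)`, lies within `1 / (2 * N) < δ`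
  -- of its centre, inside the collar on which `δ` is a Lebesgue number. Scale invariance of `g`
  -- returns to the original cell.
  obtain ⟨N, hN⟩ := exists_nat_gt (1 / δ)
  have hN0 : (0 : ℝ) < N := lt_trans (by positivity) hN
  refine ⟨N, by exact_mod_cast hN0, fun c hc => ?_⟩
  set z₀ : κ → ℝ := fun i => (c i : ℝ) / 2
  have hz₀ := centre_mem_gridCell c
  have hs : (0 : ℝ) < (2 * N : ℝ)⁻¹ := by positivity
  obtain ⟨b, hb⟩ := hball ((2 * N : ℝ)⁻¹ • z₀) (by
    obtain ⟨h1, h2⟩ := hc hz₀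
    push_cast at h2
    simp only [mem_ofPred_eq, norm_smul, Real.norm_of_nonneg hs.le]
    constructor
    · rw [inv_mul_eq_div, le_div_iff₀ (by positivity)]
      linarith
    · rw [inv_mul_le_iff₀ (by positivity)]
      linarith)
  have key : MapsTo g (gridCell c) (if b then O₁ else O₂) := by
    intro z hz
    have : (2 * N : ℝ)⁻¹ • z ∈ ball ((2 * N : ℝ)⁻¹ • z₀) δ := by
      rw [mem_ball, dist_smul₀, Real.norm_of_nonneg hs.le]
      have h1 := dist_le_one_of_mem_gridCell hz hz₀
      rw [div_lt_iff₀ hδ] at hN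
      rw [inv_mul_lt_iff₀ (by positivity)]
      nlinarith
    have := (hb this).2
    rwa [mem_preimage, hscale _ _ hs] at this
  cases b
  · exact Or.inr (by simpa using key)
  · exact Or.inl (by simpa using key)

theorem finite_gridCell_subset_closedBall (r : ℕ) :
    {c : κ → ℤ | gridCell c ⊆ closedBall 0 r}.Finite := by
  classical
  refine (Finset.finite_toSet (Fintype.piFinset fun _ : κ => Finset.Icc (-(2 * r : ℤ)) (2 * r))).subset
    fun c hc => ?_
  rw [Finset.mem_coe, Fintype.mem_piFinset]
  intro i
  have h1 := hc (centre_mem_gridCell c)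
  rw [mem_closedBall_zero_iff, pi_norm_le_iff_of_nonneg (by positivity)] at h1
  have h2 := abs_le.1 (h1 i)
  rw [Finset.mem_Icc]
  constructor
  · have : -(2 * r : ℝ) ≤ c i := by linarith [h2.1]
    exact_mod_cast this
  · have : (c i : ℝ) ≤ 2 * r := by linarith [h2.2]
    exact_mod_cast this

/-- If two relatively open subsets cover `A`, both are `(m - 1)`-connected and their intersection
is `(m - 2)`-connected, then `A` is `(m - 1)`-connected. -/
theorem Fills.of_open_cover {m : ℕ} {A O₁ O₂ : Set E} (h₁ : IsOpen O₁) (h₂ : IsOpen O₂)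
    (hcov : A ⊆ O₁ ∪ O₂) (hA₁ : Fills m (A ∩ O₁)) (hA₂ : Fills m (A ∩ O₂))
    (hA₁₂ : ∀ m' < m, Fills m' (A ∩ (O₁ ∩ O₂))) : Fills m A := by
  classical
  intro κ _ hκ f hf hfA
  -- The map is made constant along rays from the origin, so that the collar can be taken as large,
  -- and hence the integral grid as fine, as needed.
  set g : (κ → ℝ) → E := fun x => f (‖x‖⁻¹ • x) with hgdef
  have hmaps : MapsTo (fun x : κ → ℝ => ‖x‖⁻¹ • x) {0}ᶜ (sphere 0 1) :=
    fun x hx => norm_inv_smul_mem_sphere hx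
  have hg : ContinuousOn g {0}ᶜ := hf.comp ((continuous_norm.continuousOn.inv₀
    fun x hx => norm_ne_zero_iff.2 hx).smul continuousOn_id) hmaps
  have hgA : ∀ x ≠ 0, g x ∈ A := fun x hx => hfA (hmaps hx)
  have hscale : ∀ (t : ℝ) (x : κ → ℝ), 0 < t → g (t • x) = g x := by
    intro t x ht
    simp only [hgdef]
    rw [norm_smul, Real.norm_of_nonneg ht.le, smul_smul, mul_inv, mul_right_comm,
      inv_mul_cancel₀ ht.ne', one_mul]
  obtain ⟨N, hN, hsub⟩ := exists_subordinate_grid hg hscale h₁ h₂ fun x hx => hcov (hgA x hx)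
  have hN' : (0 : ℝ) < N := by exact_mod_cast hN
  set R : Set (κ → ℝ) := {z : κ → ℝ | (N : ℝ) ≤ ‖z‖ ∧ ‖z‖ ≤ (2 * N : ℕ)} with hR
  have hR0 : R ⊆ {0}ᶜ := by
    rintro z hz rfl
    have := hz.1
    rw [norm_zero] at this
    linarith
  set S : Set (κ → ℝ) := {z : κ → ℝ | ‖z‖ = (2 * N : ℕ)} with hS
  -- `P` selects the cells that have to be sent into `O₁`: those that `g` already sends there, and
  -- those of less than full dimension away from the outer boundary. The latter include all cells of
  -- the inner boundary, so that the remaining hole can be filled inside `A ∩ O₁`.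
  let P : (κ → ℤ) → Prop := fun c => MapsTo g (gridCell c) O₁ ∨
    ((∀ z ∈ gridCell c, z ∉ S) ∧ ∃ i, ∀ a ∈ gridCell c, ∀ b ∈ gridCell c, a i = b i)
  let Q : (κ → ℤ) → Prop := fun c => MapsTo g (gridCell c) O₂
  have hfin : {c : κ → ℤ | gridCell c ⊆ R}.Finite :=
    (finite_gridCell_subset_closedBall (2 * N)).subset fun c hc z hz => by
      rw [mem_closedBall_zero_iff]
      exact (hc hz).2
  obtain ⟨F, hF, hFW, hFg⟩ := exists_extension_of_carrier
    (W := fun c => {y ∈ A | (P c → y ∈ O₁) ∧ (Q c → y ∈ O₂)})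
    (fun c c' hcc y hy => by
      refine ⟨hy.1, fun hP => hy.2.1 ?_, fun hQ => hy.2.2 (hQ.mono_left hcc)⟩
      exact hP.imp (fun h => h.mono_left hcc) fun ⟨h, i, hi⟩ =>
        ⟨fun z hz => h z (hcc hz), i, fun a ha b hb => hi a (hcc ha) b (hcc hb)⟩) g
    -- The map `g` is kept on cells sent into `O₁` and on the outer boundary. All other cells are
    -- sent into `O₂` by `g` and are filled anew there.
    {c | gridCell c ⊆ R ∧ (MapsTo g (gridCell c) O₁ ∨ gridCell c ⊆ S)}
    (fun c c' hcc hc => ⟨hcc.trans hc.1, hc.2.imp (fun h => h.mono_left hcc) hcc.trans⟩)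
    (fun c hc => hg.mono (hc.1.trans hR0))
    (fun c hc z hz => by
      refine ⟨hgA z (hR0 (hc.1 hz)), ?_, fun hQ => hQ hz⟩
      rintro (hP | ⟨hP, -⟩)
      · exact hP hz
      · rcases hc.2 with h | h
        · exact h hz
        · exact absurd (h hz) (hP z hz))
    hfin.toFinset
    (fun c c' hcc hc => by
      rw [Set.Finite.mem_toFinset] at hc ⊢
      exact hcc.trans hc)
    (fun c hc hc₀ => by
      rw [Set.Finite.mem_toFinset] at hc
      have hn1 : ¬ MapsTo g (gridCell c) O₁ := fun h => hc₀ ⟨hc, Or.inl h⟩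
      have hQ : Q c := (hsub c hc).resolve_left hn1
      by_cases hP : P c
      · have : {y ∈ A | (P c → y ∈ O₁) ∧ (Q c → y ∈ O₂)} = A ∩ (O₁ ∩ O₂) := by
          ext y
          simp only [hP, hQ, forall_true_left, mem_ofPred_eq, mem_inter_iff]
        rw [this]
        obtain ⟨-, i, hi⟩ := hP.resolve_left hn1
        -- A constant coordinate lowers the dimension of the cell, which is why the intersection may
        -- be one degree less connected.
        exact hA₁₂ _ ((cellDim_lt hi).trans_le hκ)
      · have : {y ∈ A | (P c → y ∈ O₁) ∧ (Q c → y ∈ O₂)} = A ∩ O₂ := by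
          ext y
          simp [hP, hQ]
        rw [this]
        exact hA₂.mono ((cellDim_le c).trans hκ))
  have hcell : ∀ z ∈ R, cellOf z ∈ hfin.toFinset := fun z hz => by
    rw [Set.Finite.mem_toFinset]
    exact gridCell_cellOf_subset_annulus hN hz.1 hz.2
  have hFR : ContinuousOn F R := hF.mono fun z hz =>
    mem_iUnion₂.2 ⟨cellOf z, hcell z hz, mem_gridCell_cellOf z⟩
  have hFA : MapsTo F R A := fun z hz => (hFW _ (hcell z hz) (mem_gridCell_cellOf z)).1
  have hFS : ∀ z ∈ S, F z = g z := by
    intro z hz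
    have hzR : z ∈ R := ⟨by rw [hz]; push_cast; linarith, hz.le⟩
    refine hFg _ (hcell z hzR) ⟨gridCell_cellOf_subset_annulus hN hzR.1 hzR.2, Or.inr ?_⟩
      (mem_gridCell_cellOf z)
    intro z' hz'
    refine le_antisymm (gridCell_cellOf_subset_annulus hN hzR.1 hzR.2 hz').2 ?_
    obtain ⟨i, hi⟩ := exists_norm_le_abs_apply (r := ((2 * N : ℕ) : ℝ))
      (by push_cast; linarith) hz.ge
    exact (le_abs_of_mem_gridCell_cellOf hz' (2 * N) hi).trans (norm_le_pi_norm z' i)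
  have hFin : ∀ z : κ → ℝ, ‖z‖ = N → F z ∈ A ∩ O₁ := by
    intro z hz
    have hzR : z ∈ R := ⟨hz.ge, by rw [hz]; push_cast; linarith⟩
    have h := hFW _ (hcell z hzR) (mem_gridCell_cellOf z)
    refine ⟨h.1, h.2.1 (Or.inr ⟨fun z' hz' hzS => ?_, ?_⟩)⟩
    · have h1 : ‖z'‖ ≤ N := by
        rw [pi_norm_le_iff_of_nonneg hN'.le]
        intro i
        exact abs_le_of_mem_gridCell_cellOf hz' N ((norm_le_pi_norm z i).trans hz.le)
      have h2 : ‖z'‖ = (2 * N : ℕ) := hzS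
      rw [h2] at h1
      push_cast at h1
      linarith
    · obtain ⟨i, hi⟩ := exists_norm_le_abs_apply hN' hz.ge
      exact ⟨i, apply_eq_of_mem_gridCell_cellOf
        (le_antisymm ((norm_le_pi_norm z i).trans hz.le) hi)⟩
  have hcs : ∀ t : ℝ, Continuous fun x : κ → ℝ => t • x := fun t => by fun_prop
  have hns : ∀ (t : ℝ) (x : κ → ℝ), 0 ≤ t → ‖t • x‖ = t * ‖x‖ := fun t x ht => by
    rw [norm_smul, Real.norm_of_nonneg ht]
  have hNs : MapsTo (fun x : κ → ℝ => (N : ℝ) • x) (sphere 0 1) {z | ‖z‖ = N} := fun x hx => by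
    rw [mem_ofPred_eq, hns _ _ hN'.le, mem_sphere_zero_iff_norm.1 hx, mul_one]
  -- On the inner boundary the new map lies in `A ∩ O₁`, where the first connectivity hypothesis
  -- fills the cube.
  obtain ⟨G, hG, hGA, hGF⟩ := hA₁ κ hκ (fun x => F ((N : ℝ) • x))
    (hFR.comp (hcs _).continuousOn fun x hx => by
      have := hNs hx
      rw [mem_ofPred_eq] at this
      exact ⟨this.ge, by rw [this]; push_cast; linarith⟩)
    (fun x hx => hFin _ (hNs hx))
  have h2N : MapsTo (fun x : κ → ℝ => (2 * N : ℝ) • x) {x | 1 / 2 ≤ ‖x‖ ∧ ‖x‖ ≤ 1} R := by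
    rintro x ⟨hx1, hx2⟩
    rw [hR, mem_ofPred_eq, hns _ _ (by positivity)]
    push_cast
    constructor <;> nlinarith
  refine exists_fill_of_annulus (F := fun x => F ((2 * N : ℝ) • x)) (G := G)
    (hFR.comp (hcs _).continuousOn h2N) (hFA.comp h2N) ?_ hG (fun x hx => (hGA hx).1) ?_
  · intro x hx
    have hx1 : ‖x‖ = 1 := mem_sphere_zero_iff_norm.1 hx
    have : (2 * N : ℝ) • x ∈ S := by
      rw [hS, mem_ofPred_eq, hns _ _ (by positivity), hx1]
      push_cast
      ring
    simp only
    rw [hFS _ this, hscale _ _ (by positivity)]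
    simp [hgdef, hx1]
  · intro x hx
    rw [hGF hx, smul_smul]
    ring_nf

end Gluing

/-! ### Stars and links in barycentric coordinates -/

section Geo

variable {ι : Type*}

/-- The union of the simplices spanned by the members of `K`, in barycentric coordinates. -/
def geo (K : Set (Finset ι)) : Set (ι → ℝ) :=
  {w | (∀ i, 0 ≤ w i) ∧ ∃ s ∈ K, (∀ i ∉ s, w i = 0) ∧ ∑ i ∈ s, w i = 1}

/-- The non-empty subsets of members of `K` are members of `K`. -/
def IsDownClosed (K : Set (Finset ι)) : Prop := ∀ s ∈ K, ∀ t ⊆ s, t.Nonempty → t ∈ K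

theorem mem_geo_of_support [DecidableEq ι] {K : Set (Finset ι)} {w : ι → ℝ} (h0 : ∀ i, 0 ≤ w i)
    {s : Finset ι} (hs : ∀ i ∉ s, w i = 0) (h1 : ∑ i ∈ s, w i = 1)
    (hK : s.filter (fun i => w i ≠ 0) ∈ K) : w ∈ geo K := by
  refine ⟨h0, _, hK, fun i hi => ?_, ?_⟩
  · by_cases his : i ∈ s
    · by_contra h
      exact hi (Finset.mem_filter.2 ⟨his, h⟩)
    · exact hs i his
  · rw [← h1]
    exact Finset.sum_filter_ne_zero s

/-- The barycentre of a simplex. -/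
noncomputable def barycentre [DecidableEq ι] (σ : Finset ι) : ι → ℝ :=
  fun i => if i ∈ σ then (σ.card : ℝ)⁻¹ else 0

variable [DecidableEq ι] {σ : Finset ι}

theorem sum_barycentre (hσ : σ.Nonempty) {s : Finset ι} (hs : σ ⊆ s) :
    ∑ i ∈ s, barycentre σ i = 1 := by
  have : (σ.card : ℝ) ≠ 0 := by exact_mod_cast hσ.card_ne_zero
  simp only [barycentre]
  rw [Finset.sum_ite_mem, Finset.inter_eq_right.2 hs, Finset.sum_const, nsmul_eq_mul,
    mul_inv_cancel₀ this]

theorem barycentre_nonneg (i : ι) : 0 ≤ barycentre σ i := by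
  unfold barycentre
  split_ifs <;> positivity

theorem barycentre_of_notMem {i : ι} (hi : i ∉ σ) : barycentre σ i = 0 := if_neg hi

theorem card_mul_barycentre {i : ι} (hi : i ∈ σ) : (σ.card : ℝ) * barycentre σ i = 1 := by
  have : (σ.card : ℝ) ≠ 0 := by exact_mod_cast Finset.card_ne_zero_of_mem hi
  rw [barycentre, if_pos hi, mul_inv_cancel₀ this]

/-- The weight of the barycentre of `σ` in `w`, if `w` is written as a convex combination of the
barycentre and of a point in whose support `σ` is not contained. -/
noncomputable def baryWeight {ι : Type*} {σ : Finset ι} (hσ : σ.Nonempty) (w : ι → ℝ) : ℝ := σ.card * σ.inf' hσ w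

/-- Radial projection away from the barycentre of `σ`. -/
noncomputable def radialProj (hσ : σ.Nonempty) (w : ι → ℝ) : ι → ℝ :=
  (1 - baryWeight hσ w)⁻¹ • (w - baryWeight hσ w • barycentre σ)

theorem continuous_baryWeight {ι : Type*} {σ : Finset ι} (hσ : σ.Nonempty) : Continuous (baryWeight hσ) :=
  continuous_const.mul (Continuous.finset_inf'_apply hσ fun i _ => continuous_apply i)

theorem continuousOn_radialProj (hσ : σ.Nonempty) :
    ContinuousOn (radialProj hσ) {w | baryWeight hσ w < 1} := by
  have h := continuous_baryWeight hσ
  refine ContinuousOn.smul ((continuous_const.sub h).continuousOn.inv₀ fun w hw => ?_) ?_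
  · exact (sub_pos.2 (show baryWeight hσ w < 1 from hw)).ne'
  · exact (continuous_id.sub (h.smul continuous_const)).continuousOn

theorem baryWeight_le {ι : Type*} {σ : Finset ι} (hσ : σ.Nonempty) (w : ι → ℝ) {i : ι} (hi : i ∈ σ) :
    baryWeight hσ w ≤ σ.card * w i :=
  mul_le_mul_of_nonneg_left (Finset.inf'_le w hi) (Nat.cast_nonneg _)

theorem exists_baryWeight_eq {ι : Type*} {σ : Finset ι} (hσ : σ.Nonempty) (w : ι → ℝ) :
    ∃ i ∈ σ, baryWeight hσ w = σ.card * w i := by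
  obtain ⟨i, hi, h⟩ := Finset.exists_mem_eq_inf' hσ w
  exact ⟨i, hi, by rw [baryWeight, h]⟩

theorem eq_radialProj_add (hσ : σ.Nonempty) {w : ι → ℝ} (hw : baryWeight hσ w ≠ 1) :
    w = (1 - baryWeight hσ w) • radialProj hσ w + baryWeight hσ w • barycentre σ := by
  have : 1 - baryWeight hσ w ≠ 0 := sub_ne_zero.2 hw.symm
  rw [radialProj, smul_smul, mul_inv_cancel₀ this, one_smul, sub_add_cancel]

theorem radialProj_of_baryWeight_eq_zero (hσ : σ.Nonempty) {w : ι → ℝ} (hw : baryWeight hσ w = 0) :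
    radialProj hσ w = w := by
  rw [radialProj, hw]
  simp

theorem baryWeight_nonneg {ι : Type*} {σ : Finset ι} (hσ : σ.Nonempty) {w : ι → ℝ} (hw : ∀ i, 0 ≤ w i) :
    0 ≤ baryWeight hσ w := by
  obtain ⟨i, -, h⟩ := exists_baryWeight_eq hσ w
  rw [h]
  exact mul_nonneg (Nat.cast_nonneg _) (hw i)

theorem subset_of_baryWeight_pos (hσ : σ.Nonempty) {w : ι → ℝ} (h : 0 < baryWeight hσ w)
    {s : Finset ι} (hs : ∀ i ∉ s, w i = 0) : σ ⊆ s := by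
  intro i hi
  by_contra his
  have := baryWeight_le hσ w hi
  rw [hs i his, mul_zero] at this
  linarith

variable {K : Set (Finset ι)}

/-- The faces that do not contain `σ`. -/
def facesAvoiding {ι : Type*} (K : Set (Finset ι)) (σ : Finset ι) : Set (Finset ι) := {τ ∈ K | ¬ σ ⊆ τ}

/-- The join of the boundary of `σ` with the link of `σ`. -/
def boundaryJoinLink (K : Set (Finset ι)) (σ : Finset ι) : Set (Finset ι) :=
  {τ ∈ K | ¬ σ ⊆ τ ∧ σ ∪ τ ∈ K}

/-- The weight is the largest multiple of the barycentre that can be subtracted without creating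
negative coordinates. Subtracting it kills a coordinate in `σ` at which the minimum is attained, so
the new support omits a vertex of `σ`. A positive weight forces `σ` into every simplex that carries
`w`; the new support then spans a simplex together with `σ`. -/
theorem radialProj_mem (hK : IsDownClosed K) (hσ : σ.Nonempty) {w : ι → ℝ} (hw : w ∈ geo K)
    (hw1 : baryWeight hσ w < 1) :
    radialProj hσ w ∈ geo (facesAvoiding K σ) ∧
      (0 < baryWeight hσ w → radialProj hσ w ∈ geo (boundaryJoinLink K σ)) := by
  obtain ⟨h0, s, hs, hsw, hsum⟩ := hw
  have hpos : 0 < 1 - baryWeight hσ w := by linarith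
  have hθ := baryWeight_nonneg hσ h0
  have hr : ∀ i, radialProj hσ w i =
      (1 - baryWeight hσ w)⁻¹ * (w i - baryWeight hσ w * barycentre σ i) := fun i => rfl
  have hr0 : ∀ i, 0 ≤ radialProj hσ w i := by
    intro i
    rw [hr]
    refine mul_nonneg (inv_nonneg.2 hpos.le) ?_
    by_cases hi : i ∈ σ
    · have h1 := baryWeight_le hσ w hi
      have h2 := card_mul_barycentre hi
      have h3 : baryWeight hσ w * barycentre σ i ≤ (σ.card * w i) * barycentre σ i :=
        mul_le_mul_of_nonneg_right h1 (barycentre_nonneg i)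
      have h4 : (σ.card * w i) * barycentre σ i = w i := by rw [mul_right_comm, h2, one_mul]
      linarith
    · rw [barycentre_of_notMem hi, mul_zero, sub_zero]
      exact h0 i
  have hrs : ∀ i ∉ s, radialProj hσ w i = 0 := by
    intro i hi
    rw [hr, hsw i hi]
    rcases hθ.eq_or_lt with h | h
    · rw [← h]
      simp
    · rw [barycentre_of_notMem fun h' => hi (subset_of_baryWeight_pos hσ h hsw h')]
      simp
  have hrsum : ∑ i ∈ s, radialProj hσ w i = 1 := by
    simp only [hr]
    rw [← Finset.mul_sum, Finset.sum_sub_distrib, ← Finset.mul_sum, hsum]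
    rcases hθ.eq_or_lt with h | h
    · rw [← h]
      simp
    · rw [sum_barycentre hσ (subset_of_baryWeight_pos hσ h hsw), mul_one, inv_mul_cancel₀ hpos.ne']
  have hne : (s.filter fun i => radialProj hσ w i ≠ 0).Nonempty := by
    rw [Finset.nonempty_iff_ne_empty]
    intro h
    have := Finset.sum_filter_ne_zero (f := radialProj hσ w) s
    rw [h, hrsum] at this
    simp at this
  have hmem := hK s hs _ (Finset.filter_subset (fun i => radialProj hσ w i ≠ 0) s) hne
  have hσn : ¬ σ ⊆ s.filter fun i => radialProj hσ w i ≠ 0 := by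
    intro h
    obtain ⟨i, hi, hi'⟩ := exists_baryWeight_eq hσ w
    refine (Finset.mem_filter.1 (h hi)).2 ?_
    have h4 : (σ.card * w i) * barycentre σ i = w i := by
      rw [mul_right_comm, card_mul_barycentre hi, one_mul]
    rw [hr, hi', h4, sub_self, mul_zero]
  refine ⟨mem_geo_of_support hr0 hrs hrsum ⟨hmem, hσn⟩, fun h =>
    mem_geo_of_support hr0 hrs hrsum ⟨hmem, hσn, hK s hs _ ?_ (hσ.mono Finset.subset_union_left)⟩⟩
  exact Finset.union_subset (subset_of_baryWeight_pos hσ h hsw) (Finset.filter_subset _ _)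

/-- The point `u` vanishes at some vertex of `σ`, so the minimum over `σ` comes from the barycentre
alone. This makes the weight and the radial projection polar coordinates around the barycentre. -/
theorem join_barycentre_mem (hσ : σ.Nonempty) {u : ι → ℝ} (hu : u ∈ geo (boundaryJoinLink K σ))
    {t : ℝ} (h0 : 0 ≤ t) (h1 : t ≤ 1) :
    (1 - t) • u + t • barycentre σ ∈ geo K ∧
      baryWeight hσ ((1 - t) • u + t • barycentre σ) = t := by
  obtain ⟨hu0, s, ⟨hs, hσs, hus⟩, hsu, hsum⟩ := hu
  have hval : ∀ i, ((1 - t) • u + t • barycentre σ) i = (1 - t) * u i + t * barycentre σ i :=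
    fun i => rfl
  have hle : ∀ i ∈ σ, σ.card * ((1 - t) • u + t • barycentre σ) i =
      (1 - t) * (σ.card * u i) + t := by
    intro i hi
    rw [hval, mul_add, mul_left_comm, mul_left_comm _ t, card_mul_barycentre hi, mul_one]
  refine ⟨⟨fun i => ?_, σ ∪ s, hus, fun i hi => ?_, ?_⟩, le_antisymm ?_ ?_⟩
  · rw [hval]
    have := hu0 i
    have := barycentre_nonneg (σ := σ) i
    have : 0 ≤ 1 - t := by linarith
    positivity
  · rw [Finset.mem_union, not_or] at hi
    rw [hval, hsu i hi.2, barycentre_of_notMem hi.1]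
    simp
  · simp only [hval]
    rw [Finset.sum_add_distrib, ← Finset.mul_sum, ← Finset.mul_sum,
      sum_barycentre hσ Finset.subset_union_left,
      ← Finset.sum_subset Finset.subset_union_right fun i _ hi => hsu i hi, hsum]
    ring
  · obtain ⟨i, hi, his⟩ := Finset.not_subset.1 hσs
    refine (baryWeight_le hσ _ hi).trans ?_
    rw [hle i hi, hsu i his]
    simp
  · obtain ⟨i, hi, h⟩ := exists_baryWeight_eq hσ ((1 - t) • u + t • barycentre σ)
    rw [h, hle i hi]
    have := hu0 i
    have : 0 ≤ 1 - t := by linarith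
    have : 0 ≤ (1 - t) * (σ.card * u i) := by positivity
    linarith

theorem geo_mono {ι : Type*} {K L : Set (Finset ι)} (h : K ⊆ L) : geo K ⊆ geo L :=
  fun _ ⟨h0, s, hs, h1⟩ => ⟨h0, s, h hs, h1⟩

/-- The set is star-shaped about the barycentre: a positive weight puts `σ` into the carrier of `w`,
and moving towards the barycentre does not take the weight below `1 / 3`. -/
theorem fills_star (hσ : σ.Nonempty) (hσK : σ ∈ K) (m : ℕ) :
    Fills m (geo K ∩ {w | 1 / 3 < baryWeight hσ w}) := by
  have hb1 : baryWeight hσ (barycentre σ) = 1 := by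
    obtain ⟨i, hi, h⟩ := exists_baryWeight_eq hσ (barycentre σ)
    rw [h, card_mul_barycentre hi]
  refine (fills_singleton m (barycentre σ)).of_dominated (fun _ => barycentre σ) id
    continuousOn_const (fun _ _ => rfl) continuousOn_id ?_ ?_
  · rintro w ⟨⟨hw0, s, hs, hsw, hsum⟩, hw⟩ t ht0 ht1
    have hw : 1 / 3 < baryWeight hσ w := hw
    have hσs := subset_of_baryWeight_pos hσ (by linarith) hsw
    have ht : 0 ≤ 1 - t := by linarith
    have hval : ∀ i, ((1 - t) • w + t • barycentre σ) i = (1 - t) * w i + t * barycentre σ i :=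
      fun i => rfl
    refine ⟨⟨fun i => ?_, s, hs, fun i hi => ?_, ?_⟩, ?_⟩
    · rw [id, hval]
      have := hw0 i
      have := barycentre_nonneg (σ := σ) i
      positivity
    · rw [id, hval, hsw i hi, barycentre_of_notMem fun h => hi (hσs h)]
      simp
    · simp only [id, hval]
      rw [Finset.sum_add_distrib, ← Finset.mul_sum, ← Finset.mul_sum, sum_barycentre hσ hσs, hsum]
      ring
    · obtain ⟨i, hi, h⟩ := exists_baryWeight_eq hσ ((1 - t) • w + t • barycentre σ)
      rw [mem_ofPred_eq, id, h, hval, mul_add, mul_left_comm, mul_left_comm _ t,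
        card_mul_barycentre hi]
      have h1 := baryWeight_le hσ w hi
      rcases ht0.eq_or_lt with rfl | ht0
      · linarith
      · nlinarith [mul_nonneg ht (show 0 ≤ σ.card * w i - 1 / 3 by linarith)]
  · rintro _ rfl
    refine ⟨⟨barycentre_nonneg, σ, hσK, fun i hi => barycentre_of_notMem hi,
      sum_barycentre hσ subset_rfl⟩, ?_⟩
    rw [mem_ofPred_eq, id, hb1]
    norm_num

/-- Attaching all simplices that contain `σ`. -/
theorem fills_geo_of_avoiding (hK : IsDownClosed K) (hσ : σ.Nonempty) (hσK : σ ∈ K) {m : ℕ}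
    (h₁ : Fills m (geo (facesAvoiding K σ)))
    (h₂ : ∀ m' < m, Fills m' (geo (boundaryJoinLink K σ))) : Fills m (geo K) := by
  have hc := continuous_baryWeight hσ
  have hr1 : ContinuousOn (radialProj hσ) {w | baryWeight hσ w < 2 / 3} :=
    (continuousOn_radialProj hσ).mono fun w (hw : baryWeight hσ w < 2 / 3) => by
      rw [mem_ofPred_eq]; linarith
  -- The thresholds make the two sets overlap. Below `2 / 3` the radial projection deforms onto the
  -- faces avoiding `σ`; above `1 / 3` there is the star; on the overlap everything contracts
  -- radially onto a copy of `boundaryJoinLink K σ`.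
  refine Fills.of_open_cover (O₁ := {w | baryWeight hσ w < 2 / 3})
    (O₂ := {w | 1 / 3 < baryWeight hσ w}) (isOpen_lt hc continuous_const)
    (isOpen_lt continuous_const hc) ?_ ?_ (fills_star hσ hσK m) ?_
  · intro w _
    rcases lt_or_ge (baryWeight hσ w) (2 / 3) with h | h
    · exact Or.inl h
    · exact Or.inr (show 1 / 3 < baryWeight hσ w by linarith)
  · refine h₁.of_dominated (radialProj hσ) id (hr1.mono inter_subset_right) ?_ continuousOn_id ?_ ?_
    · rintro w ⟨hw, hw1⟩
      have hw1 : baryWeight hσ w < 2 / 3 := hw1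
      exact (radialProj_mem hK hσ hw (by linarith)).1
    · rintro w ⟨hw, hw1⟩ t ht0 ht1
      have hw1 : baryWeight hσ w < 2 / 3 := hw1
      rcases (baryWeight_nonneg hσ hw.1).eq_or_lt with h | h
      · have : (1 - t) • w + t • id (radialProj hσ w) = w := by
          rw [id, radialProj_of_baryWeight_eq_zero hσ h.symm, ← add_smul, sub_add_cancel, one_smul]
        rw [this]
        exact ⟨hw, hw1⟩
      -- The segment to the projection runs along one ray from the barycentre and just scales the
      -- weight by `1 - t`.
      · have e : (1 - t) • w + t • id (radialProj hσ w) =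
            (1 - (1 - t) * baryWeight hσ w) • radialProj hσ w +
              ((1 - t) * baryWeight hσ w) • barycentre σ := by
          conv_lhs => enter [1]; rw [eq_radialProj_add hσ (w := w) (by linarith)]
          rw [id]
          module
        have := join_barycentre_mem hσ ((radialProj_mem hK hσ hw (by linarith)).2 h)
          (t := (1 - t) * baryWeight hσ w) (mul_nonneg (by linarith) h.le) (by nlinarith)
        rw [e]
        refine ⟨this.1, ?_⟩
        rw [mem_ofPred_eq, this.2]
        nlinarith
    · rintro w hw
      refine ⟨geo_mono (fun τ hτ => hτ.1) hw, ?_⟩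
      obtain ⟨-, s, hs, hsw, -⟩ := hw
      obtain ⟨i, hi, his⟩ := Finset.not_subset.1 hs.2
      have := baryWeight_le hσ w hi
      rw [hsw i his] at this
      rw [mem_ofPred_eq, id]
      linarith
  · intro m' hm'
    -- The section places `boundaryJoinLink K σ` at weight `1 / 2`, between the two thresholds.
    refine (h₂ m' hm').of_dominated (radialProj hσ)
      (fun u => (1 - (1 / 2 : ℝ)) • u + (1 / 2 : ℝ) • barycentre σ)
      (hr1.mono fun w hw => hw.2.1) ?_ (by fun_prop) ?_ ?_
    · rintro w ⟨hw, hw1, hw2⟩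
      have hw1 : baryWeight hσ w < 2 / 3 := hw1
      have hw2 : 1 / 3 < baryWeight hσ w := hw2
      exact (radialProj_mem hK hσ hw (by linarith)).2 (by linarith)
    · rintro w ⟨hw, hw1, hw2⟩ t ht0 ht1
      have hw1 : baryWeight hσ w < 2 / 3 := hw1
      have hw2 : 1 / 3 < baryWeight hσ w := hw2
      have e : (1 - t) • w + t • ((1 - (1 / 2 : ℝ)) • radialProj hσ w + (1 / 2 : ℝ) • barycentre σ) =
          (1 - ((1 - t) * baryWeight hσ w + t / 2)) • radialProj hσ w +
            ((1 - t) * baryWeight hσ w + t / 2) • barycentre σ := by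
        conv_lhs => enter [1]; rw [eq_radialProj_add hσ (w := w) (by linarith)]
        module
      have := join_barycentre_mem hσ ((radialProj_mem hK hσ hw (by linarith)).2 (by linarith))
        (t := (1 - t) * baryWeight hσ w + t / 2) (by nlinarith) (by nlinarith)
      simp only [e]
      refine ⟨this.1, ?_⟩
      rw [mem_inter_iff, mem_ofPred_eq, mem_ofPred_eq, this.2]
      constructor <;> nlinarith
    · intro u hu
      have := join_barycentre_mem hσ hu (t := 1 / 2) (by norm_num) (by norm_num)
      refine ⟨this.1, ?_⟩
      rw [mem_inter_iff, mem_ofPred_eq, mem_ofPred_eq, this.2]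
      norm_num

end Geo

/-! ### Complexes of pairwise related sets -/

section PairwiseComplex

variable {ι : Type*} [DecidableEq ι]

/-- The subsets of `S` with at most `M` elements that are pairwise related by `r`. -/
def pairwiseFaces {ι : Type*} (r : ι → ι → Prop) (S : Finset ι) (M : ℕ) : Set (Finset ι) :=
  {σ | σ.Nonempty ∧ σ ⊆ S ∧ (σ : Set ι).Pairwise r ∧ σ.card ≤ M}

theorem isDownClosed_pairwiseFaces {ι : Type*} (r : ι → ι → Prop) (S : Finset ι) (M : ℕ) :
    IsDownClosed (pairwiseFaces r S M) := fun _ hs _ hts hne =>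
  ⟨hne, hts.trans hs.2.1, hs.2.2.1.mono hts, (Finset.card_le_card hts).trans hs.2.2.2⟩

/-- Each vertex is related to all members of `B` but at most one, so passing to the link of a vertex
costs at most one member of `B`, while the size bound also drops by one. Induction on `m` therefore
controls links, and an inner induction on the number of vertices attaches one cone at a time. It
ends with a full simplex on `B`. -/
theorem fills_geo_pairwiseFaces {r : ι → ι → Prop} (hsymm : ∀ a b, r a b → r b a)
    (hirr : ∀ a, ¬ r a a) (m : ℕ) (S B : Finset ι) (hBS : B ⊆ S) (hB : m + 1 ≤ B.card)
    (hgen : ∀ f ∈ S, ∀ b ∈ B, ∀ b' ∈ B, ¬ r f b → ¬ r f b' → b = b') :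
    Fills m (geo (pairwiseFaces r S (m + 1))) := by
  classical
  induction m using Nat.strong_induction_on generalizing S B with
  | _ m ihm =>
  induction hn : S.card generalizing S B with
  | zero =>
    have := Finset.card_le_card hBS
    omega
  | succ n ihn =>
    have attach : ∀ v ∈ S, ∀ B' ⊆ S.erase v, m + 1 ≤ B'.card → B' ⊆ B →
        Fills m (geo (pairwiseFaces r S (m + 1))) := by
      intro v hv B' hB' hcard hBB
      refine fills_geo_of_avoiding (isDownClosed_pairwiseFaces r S (m + 1))
        (Finset.singleton_nonempty v) ⟨Finset.singleton_nonempty v, by simpa, by simp, by simp⟩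
        ?_ fun m' hm' => ?_
      · have : facesAvoiding (pairwiseFaces r S (m + 1)) {v} =
            pairwiseFaces r (S.erase v) (m + 1) := by
          ext τ
          simp only [facesAvoiding, pairwiseFaces, mem_ofPred_eq, Finset.singleton_subset_iff,
            Finset.subset_erase]
          tauto
        rw [this]
        exact ihn (S.erase v) B' hB' hcard
          (fun f hf b hb b' hb' => hgen f (Finset.mem_of_mem_erase hf) b (hBB hb) b' (hBB hb'))
          (by rw [Finset.card_erase_of_mem hv, hn]; rfl)
      · obtain ⟨p, rfl⟩ : ∃ p, m = p + 1 := ⟨m - 1, by omega⟩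
        -- For a single vertex the boundary is empty, so this is the ordinary link: the same kind of
        -- complex on the vertices related to `v`, with one vertex fewer allowed.
        have : boundaryJoinLink (pairwiseFaces r S (p + 1 + 1)) {v} =
            pairwiseFaces r (S.filter (r v)) (p + 1) := by
          ext τ
          simp only [boundaryJoinLink, pairwiseFaces, mem_ofPred_eq, Finset.singleton_subset_iff]
          constructor
          · rintro ⟨⟨h1, h2, h3, h4⟩, h5, -, h6, h7, h8⟩
            refine ⟨h1, fun a ha => Finset.mem_filter.2 ⟨h2 ha, ?_⟩, h3, ?_⟩
            · refine h7 (by simp) (by simp [ha]) ?_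
              rintro rfl
              exact h5 ha
            · rw [← Finset.insert_eq, Finset.card_insert_of_notMem h5] at h8
              omega
          · rintro ⟨h1, h2, h3, h4⟩
            have h2' : ∀ a ∈ τ, r v a := fun a ha => (Finset.mem_filter.1 (h2 ha)).2
            have h5 : v ∉ τ := fun h => hirr v (h2' v h)
            have h6 : τ ⊆ S := h2.trans (Finset.filter_subset _ _)
            refine ⟨⟨h1, h6, h3, h4.trans (by omega)⟩, h5, ⟨v, by simp⟩, ?_, ?_, ?_⟩
            · exact Finset.union_subset (by simpa) h6
            · rw [← Finset.insert_eq, Finset.coe_insert]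
              exact h3.insert fun b hb _ => ⟨h2' b hb, hsymm _ _ (h2' b hb)⟩
            · rw [← Finset.insert_eq, Finset.card_insert_of_notMem h5]
              omega
        rw [this]
        refine Fills.mono (by omega : m' ≤ p) (ihm p (by omega) (S.filter (r v)) (B.filter (r v))
          (Finset.filter_subset_filter _ hBS) ?_ ?_)
        · have h1 := Finset.card_filter_add_card_filter_not (s := B) (r v)
          have h2 : (B.filter fun b => ¬ r v b).card ≤ 1 := by
            rw [Finset.card_le_one]
            intro a ha b hb
            rw [Finset.mem_filter] at ha hb
            exact hgen v hv a ha.1 b hb.1 ha.2 hb.2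
          omega
        · intro f hf b hb b' hb'
          exact hgen f (Finset.mem_filter.1 hf).1 b (Finset.mem_filter.1 hb).1 b'
            (Finset.mem_filter.1 hb').1
    by_cases hSB : S ⊆ B
    · obtain rfl : B = S := hBS.antisymm hSB
      obtain ⟨v, hv⟩ : B.Nonempty := Finset.card_pos.1 (by omega)
      rcases hB.eq_or_lt with h | h
      -- By irreflexivity each member of `B` is its own only exception. Hence all of `B`, having
      -- exactly `m + 1` elements, is one simplex, which contracts to its barycentre.
      · have hpw : ∀ τ ⊆ B, (τ : Set ι).Pairwise r := by
          intro τ hτ a ha b hb hab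
          by_contra hr
          exact hab (hgen a (hτ ha) a (hτ ha) b (hτ hb) (hirr a) hr)
        have hmem : B ∈ pairwiseFaces r B (m + 1) := ⟨⟨v, hv⟩, subset_rfl, hpw B subset_rfl, h.ge⟩
        refine (fills_singleton m (barycentre B)).of_dominated (fun _ => barycentre B) id
          continuousOn_const (fun _ _ => rfl) continuousOn_id ?_ ?_
        · rintro w ⟨hw0, s, hs, hsw, hsum⟩ t ht0 ht1
          have ht : 0 ≤ 1 - t := by linarith
          have hval : ∀ i, ((1 - t) • w + t • barycentre B) i =
            (1 - t) * w i + t * barycentre B i := fun i => rfl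
          refine ⟨fun i => ?_, B, hmem, fun i hi => ?_, ?_⟩
          · rw [id, hval]
            have := hw0 i
            have := barycentre_nonneg (σ := B) i
            positivity
          · rw [id, hval, hsw i fun h => hi (hs.2.1 h), barycentre_of_notMem hi]
            simp
          · simp only [id, hval]
            rw [Finset.sum_add_distrib, ← Finset.mul_sum, ← Finset.mul_sum,
              sum_barycentre ⟨v, hv⟩ subset_rfl, ← Finset.sum_subset hs.2.1 fun i _ hi => hsw i hi,
              hsum]
            ring
        · rintro _ rfl
          exact ⟨barycentre_nonneg, B, hmem, fun i hi => barycentre_of_notMem hi,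
            sum_barycentre ⟨v, hv⟩ subset_rfl⟩
      · exact attach v hv (B.erase v) subset_rfl (by rw [Finset.card_erase_of_mem hv]; omega)
          (Finset.erase_subset _ _)
    · obtain ⟨v, hv, hvB⟩ := Finset.not_subset.1 hSB
      exact attach v hv B (Finset.subset_erase.2 ⟨hBS, hvB⟩) hB subset_rfl

/-- Attaching finitely many `(m + 1)`-dimensional simplices along their boundaries. -/
theorem fills_geo_union_of_card_eq {K : Set (Finset ι)} (hK : IsDownClosed K) {m : ℕ}
    (hK₀ : ∀ s ∈ K, s.Nonempty) (hKm : ∀ s ∈ K, s.card ≤ m + 1) (h : Fills m (geo K)) (T : Finset (Finset ι))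
    (hT : ∀ σ ∈ T, σ.card = m + 2 ∧ ∀ τ ⊂ σ, τ.Nonempty → τ ∈ K) :
    Fills m (geo (K ∪ T)) := by
  induction T using Finset.induction_on with
  | empty => simpa using h
  | insert σ T hσT ih =>
    have hσ := hT σ (Finset.mem_insert_self _ _)
    have hne : σ.Nonempty := Finset.card_pos.1 (by omega)
    have hcard : ∀ τ ∈ K ∪ ((insert σ T : Finset (Finset ι)) : Set (Finset ι)), τ.card ≤ m + 2 := by
      rintro τ (hτ | hτ)
      · exact (hKm τ hτ).trans (by omega)
      · exact (hT τ hτ).1.le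
    have hmax : ∀ τ ∈ K ∪ ((insert σ T : Finset (Finset ι)) : Set (Finset ι)), σ ⊆ τ → τ = σ :=
      fun τ hτ hστ => (Finset.eq_of_subset_of_card_le hστ (by rw [hσ.1]; exact hcard τ hτ)).symm
    refine fills_geo_of_avoiding (σ := σ) ?_ hne (Or.inr (by simp)) ?_ ?_
    · rintro s (hs | hs) t hts htn
      · exact Or.inl (hK s hs t hts htn)
      · rcases hts.eq_or_ssubset with rfl | h'
        · exact Or.inr hs
        · exact Or.inl ((hT s hs).2 t h' htn)
    · have : facesAvoiding (K ∪ ((insert σ T : Finset (Finset ι)) : Set (Finset ι))) σ = K ∪ T := by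
        ext τ
        constructor
        · rintro ⟨hτ | hτ, hn⟩
          · exact Or.inl hτ
          · rcases Finset.mem_insert.1 hτ with rfl | h'
            · exact absurd subset_rfl hn
            · exact Or.inr h'
        · intro hτ
          have hτ' : τ ∈ K ∪ ((insert σ T : Finset (Finset ι)) : Set (Finset ι)) :=
            hτ.imp id fun h => by simp [Finset.mem_coe.1 h]
          refine ⟨hτ', fun hστ => ?_⟩
          obtain rfl := hmax τ hτ' hστ
          rcases hτ with h' | h'
          · have := hKm _ h'
            omega
          · exact hσT h'
      rw [this]
      exact ih fun τ hτ => hT τ (Finset.mem_insert_of_mem hτ)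
    · intro m' hm'
      -- The simplex `σ` is maximal, so only its boundary remains. As a complex of sets pairwise
      -- related by `≠`, that sphere is covered by the preceding theorem.
      have : boundaryJoinLink (K ∪ ((insert σ T : Finset (Finset ι)) : Set (Finset ι))) σ =
          pairwiseFaces (· ≠ ·) σ (m + 1) := by
        ext τ
        constructor
        · rintro ⟨hτ, hn, hu⟩
          have hτσ : τ ⊆ σ := by
            have := hmax _ hu Finset.subset_union_left
            exact Finset.union_eq_left.1 this
          have hss : τ ⊂ σ := ⟨hτσ, hn⟩
          refine ⟨?_, hτσ, fun a _ b _ hab => hab, ?_⟩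
          · rcases hτ with h' | h'
            · exact hK₀ τ h'
            · exact Finset.card_pos.1 (by rw [(hT τ h').1]; omega)
          · have := Finset.card_lt_card hss
            omega
        · rintro ⟨h1, h2, -, h3⟩
          have hn : ¬ σ ⊆ τ := fun h' => by
            have := Finset.card_le_card h'
            omega
          refine ⟨Or.inl (hσ.2 τ ⟨h2, hn⟩ h1), hn, Or.inr ?_⟩
          rw [Finset.union_eq_left.2 h2]
          simp
      rw [this]
      exact Fills.mono hm'.le (fills_geo_pairwiseFaces (fun _ _ => Ne.symm) (fun a h => h rfl) m σ σ
        subset_rfl (by omega) fun f _ b _ b' _ hb hb' => (not_not.1 hb).symm.trans (not_not.1 hb'))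

end PairwiseComplex

/-! ### From finite complexes to the realization with the weak topology -/

namespace Realization

variable {ι : Type*} {K : PreAbstractSimplicialComplex ι}

theorem continuous_coe : Continuous fun (w : Realization K) (i : ι) => w.1 i := by
  refine continuous_iSup_dom.2 fun s => continuous_coinduced_dom.2 ?_
  exact continuous_induced_dom

theorem coe_injective : Function.Injective fun (w : Realization K) (i : ι) => w.1 i :=
  fun _ _ h => Subtype.ext (DFunLike.coe_injective h)

theorem isClosed_iff {t : Set (Realization K)} :
    IsClosed t ↔ ∀ s ∈ K.faces, IsClosed {w : ClosedSimplex K s | w.1 ∈ t} := by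
  refine isClosed_iSup_iff.trans ?_
  simp only [isClosed_coinduced, Subtype.forall]
  rfl

/-- A compact subset of the realization meets only finitely many open simplices. -/
theorem finite_support_image {s : Set (Realization K)} (hs : IsCompact s) :
    ((fun w : Realization K => w.1.support) '' s).Finite := by
  -- One point is chosen in each open simplex that is met. Any subset of `D` has finite intersection
  -- with every closed simplex and so is closed; thus `D` is closed and discrete in a compact set,
  -- hence finite.
  obtain ⟨D, hDs, hD⟩ := exists_subset_bijOn s (fun w : Realization K => w.1.support)
  have hclosed : ∀ t ⊆ D, IsClosed t := by
    intro t ht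
    rw [isClosed_iff]
    intro a _
    have : T2Space (ClosedSimplex K a) := T2Space.of_injective_continuous
      (f := fun (w : ClosedSimplex K a) (i : ι) => w.1.1 i)
      (coe_injective.comp Subtype.val_injective) continuous_induced_dom
    refine Set.Finite.isClosed (Set.Finite.of_finite_image (f := fun w => w.1.1.support)
      (a.powerset.finite_toSet.subset ?_) ?_)
    · rintro _ ⟨w, -, rfl⟩
      exact Finset.mem_coe.2 (Finset.mem_powerset.2 w.2)
    · intro w hw w' hw' h
      exact Subtype.ext (hD.injOn (ht hw) (ht hw') h)
  have hdisc : IsDiscrete D :=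
    isDiscrete_iff_forall_mem_exists_isClosed.2 fun t ht => ⟨t, hclosed t ht, inter_eq_left.2 ht⟩
  have hfin := (hs.of_isClosed_subset (hclosed D subset_rfl) hDs).finite hdisc
  rw [← hD.image_eq]
  exact hfin.image _

open Classical in
theorem support_mem {L : Set (Finset ι)} (hL : L ⊆ K.faces) {w : ι → ℝ} (hw : w ∈ geo L) :
    ∃ hf : (Function.support w).Finite, hf.toFinset ∈ K.faces ∧
      (Finsupp.ofSupportFinite w hf).sum (fun _ x => x) = 1 := by
  obtain ⟨h0, s, hs, hsw, hsum⟩ := hw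
  have hsub : Function.support w ⊆ s := fun i hi => by
    by_contra h
    exact hi (hsw i h)
  have hf : (Function.support w).Finite := s.finite_toSet.subset hsub
  have h1 : (Finsupp.ofSupportFinite w hf).sum (fun _ x => x) = 1 := by
    rw [Finsupp.sum_of_support_subset (s := s)]
    · exact hsum
    · intro i hi
      exact hsub (Finsupp.mem_support_iff.1 hi)
    · exact fun _ _ => rfl
  refine ⟨hf, (K.isRelLowerSet_faces (hL hs)).2 (fun i hi => hsub (hf.mem_toFinset.1 hi)) ?_, h1⟩
  by_contra h
  rw [Finset.not_nonempty_iff_eq_empty, Set.Finite.toFinset_eq_empty,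
    Function.support_eq_empty_iff] at h
  subst h
  simp at hsum

/-- The map to the realization of a complex from the geometric version of a subcomplex. -/
noncomputable def ofGeo {L : Set (Finset ι)} (hL : L ⊆ K.faces) (w : geo L) : Realization K :=
  ⟨Finsupp.ofSupportFinite w.1 (support_mem hL w.2).1, w.2.1, (support_mem hL w.2).2.2, by
    convert (support_mem hL w.2).2.1
    ext i
    simp [Finsupp.ofSupportFinite_coe]⟩

/-- The closed simplices of `L` are a finite closed cover of `geo L`, and on each of them the map
factors through a closed simplex of `K` with its Euclidean topology. Finiteness is what reconciles
the product topology with the weak one. -/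
theorem continuous_ofGeo {L : Set (Finset ι)} (hL : L ⊆ K.faces) (hfin : L.Finite) :
    Continuous (ofGeo hL) := by
  have : Finite L := hfin
  refine (locallyFinite_of_finite fun s : L => {w : geo L | ∀ i ∉ s.1, w.1 i = 0}).continuous
    ?_ ?_ ?_
  · ext w
    obtain ⟨-, s, hs, hsw, -⟩ := w.2
    simpa using ⟨s, hs, hsw⟩
  · intro s
    have : {w : geo L | ∀ i ∉ s.1, w.1 i = 0} = ⋂ i, ⋂ (_ : i ∉ s.1), {w : geo L | w.1 i = 0} := by
      ext w
      simp
    rw [this]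
    exact isClosed_iInter fun i => isClosed_iInter fun _ =>
      isClosed_eq ((continuous_apply i).comp continuous_subtype_val) continuous_const
  · intro s
    rw [continuousOn_iff_continuous_domRestrict]
    let g : {w : geo L | ∀ i ∉ s.1, w.1 i = 0} → ClosedSimplex K s.1 := fun w =>
      ⟨ofGeo hL w.1, fun i hi => by
        by_contra h
        exact (Finsupp.mem_support_iff.1 hi) (w.2 i h)⟩
    have hg : Continuous g := continuous_induced_rng.2
      (continuous_subtype_val.comp continuous_subtype_val)
    have hv : Continuous fun w : ClosedSimplex K s.1 => w.1 :=
      continuous_iSup_rng (i := ⟨s.1, hL s.2⟩) continuous_coinduced_rng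
    exact hv.comp hg

/-- Radial projection of the Euclidean sphere from the boundary of a cube. -/
theorem continuous_normalize (d : ℕ) : ContinuousOn
    (fun x : Fin d → ℝ => ‖WithLp.toLp 2 x‖⁻¹ • WithLp.toLp 2 x) {0}ᶜ := by
  have h : Continuous fun x : Fin d → ℝ => WithLp.toLp 2 x := PiLp.continuous_toLp 2 _
  refine (h.norm.continuousOn.inv₀ fun x hx => ?_).smul h.continuousOn
  rw [norm_ne_zero_iff]
  exact fun hx₀ => hx ((WithLp.toLp_eq_zero 2).1 hx₀)

/-- If every finite set of vertices spans simplices of a finite `(m - 1)`-connected subcomplex, then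
the realization is `(m - 1)`-connected. -/
theorem nullhomotopic_of_fills {m : ℕ} (h : ∀ S : Finset ι, ∃ L ⊆ K.faces, L.Finite ∧
      (∀ s ∈ K.faces, s ⊆ S → s ∈ L) ∧ Fills m (geo L)) {d : ℕ} (hd : d + 1 ≤ m)
    (f : C(sphere (0 : EuclideanSpace ℝ (Fin (d + 1))) 1, Realization K)) : f.Nullhomotopic := by
  classical
  have hfin := finite_support_image (isCompact_range f.continuous)
  obtain ⟨L, hLK, hLfin, hL, hfill⟩ := h (hfin.toFinset.biUnion id)
  have hfL : ∀ y, (fun i => (f y).1 i) ∈ geo L := by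
    intro y
    refine ⟨(f y).2.1, (f y).1.support, hL _ (f y).2.2.2 ?_, fun i hi => ?_, (f y).2.2.1⟩
    · intro i hi
      exact Finset.mem_biUnion.2 ⟨(f y).1.support,
        hfin.mem_toFinset.2 ⟨f y, mem_range_self y, rfl⟩, hi⟩
    · exact Finsupp.notMem_support_iff.1 hi
  have hne : ∀ x ∈ sphere (0 : Fin (d + 1) → ℝ) 1, x ≠ 0 := by
    rintro x hx rfl
    simp at hx
  have hnu : ∀ x : Fin (d + 1) → ℝ, x ≠ 0 → ‖WithLp.toLp 2 x‖⁻¹ • WithLp.toLp 2 x ∈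
      sphere (0 : EuclideanSpace ℝ (Fin (d + 1))) 1 := by
    intro x hx
    rw [mem_sphere_zero_iff_norm, norm_smul, norm_inv, norm_norm, inv_mul_cancel₀]
    rw [norm_ne_zero_iff]
    exact fun h' => hx ((WithLp.toLp_eq_zero 2).1 h')
  let g : (Fin (d + 1) → ℝ) → ι → ℝ := fun x =>
    if hx : x ≠ 0 then fun i => (f ⟨_, hnu x hx⟩).1 i else 0
  have hgx : ∀ x (hx : x ≠ 0), g x = fun i => (f ⟨_, hnu x hx⟩).1 i := fun x hx => dif_pos hx
  have hg : ContinuousOn g (sphere 0 1) := by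
    rw [continuousOn_iff_continuous_domRestrict]
    have h1 : Continuous fun x : sphere (0 : Fin (d + 1) → ℝ) 1 =>
        (⟨_, hnu x.1 (hne x.1 x.2)⟩ : sphere (0 : EuclideanSpace ℝ (Fin (d + 1))) 1) :=
      ((continuous_normalize (d + 1)).comp_continuous continuous_subtype_val
        fun x => hne x.1 x.2).subtype_mk _
    refine (continuous_coe.comp (f.continuous.comp h1)).congr fun x => ?_
    exact (hgx x.1 (hne x.1 x.2)).symm
  obtain ⟨F, hF, hFL, hFg⟩ := hfill (Fin (d + 1)) (by simpa using hd) g hg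
    (fun x hx => by rw [hgx x (hne x hx)]; exact hfL _)
  have hy0 : ∀ y : sphere (0 : EuclideanSpace ℝ (Fin (d + 1))) 1, WithLp.ofLp y.1 ≠ 0 := by
    intro y h0
    have h1 : y.1 = 0 := (WithLp.ofLp_eq_zero 2).1 h0
    have h2 := mem_sphere_zero_iff_norm.1 y.2
    rw [h1, norm_zero] at h2
    exact zero_ne_one h2
  let u : sphere (0 : EuclideanSpace ℝ (Fin (d + 1))) 1 → Fin (d + 1) → ℝ := fun y =>
    ‖WithLp.ofLp y.1‖⁻¹ • WithLp.ofLp y.1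
  have hu : Continuous u := by
    have h1 : Continuous fun y : sphere (0 : EuclideanSpace ℝ (Fin (d + 1))) 1 =>
      WithLp.ofLp y.1 := (PiLp.continuous_ofLp 2 _).comp continuous_subtype_val
    exact (h1.norm.inv₀ fun y => norm_ne_zero_iff.2 (hy0 y)).smul h1
  have hus : ∀ y, u y ∈ sphere (0 : Fin (d + 1) → ℝ) 1 := fun y =>
    norm_inv_smul_mem_sphere (hy0 y)
  have hgu : ∀ y, g (u y) = fun i => (f y).1 i := by
    intro y
    rw [hgx _ (hne _ (hus y))]
    have h1 : (⟨_, hnu _ (hne _ (hus y))⟩ : sphere (0 : EuclideanSpace ℝ (Fin (d + 1))) 1) = y := by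
      apply Subtype.ext
      have h2 : WithLp.toLp 2 (u y) = ‖WithLp.ofLp y.1‖⁻¹ • y.1 := rfl
      have h3 := mem_sphere_zero_iff_norm.1 y.2
      have h4 : ‖WithLp.ofLp y.1‖ ≠ 0 := norm_ne_zero_iff.2 (hy0 y)
      simp only [h2]
      rw [norm_smul, h3, mul_one, norm_inv, norm_norm, inv_inv, smul_smul, mul_inv_cancel₀ h4,
        one_smul]
    rw [h1]
  have hball : ∀ p : unitInterval × sphere (0 : EuclideanSpace ℝ (Fin (d + 1))) 1,
      (1 - p.1.1) • u p.2 ∈ closedBall (0 : Fin (d + 1) → ℝ) 1 := by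
    rintro ⟨t, y⟩
    have h1 : 0 ≤ 1 - t.1 := sub_nonneg.2 t.2.2
    rw [mem_closedBall_zero_iff, norm_smul, mem_sphere_zero_iff_norm.1 (hus y),
      Real.norm_of_nonneg h1, mul_one]
    linarith [t.2.1]
  have hball0 : (0 : Fin (d + 1) → ℝ) ∈ closedBall (0 : Fin (d + 1) → ℝ) 1 := by simp
  -- The homotopy follows the filling along radii from the boundary of the cube, reached by `u`, to
  -- its centre.
  refine ⟨ofGeo hLK ⟨F 0, hFL hball0⟩, ⟨⟨⟨fun p => ofGeo hLK ⟨F _, hFL (hball p)⟩, ?_⟩, ?_, ?_⟩⟩⟩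
  · refine (continuous_ofGeo hLK hLfin).comp (Continuous.subtype_mk ?_ _)
    refine hF.comp_continuous ?_ hball
    exact (continuous_const.sub (continuous_subtype_val.comp continuous_fst)).smul
      (hu.comp continuous_snd)
  · intro y
    apply coe_injective
    funext i
    change F ((1 - (0 : ℝ)) • u y) i = (f y).1 i
    rw [sub_zero, one_smul, hFg (hus y), hgu]
  · intro y
    apply coe_injective
    funext i
    change F ((1 - (1 : ℝ)) • u y) i = F 0 i
    rw [sub_self, zero_smul]

end Realization

end CubesAndRealizations

/-! ### Tame maps and their extension to permutations -/

section Tame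

variable {k m n o : ℕ}

/-- Two points of `ℕ^k × [m]` lie in the same copy, and agree in all coordinates up to truncation
at `b`. -/
def SameCell (b : ℕ) (p p' : Cells k m) : Prop :=
  p'.2 = p.2 ∧ ∀ j, min (p'.1 j) b = min (p.1 j) b

/-- `f` is a translation on each class of `SameCell b`. -/
def IsTame (b : ℕ) (f : Cells k m → Cells k n) : Prop :=
  ∀ p p', SameCell b p p' → (f p').2 = (f p).2 ∧ ∀ j, (f p').1 j + p.1 j = (f p).1 j + p'.1 j

theorem SameCell.symm {b : ℕ} {p p' : Cells k m} (h : SameCell b p p') : SameCell b p' p :=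
  ⟨h.1.symm, fun j => (h.2 j).symm⟩

/-- The corner of the class of `p` under `SameCell b`. -/
def cellCorner (b : ℕ) (p : Cells k m) : Cells k m := (fun j => min (p.1 j) b, p.2)

theorem SameCell.mono {b b' : ℕ} (hb : b ≤ b') {p p' : Cells k m} (h : SameCell b' p p') :
    SameCell b p p' :=
  ⟨h.1, fun j => by have := h.2 j; omega⟩

theorem IsTame.mono {b b' : ℕ} (hb : b ≤ b') {f : Cells k m → Cells k n} (h : IsTame b f) :
    IsTame b' f :=
  fun p p' hp => h p p' (hp.mono hb)

theorem sameCell_cellCorner (b : ℕ) (p : Cells k m) : SameCell b p (cellCorner b p) :=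
  ⟨rfl, fun j => by simp [cellCorner]⟩

theorem sameCell_iff_cellCorner {b : ℕ} {p p' : Cells k m} :
    SameCell b p p' ↔ cellCorner b p' = cellCorner b p := by
  constructor
  · exact fun h => Prod.ext (funext h.2) h.1
  · exact fun h => ⟨(Prod.ext_iff.1 h).2, fun j => congrFun (Prod.ext_iff.1 h).1 j⟩

theorem cellCorner_eq_self {b : ℕ} {c : Cells k m} (hc : ∀ j, c.1 j ≤ b) : cellCorner b c = c :=
  Prod.ext (funext fun j => min_eq_left (hc j)) rfl

theorem finite_corners (k m b : ℕ) : {c : Cells k m | ∀ j, c.1 j ≤ b}.Finite := by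
  have h : {y : Fin k → ℕ | ∀ j, y j ≤ b}.Finite := by
    have := Set.Finite.pi (ι := Fin k) fun _ => Set.finite_Iic b
    exact this.subset fun y hy j _ => hy j
  exact (h.prod Set.finite_univ).subset fun c hc => ⟨hc, Set.mem_univ _⟩

/-- Once `b` exceeds all coordinates of the corners of finitely many rays, membership in these rays
depends on the truncation at `b` alone. Conversely, the classes for a given `b` are finitely many
rays, one for each corner, free in the directions where the corner has coordinate `b`. This replaces
arbitrary partitions by one numerical parameter. -/
theorem isPiecewiseTranslation_iff {f : Cells k m → Cells k n} :
    IsPiecewiseTranslation f ↔ ∃ b, IsTame b f := by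
  constructor
  · rintro ⟨P, Pfin, Ppart, hP⟩
    choose! r i x T hT using fun X hX => (hP X hX).1
    -- The bound is strict: a coordinate fixed by a ray is then below `b`, so truncation does not
    -- blur it.
    obtain ⟨b, hb⟩ : ∃ b, ∀ X ∈ P, ∀ j, x X j < b := by
      have : ((fun q : Set (Cells k m) × Fin k => x q.1 q.2) '' P ×ˢ Set.univ).Finite :=
        (Pfin.prod Set.finite_univ).image _
      obtain ⟨b, hb⟩ := this.bddAbove
      refine ⟨b + 1, fun X hX j => Nat.lt_succ_of_le (hb ⟨(X, j), ⟨hX, Set.mem_univ _⟩, rfl⟩)⟩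
    refine ⟨b, fun p p' h => ?_⟩
    obtain ⟨X, ⟨hX, hpX⟩, -⟩ := Ppart.2 p
    have hp'X : p' ∈ X := by
      rw [(hT X hX).2] at hpX ⊢
      obtain ⟨h1, h2, h3⟩ := hpX
      refine ⟨h.1.trans h1, fun j hj => ?_, fun j hj => ?_⟩
      · have := h2 j hj
        have := hb X hX j
        have := h.2 j
        omega
      · have := h3 j hj
        have := hb X hX j
        have := h.2 j
        omega
    obtain ⟨d, d₀, hd⟩ := (hP X hX).2
    have h1 := hd p hpX
    have h2 := hd p' hp'X
    refine ⟨Fin.ext ?_, fun j => ?_⟩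
    · have := h.1
      rw [this] at h2
      omega
    · have := h1.1 j
      have := h2.1 j
      omega
  · rintro ⟨b, hf⟩
    refine ⟨(fun c => {p | SameCell b c p}) '' {c : Cells k m | ∀ j, c.1 j ≤ b},
      (finite_corners k m b).image _, ⟨?_, ?_⟩, ?_⟩
    · rintro ⟨c, -, hc⟩
      have : c ∈ {p | SameCell b c p} := ⟨rfl, fun _ => rfl⟩
      simp only at hc
      rw [hc] at this
      exact this
    · intro p
      refine ⟨{q | SameCell b (cellCorner b p) q},
        ⟨⟨_, fun j => min_le_right _ _, rfl⟩, (sameCell_cellCorner b p).symm⟩, ?_⟩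
      rintro _ ⟨⟨c, hc, rfl⟩, hpc⟩
      have hpc : SameCell b c p := hpc
      rw [sameCell_iff_cellCorner, cellCorner_eq_self hc] at hpc
      rw [hpc]
    · rintro _ ⟨c, hc, rfl⟩
      have hc : ∀ j, c.1 j ≤ b := hc
      refine ⟨⟨_, c.2, c.1, Finset.univ.filter fun j => c.1 j = b, rfl, ?_⟩,
        fun j => ((f c).1 j : ℤ) - c.1 j, ((f c).2 : ℤ) - (c.2 : ℤ), ?_⟩
      · ext p
        simp only [SameCell, Set.mem_ofPred_eq, Finset.mem_filter, Finset.mem_univ, true_and]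
        refine and_congr_right fun _ => ⟨fun h => ⟨fun j hj => ?_, fun j hj => ?_⟩, fun h j => ?_⟩
        · have := h j
          omega
        · have := h j
          have := hc j
          omega
        · have := hc j
          by_cases hj : c.1 j = b
          · have := h.1 j hj
            omega
          · have := h.2 j hj
            omega
      · intro p hp
        have h1 := hf c p hp
        refine ⟨fun j => ?_, ?_⟩
        · have := h1.2 j
          simp only
          omega
        · rw [h1.1, hp.1]
          ring

theorem exists_apply_lt_of_le {b : ℕ} (u : Cells k m → Cells k n) :
    ∃ B, ∀ c, (∀ j, c.1 j ≤ b) → ∀ j, (u c).1 j < B := by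
  have : ((fun q : Cells k m × Fin k => (u q.1).1 q.2) ''
      {c : Cells k m | ∀ j, c.1 j ≤ b} ×ˢ Set.univ).Finite :=
    ((finite_corners k m b).prod Set.finite_univ).image _
  obtain ⟨B, hB⟩ := this.bddAbove
  exact ⟨B + 1, fun c hc j => Nat.lt_succ_of_le (hB ⟨(c, j), ⟨hc, Set.mem_univ _⟩, rfl⟩)⟩

theorem IsTame.apply_cellCorner {b : ℕ} {u : Cells k m → Cells k n} (hu : IsTame b u)
    (p : Cells k m) : (u p).2 = (u (cellCorner b p)).2 ∧
      ∀ j, (u p).1 j + min (p.1 j) b = (u (cellCorner b p)).1 j + p.1 j :=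
  hu (cellCorner b p) p (sameCell_cellCorner b p).symm

/-- The image of a tame map is a union of classes. -/
theorem IsTame.mem_range_of_sameCell {b B : ℕ} {u : Cells k m → Cells k n} (hu : IsTame b u)
    (hB : ∀ c, (∀ j, c.1 j ≤ b) → ∀ j, (u c).1 j < B) {q q' : Cells k n} (hq : SameCell B q q')
    (h : q ∈ Set.range u) : q' ∈ Set.range u := by
  obtain ⟨p, rfl⟩ := h
  have h1 := hu.apply_cellCorner p
  have h2 := hB (cellCorner b p) fun j => min_le_right _ _
  set c := cellCorner b p with hc
  have hcp : ∀ j, c.1 j = min (p.1 j) b := fun j => rfl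
  -- The candidate preimage of `q'` undoes the translation of the class of `c`. It stays in that
  -- class because `u c` has coordinates below `B`: a coordinate in which `q` and `q'` differ is at
  -- least `B` in both, which forces the coordinate of `c` to be free.
  have key : SameCell b c ((fun j => q'.1 j + c.1 j - (u c).1 j, p.2) : Cells k m) ∧
      ∀ j, (u c).1 j ≤ q'.1 j := by
    refine ⟨⟨rfl, fun j => ?_⟩, fun j => ?_⟩ <;>
      have := h1.2 j <;> have := h2 j <;> have := hq.2 j <;> have := hcp j
    · simp only
      omega
    · omega
  refine ⟨(fun j => q'.1 j + c.1 j - (u c).1 j, p.2), Prod.ext (funext fun j => ?_) ?_⟩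
  · have h3 := (hu _ _ key.1).2 j
    have h4 := key.2 j
    simp only at h3
    omega
  · rw [(hu _ _ key.1).1, ← h1.1, hq.1]

/-- The copy of `ℕ^k` to which `u` sends the deep points of the copy with index `j`. -/
def leadingCopy (b : ℕ) (u : Cells k m → Cells k n) (j : Fin m) : Fin n := (u (fun _ => b, j)).2

/-- The deepest class of a copy is an orthant, and its image is an orthant whose corner has
coordinates below `B`. -/
theorem IsTame.exists_apply_eq_deep {b B : ℕ} {u : Cells k m → Cells k n} (hu : IsTame b u)
    (hB : ∀ c, (∀ j, c.1 j ≤ b) → ∀ j, (u c).1 j < B) (j : Fin m) :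
    ∃ y, u (y, j) = (fun _ => B, leadingCopy b u j) := by
  have hlt := hB (fun _ => b, j) fun _ => le_rfl
  have key : SameCell b ((fun _ => b, j) : Cells k m)
      (fun l => B + b - (u (fun _ => b, j)).1 l, j) := by
    refine ⟨rfl, fun l => ?_⟩
    have := hlt l
    simp only
    omega
  refine ⟨fun l => B + b - (u (fun _ => b, j)).1 l, Prod.ext (funext fun l => ?_) (hu _ _ key).1⟩
  have := (hu _ _ key).2 l
  have := hlt l
  simp only at *
  omega

/-- A coordinate that is bounded on a class keeps a value below `B` in the image, so a point with
all coordinates `B` can only come from the deepest class of some copy. -/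
theorem IsTame.deep_mem_range_iff {b B : ℕ} {u : Cells k m → Cells k n} (hu : IsTame b u)
    (hB : ∀ c, (∀ j, c.1 j ≤ b) → ∀ j, (u c).1 j < B) (i : Fin n) :
    (((fun _ => B, i) : Cells k n) ∈ Set.range u) ↔ i ∈ Set.range (leadingCopy b u) := by
  constructor
  · rintro ⟨p, hp⟩
    have h1 := hu.apply_cellCorner p
    have h2 := hB (cellCorner b p) fun j => min_le_right _ _
    have h3 : cellCorner b p = (fun _ => b, p.2) := by
      refine Prod.ext (funext fun j => ?_) rfl
      have := h1.2 j
      have := h2 j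
      have e : (u p).1 j = B := by rw [hp]
      simp only [cellCorner]
      omega
    refine ⟨p.2, ?_⟩
    rw [h3, hp] at h1
    exact h1.1.symm
  · rintro ⟨j, rfl⟩
    obtain ⟨y, hy⟩ := hu.exists_apply_eq_deep hB j
    exact ⟨_, hy⟩

/-- Two copies with a common leading copy would both hit the same deep point of it. -/
theorem IsTame.leadingCopy_injective {b : ℕ} {u : Cells k m → Cells k n} (hu : IsTame b u)
    (hinj : Function.Injective u) : Function.Injective (leadingCopy b u) := by
  obtain ⟨B, hB⟩ := exists_apply_lt_of_le (b := b) u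
  intro j j' h
  obtain ⟨y, hy⟩ := hu.exists_apply_eq_deep hB j
  obtain ⟨y', hy'⟩ := hu.exists_apply_eq_deep hB j'
  rw [← h, ← hy] at hy'
  have hyy := hinj hy'
  exact (congrArg Prod.snd hyy).symm

/-- One more lower-dimensional class can be added to the image of a tame injection. -/
theorem IsTame.exists_absorb {a B : ℕ} {φ : Cells k (m + 1) → Cells k n} (hφ : IsTame a φ)
    (hinj : Function.Injective φ) {c : Cells k n} (hc : ∀ j, c.1 j ≤ B) {l₀ : Fin k}
    (hl₀ : c.1 l₀ < B) (hdisj : ∀ p, ¬ SameCell B c (φ p)) :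
    ∃ ψ : Cells k (m + 1) → Cells k n, IsTame (a + 1) ψ ∧ Function.Injective ψ ∧
      Set.range ψ = Set.range φ ∪ {q | SameCell B c q} := by
  classical
  -- Hilbert's hotel along direction `l₀`: `A` is the ray in copy `0` whose free directions are
  -- those of the class of `c` together with `l₀`. The slice `p.1 l₀ = 0` of `A` is sent onto the
  -- new class, while the rest of `A` moves down by one, by `θ`, into the place that is vacated.
  let A : Cells k (m + 1) → Prop := fun p => p.2 = 0 ∧ ∀ l, c.1 l < B → l ≠ l₀ → p.1 l = 0
  let θ : Cells k (m + 1) → Cells k (m + 1) := fun p => (Function.update p.1 l₀ (p.1 l₀ - 1), p.2)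
  let ψ : Cells k (m + 1) → Cells k n := fun p =>
    if A p then (if p.1 l₀ = 0 then (fun j => c.1 j + p.1 j, c.2) else φ (θ p)) else φ p
  have hψ1 : ∀ p, A p → p.1 l₀ = 0 → ψ p = (fun j => c.1 j + p.1 j, c.2) := fun p h h' => by
    simp only [ψ, h, h', if_true]
  have hψ2 : ∀ p, A p → p.1 l₀ ≠ 0 → ψ p = φ (θ p) := fun p h h' => by
    simp only [ψ, h, h', if_true, if_false]
  have hψ3 : ∀ p, ¬ A p → ψ p = φ p := fun p h => by
    simp only [ψ, h, if_false]
  have hθ0 : ∀ p, (θ p).1 l₀ = p.1 l₀ - 1 := fun p => Function.update_self _ _ _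
  have hθ1 : ∀ p l, l ≠ l₀ → (θ p).1 l = p.1 l := fun p l hl => Function.update_of_ne hl _ _
  have hθA : ∀ p, A p → A (θ p) := fun p h =>
    ⟨h.1, fun l hl hl' => (hθ1 p l hl').trans (h.2 l hl hl')⟩
  have hθinj : ∀ p p', p.1 l₀ ≠ 0 → p'.1 l₀ ≠ 0 → θ p = θ p' → p = p' := by
    intro p p' h h' e
    refine Prod.ext (funext fun l => ?_) (Prod.ext_iff.1 e).2
    have e' := congrFun (Prod.ext_iff.1 e).1 l
    by_cases hl : l = l₀
    · subst hl
      rw [hθ0, hθ0] at e'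
      omega
    · rwa [hθ1 _ _ hl, hθ1 _ _ hl] at e'
  have hmem : ∀ p, A p → p.1 l₀ = 0 → SameCell B c (fun j => c.1 j + p.1 j, c.2) := by
    intro p h h'
    refine ⟨rfl, fun j => ?_⟩
    have := hc j
    by_cases hj : c.1 j < B
    · have : p.1 j = 0 := by
        by_cases hl : j = l₀
        · rw [hl, h']
        · exact h.2 j hj hl
      simp [this]
    · simp only
      omega
  have himg : ∀ p, SameCell B c (ψ p) ∨ ψ p ∈ Set.range φ := by
    intro p
    by_cases h : A p
    · by_cases h' : p.1 l₀ = 0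
      · rw [hψ1 p h h']
        exact Or.inl (hmem p h h')
      · rw [hψ2 p h h']
        exact Or.inr ⟨_, rfl⟩
    · rw [hψ3 p h]
      exact Or.inr ⟨_, rfl⟩
  refine ⟨ψ, ?_, ?_, ?_⟩
  · intro p p' hp
    have hz : ∀ l, p.1 l = 0 ↔ p'.1 l = 0 := fun l => by
      have := hp.2 l
      omega
    have hAA : A p ↔ A p' := by
      refine and_congr (by rw [hp.1]) (forall_congr' fun l => ?_)
      rw [hz l]
    by_cases h : A p
    · by_cases h' : p.1 l₀ = 0
      · rw [hψ1 p h h', hψ1 p' (hAA.1 h) ((hz _).1 h')]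
        exact ⟨rfl, fun j => by simp only; omega⟩
      · have h'' : p'.1 l₀ ≠ 0 := fun e => h' ((hz _).2 e)
        rw [hψ2 p h h', hψ2 p' (hAA.1 h) h'']
        -- Lowering a coordinate by one costs one unit of truncation, whence the level `a + 1`.
        have hs : SameCell a (θ p) (θ p') := by
          refine ⟨hp.1, fun j => ?_⟩
          have := hp.2 j
          by_cases hj : j = l₀
          · subst hj
            rw [hθ0, hθ0]
            omega
          · rw [hθ1 _ _ hj, hθ1 _ _ hj]
            omega
        have h1 := hφ _ _ hs
        refine ⟨h1.1, fun j => ?_⟩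
        have h2 := h1.2 j
        by_cases hj : j = l₀
        · subst hj
          rw [hθ0, hθ0] at h2
          omega
        · rwa [hθ1 _ _ hj, hθ1 _ _ hj] at h2
    · rw [hψ3 p h, hψ3 p' (fun e => h (hAA.2 e))]
      exact hφ p p' (hp.mono (Nat.le_succ a))
  · intro p p' e
    by_cases h : A p <;> by_cases h' : A p'
    · by_cases g : p.1 l₀ = 0 <;> by_cases g' : p'.1 l₀ = 0
      · rw [hψ1 p h g, hψ1 p' h' g'] at e
        refine Prod.ext (funext fun j => ?_) (h.1.trans h'.1.symm)
        have := congrFun (congrArg Prod.fst e) j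
        simp only at this
        omega
      · rw [hψ1 p h g, hψ2 p' h' g'] at e
        exact absurd (e ▸ hmem p h g) (hdisj _)
      · rw [hψ2 p h g, hψ1 p' h' g'] at e
        exact absurd (e.symm ▸ hmem p' h' g') (hdisj _)
      · rw [hψ2 p h g, hψ2 p' h' g'] at e
        exact hθinj p p' g g' (hinj e)
    · by_cases g : p.1 l₀ = 0
      · rw [hψ1 p h g, hψ3 p' h'] at e
        exact absurd (e ▸ hmem p h g) (hdisj _)
      · rw [hψ2 p h g, hψ3 p' h'] at e
        exact absurd (hinj e ▸ hθA p h) h'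
    · by_cases g' : p'.1 l₀ = 0
      · rw [hψ3 p h, hψ1 p' h' g'] at e
        exact absurd (e.symm ▸ hmem p' h' g') (hdisj _)
      · rw [hψ3 p h, hψ2 p' h' g'] at e
        exact absurd (hinj e ▸ hθA p' h') h
    · rw [hψ3 p h, hψ3 p' h'] at e
      exact hinj e
  · apply Set.Subset.antisymm
    · rintro _ ⟨p, rfl⟩
      exact (himg p).symm
    · rintro q (⟨p, rfl⟩ | hq)
      · by_cases h : A p
        · have hA : A (Function.update p.1 l₀ (p.1 l₀ + 1), p.2) :=
            ⟨h.1, fun l hl hl' => by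
              simp only [Function.update_of_ne hl']
              exact h.2 l hl hl'⟩
          refine ⟨(Function.update p.1 l₀ (p.1 l₀ + 1), p.2), ?_⟩
          rw [hψ2 _ hA (by simp)]
          congr 1
          refine Prod.ext ?_ rfl
          simp [θ]
        · exact ⟨p, hψ3 p h⟩
      · have hle : ∀ j, c.1 j ≤ q.1 j := fun j => by
          have := hq.2 j
          have := hc j
          omega
        have h0 : ∀ j, c.1 j < B → q.1 j - c.1 j = 0 := fun j hj => by
          have := hq.2 j
          omega
        refine ⟨(fun j => q.1 j - c.1 j, 0), ?_⟩
        rw [hψ1 _ ⟨rfl, fun l hl _ => h0 l hl⟩ (h0 l₀ hl₀)]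
        refine Prod.ext (funext fun j => ?_) hq.1.symm
        have := hle j
        simp only
        omega

/-- Starting from deep orthants in the copies `e`, the classes of lower dimension are absorbed one
at a time. At least one copy in the source is needed as the hotel. -/
theorem exists_tame_of_corners (B : ℕ) {e : Fin (m + 1) → Fin n} (he : Function.Injective e)
    (Z : Finset (Cells k n)) (hZ : ∀ c ∈ Z, (∀ j, c.1 j ≤ B) ∧ ∃ j, c.1 j < B) :
    ∃ (a : ℕ) (φ : Cells k (m + 1) → Cells k n), IsTame a φ ∧ Function.Injective φ ∧
      Set.range φ = {q | (∀ j, B ≤ q.1 j) ∧ q.2 ∈ Set.range e} ∪ {q | cellCorner B q ∈ Z} := by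
  classical
  induction Z using Finset.induction_on with
  | empty =>
    refine ⟨0, fun p => (fun j => p.1 j + B, e p.2), ?_, ?_, ?_⟩
    · intro p p' h
      exact ⟨congrArg e h.1, fun j => by simp only; omega⟩
    · intro p p' h
      refine Prod.ext (funext fun j => ?_) (he (congrArg Prod.snd h))
      have := congrFun (congrArg Prod.fst h) j
      simp only at this
      omega
    · ext q
      simp only [Finset.notMem_empty, Set.mem_union, Set.mem_ofPred_eq, or_false, Set.mem_range]
      constructor
      · rintro ⟨p, rfl⟩
        exact ⟨fun j => Nat.le_add_left _ _, p.2, rfl⟩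
      · rintro ⟨h, s, hs⟩
        refine ⟨(fun j => q.1 j - B, s), Prod.ext (funext fun j => ?_) hs⟩
        have := h j
        simp only
        omega
  | insert c Z hcZ ih =>
    obtain ⟨a, φ, hφ, hinj, hr⟩ := ih fun c hc => hZ c (Finset.mem_insert_of_mem hc)
    obtain ⟨hc, l₀, hl₀⟩ := hZ c (Finset.mem_insert_self _ _)
    obtain ⟨ψ, h1, h2, h3⟩ := hφ.exists_absorb hinj hc hl₀ fun p hp => by
      have : φ p ∈ Set.range φ := ⟨p, rfl⟩
      rw [hr] at this
      rcases this with h | h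
      · have := h.1 l₀
        have := hp.2 l₀
        omega
      · rw [sameCell_iff_cellCorner, cellCorner_eq_self hc] at hp
        rw [Set.mem_ofPred_eq, hp] at h
        exact hcZ h
    refine ⟨a + 1, ψ, h1, h2, ?_⟩
    rw [h3, hr]
    ext q
    simp only [Set.mem_union, Set.mem_ofPred_eq, Finset.mem_insert, sameCell_iff_cellCorner,
      cellCorner_eq_self hc]
    tauto

/-- The complement of the image of a tame injection from fewer copies is, up to piecewise
translation, the union of the remaining number of copies. -/
theorem IsTame.exists_range_eq_compl {b : ℕ} {u : Cells k m → Cells k (m + (o + 1))}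
    (hu : IsTame b u) (hinj : Function.Injective u) :
    ∃ (a : ℕ) (φ : Cells k (o + 1) → Cells k (m + (o + 1))), IsTame a φ ∧ Function.Injective φ ∧
      Set.range φ = (Set.range u)ᶜ := by
  classical
  obtain ⟨B, hB⟩ := exists_apply_lt_of_le (b := b) u
  have hπ := hu.leadingCopy_injective hinj
  -- Exactly `o + 1` copies are not leading copies of `u`; their deep orthants are the part of the
  -- complement with full dimension.
  have hcard : Fintype.card {i // i ∉ Set.range (leadingCopy b u)} = o + 1 := by
    rw [Fintype.card_subtype_compl, Fintype.card_fin]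
    have : Fintype.card {i // i ∈ Set.range (leadingCopy b u)} = m := by
      rw [← Fintype.card_congr (Equiv.ofInjective _ hπ), Fintype.card_fin]
    rw [this]
    omega
  let e := (Fintype.equivFinOfCardEq hcard).symm
  -- The rest of the complement is a union of classes for `B` of lower dimension, recorded by
  -- finitely many corners.
  have hfin : {c : Cells k (m + (o + 1)) |
      (∀ j, c.1 j ≤ B) ∧ (∃ j, c.1 j < B) ∧ c ∉ Set.range u}.Finite :=
    (finite_corners k _ B).subset fun c hc => hc.1
  obtain ⟨a, φ, h1, h2, h3⟩ := exists_tame_of_corners (k := k) B (e := fun s => (e s).1)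
    (Subtype.val_injective.comp e.injective) hfin.toFinset
    (fun c hc => by
      rw [Set.Finite.mem_toFinset] at hc
      exact ⟨hc.1, hc.2.1⟩)
  refine ⟨a, φ, h1, h2, ?_⟩
  have hre : ∀ i, (i ∈ Set.range fun s => (e s).1) ↔ i ∉ Set.range (leadingCopy b u) := by
    intro i
    constructor
    · rintro ⟨s, rfl⟩
      exact (e s).2
    · intro hi
      exact ⟨e.symm ⟨i, hi⟩, by simp⟩
  have hmem : ∀ q, q ∈ Set.range u ↔ cellCorner B q ∈ Set.range u := fun q =>
    ⟨hu.mem_range_of_sameCell hB (sameCell_cellCorner B q),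
      hu.mem_range_of_sameCell hB (sameCell_cellCorner B q).symm⟩
  rw [h3]
  ext q
  simp only [Set.mem_union, Set.mem_ofPred_eq, hre, Set.Finite.mem_toFinset, Set.mem_compl_iff]
  rw [hmem q]
  by_cases hq : ∀ j, B ≤ q.1 j
  · have hcq : cellCorner B q = (fun _ => B, q.2) :=
      Prod.ext (funext fun j => min_eq_right (hq j)) rfl
    rw [hcq, hu.deep_mem_range_iff hB]
    simp [hq]
  · have hq' : ∃ j, (cellCorner B q).1 j < B := by
      push Not at hq
      obtain ⟨j, hj⟩ := hq
      exact ⟨j, by simp only [cellCorner]; omega⟩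
    have : ∀ j, (cellCorner B q).1 j ≤ B := fun j => min_le_right _ _
    have hqn := hq'
    simp [hq, hqn, this]

/-- A tame injection from fewer copies extends to a piecewise translation. -/
theorem IsTame.exists_extension {b : ℕ} (h : m < n) {u : Cells k m → Cells k n} (hu : IsTame b u)
    (hinj : Function.Injective u) :
    ∃ g : TwistedHoughton k n, ∀ p, g.1 (cellsUp h.le p) = u p := by
  obtain ⟨o, rfl⟩ : ∃ o, n = m + (o + 1) := ⟨n - m - 1, by omega⟩
  obtain ⟨a, φ, hφ, hφinj, hr⟩ := hu.exists_range_eq_compl hinj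
  let F : Cells k (m + (o + 1)) → Cells k (m + (o + 1)) := fun q =>
    Sum.elim u φ ((cellsSum k m (o + 1)).symm q)
  have hFl : ∀ p, F (cellsInl (o + 1) p) = u p := fun p => by
    simp only [F, ← cellsSum_inl, Equiv.symm_apply_apply, Sum.elim_inl]
  have hFr : ∀ p, F (cellsInr m p) = φ p := fun p => by
    simp only [F, ← cellsSum_inr, Equiv.symm_apply_apply, Sum.elim_inr]
  have hdisj : ∀ p q, u p ≠ φ q := fun p q e => by
    have : φ q ∈ (Set.range u)ᶜ := hr ▸ ⟨q, rfl⟩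
    exact this ⟨p, e⟩
  have hF : Function.Bijective F := by
    refine ⟨Function.Injective.comp (hinj.sumElim hφinj hdisj) (Equiv.injective _), fun q => ?_⟩
    by_cases hq : q ∈ Set.range u
    · obtain ⟨p, rfl⟩ := hq
      exact ⟨_, hFl p⟩
    · have : q ∈ Set.range φ := hr ▸ hq
      obtain ⟨p, rfl⟩ := this
      exact ⟨_, hFr p⟩
  have hFt : IsTame (max a b) F := by
    intro p p' hp
    induction p using cells_cases with
    | hl p =>
      have hp1 : p' = cellsInl (o + 1) (p'.1, p.2) := Prod.ext rfl hp.1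
      rw [hp1] at hp ⊢
      rw [hFl, hFl]
      exact hu.mono (le_max_right a b) p (p'.1, p.2) ⟨rfl, hp.2⟩
    | hr p =>
      have hp1 : p' = cellsInr m (p'.1, p.2) := Prod.ext rfl hp.1
      rw [hp1] at hp ⊢
      rw [hFr, hFr]
      exact hφ.mono (le_max_left a b) p (p'.1, p.2) ⟨rfl, hp.2⟩
  exact ⟨⟨Equiv.ofBijective F hF, isPiecewiseTranslation_iff.2 ⟨_, hFt⟩⟩, hFl⟩

end Tame

/-! ### A criterion for fin-retractions -/

section FinRetractionCriterion

variable {ι κ : Type*}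

open Classical in
/-- The complex of pairwise `r`-related sets of bounded size is a fin-retract of a skeleton of a
simplex if there are sections that are `r`-related to as many members of a finite set as possible. -/
theorem isFinRetraction_of_sections {K : PreAbstractSimplicialComplex ι}
    {L : PreAbstractSimplicialComplex κ} {π : ι → κ} {r : ι → ι → Prop} {M : ℕ}
    (hsymm : ∀ a b, r a b → r b a)
    (hK : ∀ s, s ∈ K.faces ↔ s.Nonempty ∧ (s : Set ι).Pairwise r ∧ s.card ≤ M)
    (hL : ∀ s, s ∈ L.faces ↔ s.Nonempty ∧ s.card ≤ M) (hπ : ∀ a b, r a b → π a ≠ π b)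
    (hρ : ∀ S : Set ι, S.Finite → ∃ ρ : κ → ι, (∀ i, π (ρ i) = i) ∧
      (∀ i j, i ≠ j → r (ρ i) (ρ j)) ∧ ∀ f ∈ S, ∀ i, π f ≠ i → r f (ρ i)) :
    IsFinRetraction K L π := by
  have hinj : ∀ σ ∈ K.faces, Set.InjOn π σ := by
    intro σ hσ a ha b hb hab
    by_contra hne
    exact hπ a b (((hK σ).1 hσ).2.1 ha hb hne) hab
  have hsec : ∀ ρ : κ → ι, (∀ i j, i ≠ j → r (ρ i) (ρ j)) → IsSimplicialMap L K ρ := by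
    intro ρ hρ τ hτ
    rw [hL] at hτ
    rw [hK]
    refine ⟨hτ.1.image ρ, ?_, Finset.card_image_le.trans hτ.2⟩
    intro a ha b hb hab
    obtain ⟨i, -, rfl⟩ := Finset.mem_image.1 ha
    obtain ⟨j, -, rfl⟩ := Finset.mem_image.1 hb
    exact hρ i j fun h => hab (h ▸ rfl)
  refine ⟨fun σ hσ => ?_, fun τ hτ => ?_, fun S hS _ => ?_⟩
  · rw [hK] at hσ
    rw [hL]
    exact ⟨hσ.1.image π, Finset.card_image_le.trans hσ.2.2⟩
  · obtain ⟨ρ, h1, h2, -⟩ := hρ ∅ Set.finite_empty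
    refine ⟨τ.image ρ, hsec ρ h2 τ hτ, ?_⟩
    rw [Finset.image_image, show π ∘ ρ = id from funext h1, Finset.image_id]
  · obtain ⟨ρ, h1, h2, h3⟩ := hρ S hS
    have hρinj : Function.Injective ρ := Function.LeftInverse.injective h1
    refine ⟨ρ, hsec ρ h2, fun v _ => h1 v, fun σ hσ hσS τ hτ => ?_⟩
    have hcσ : (σ.image π).card = σ.card := Finset.card_image_of_injOn (hinj σ hσ)
    have hcτ : (τ.image ρ).card = τ.card := Finset.card_image_of_injective _ hρinj
    have hρτ := hsec ρ h2 τ hτ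
    constructor
    · rintro ⟨-, hd, hu⟩
      have hne : ∀ x ∈ σ, ∀ t ∈ τ, π x ≠ t := fun x hx t ht h =>
        Finset.disjoint_left.1 hd (Finset.mem_image_of_mem π hx) (h ▸ ht)
      refine ⟨hρτ, Finset.disjoint_left.2 fun x hx hxτ => ?_, ?_⟩
      · obtain ⟨t, ht, rfl⟩ := Finset.mem_image.1 hxτ
        exact hne _ hx t ht (h1 t)
      · rw [hK] at hσ hρτ ⊢
        refine ⟨hσ.1.mono Finset.subset_union_left, ?_, ?_⟩
        · rw [Finset.coe_union, Set.pairwise_union]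
          refine ⟨hσ.2.1, hρτ.2.1, fun x hx y hy _ => ?_⟩
          obtain ⟨t, ht, rfl⟩ := Finset.mem_image.1 hy
          -- Disjointness of `τ` from `σ.image π` is exactly what lets each `x ∈ σ` be related to
          -- each `ρ t`. The size bound carries over because `π` is injective on simplices.
          have h4 := h3 x (hσS hx) t (hne x hx t ht)
          exact ⟨h4, hsymm _ _ h4⟩
        · have h4 := ((hL _).1 hu).2
          rw [Finset.card_union_of_disjoint hd, hcσ] at h4
          exact (Finset.card_union_le _ _).trans (by rwa [hcτ])
    · rintro ⟨-, hd, hu⟩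
      refine ⟨hτ, Finset.disjoint_left.2 fun t htσ ht => ?_, ?_⟩
      · obtain ⟨x, hx, rfl⟩ := Finset.mem_image.1 htσ
        -- If `π x ∈ τ`, then `x` and `ρ (π x)` are distinct vertices of a common simplex with the
        -- same image under `π`, which is impossible for related vertices.
        have hm : ρ (π x) ∈ τ.image ρ := Finset.mem_image_of_mem ρ ht
        refine hπ x (ρ (π x)) (((hK _).1 hu).2.1 ?_ ?_ ?_) (h1 _).symm
        · exact Finset.mem_coe.2 (Finset.mem_union_left _ hx)
        · exact Finset.mem_coe.2 (Finset.mem_union_right _ hm)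
        · exact fun h => Finset.disjoint_left.1 hd hx (h ▸ hm)
      · have h4 := ((hK _).1 hu).2.2
        rw [Finset.card_union_of_disjoint hd, hcτ] at h4
        rw [hL]
        refine ⟨((hL τ).1 hτ).1.mono Finset.subset_union_right, ?_⟩
        exact (Finset.card_union_le _ _).trans (by rwa [hcσ])

open Classical in
-- Serves `n = 1`, where the skeleta have dimension `-1`.
theorem isFinRetraction_of_isEmpty [Nonempty ι] {K : PreAbstractSimplicialComplex ι}
    {L : PreAbstractSimplicialComplex κ} {π : ι → κ} (hK : K.faces = ∅) (hL : L.faces = ∅) :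
    IsFinRetraction K L π := by
  refine ⟨fun σ hσ => ?_, fun τ hτ => ?_, fun S _ _ => ⟨fun _ => Classical.arbitrary ι,
    fun τ hτ => ?_, fun v hv => ?_, fun σ hσ => ?_⟩⟩
  · simp [hK] at hσ
  · simp [hL] at hτ
  · simp [hL] at hτ
  · simp [hL] at hv
  · simp [hK] at hσ

end FinRetractionCriterion

/-! ### Vertices of the Houghton complexes as injections -/

namespace HoughtonCat

variable {k : ℕ}

theorem map_injective {X Y : HoughtonCat k} (f : X ⟶ Y) : Function.Injective (map f) := by
  obtain ⟨h, g, rfl⟩ := HoughtonHom.exists_of f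
  intro p q e
  have e' := g.1.injective e
  refine Prod.ext (Prod.ext_iff.1 e').1 ?_
  exact Fin.castLE_injective h (Prod.ext_iff.1 e').2

theorem exists_isTame_map {X Y : HoughtonCat k} (f : X ⟶ Y) : ∃ b, IsTame b (map f) := by
  obtain ⟨h, g, rfl⟩ := HoughtonHom.exists_of f
  have hg : IsPiecewiseTranslation g.1 := g.2
  exact isPiecewiseTranslation_iff.1 (hg.comp (isPiecewiseTranslation_copy (Fin.castLE h)))

/-- A tame injection into a larger number of copies underlies a morphism. -/
theorem exists_map_eq {X Y : HoughtonCat k} (h : X.rank < Y.rank) {b : ℕ}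
    {u : Cells k X.rank → Cells k Y.rank} (hu : IsTame b u) (hinj : Function.Injective u) :
    ∃ f : X ⟶ Y, ∀ p, map f p = u p := by
  obtain ⟨g, hg⟩ := hu.exists_extension h hinj
  exact ⟨HoughtonHom.of h.le g, hg⟩

theorem rank_tensorPow (n : ℕ) : (tensorPow (⟨1⟩ : HoughtonCat k) n).rank = n := by
  induction n with
  | zero => rfl
  | succ n ih => exact congrArg (· + 1) ih

theorem map_leftUnitor_inv {X : HoughtonCat k} (p : Cells k X.rank) :
    map (λ_ X).inv p = inr (𝟙_ (HoughtonCat k)) p :=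
  Prod.ext rfl (Fin.ext (Nat.zero_add p.2).symm)

theorem map_rightUnitor_inv {X : HoughtonCat k} (p : Cells k X.rank) :
    map (ρ_ X).inv p = inl (𝟙_ (HoughtonCat k)) p := rfl

theorem map_summand (n : ℕ) (j : Fin n) (p : Cells k 1) :
    map (summand (isInitialUnit k) (⟨1⟩ : HoughtonCat k) n j) p =
      (p.1, Fin.cast (rank_tensorPow n).symm j) := by
  induction n with
  | zero => exact Fin.elim0 j
  | succ n ih =>
    induction j using Fin.lastCases with
    | last =>
      rw [summand_last]
      refine (map_comp (λ_ (⟨1⟩ : HoughtonCat k)).inv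
        ((isInitialUnit k).to (tensorPow ⟨1⟩ n) ⊗ₘ 𝟙 (⟨1⟩ : HoughtonCat k)) p).trans ?_
      rw [map_leftUnitor_inv, map_tensorHom_inr]
      refine Prod.ext rfl (Fin.ext ?_)
      have h1 : (p.2 : ℕ) = 0 := by omega
      change (tensorPow (⟨1⟩ : HoughtonCat k) n).rank + (p.2 : ℕ) = n
      rw [h1, rank_tensorPow]
      rfl
    | cast i =>
      rw [summand_castSucc]
      refine (map_comp (summand (isInitialUnit k) (⟨1⟩ : HoughtonCat k) n i)
        ((ρ_ (tensorPow (⟨1⟩ : HoughtonCat k) n)).inv ≫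
          (𝟙 (tensorPow (⟨1⟩ : HoughtonCat k) n) ⊗ₘ (isInitialUnit k).to (⟨1⟩ : HoughtonCat k))) p).trans ?_
      rw [ih, map_comp, map_rightUnitor_inv, map_tensorHom_inl]
      rfl

variable {Y : HoughtonCat k}

/-- The images of two morphisms are disjoint. -/
def DisjointImages (f g : (⟨1⟩ : HoughtonCat k) ⟶ Y) : Prop := ∀ p q, map f p ≠ map g q

theorem DisjointImages.symm {f g : (⟨1⟩ : HoughtonCat k) ⟶ Y} (h : DisjointImages f g) :
    DisjointImages g f := fun p q e => h q p e.symm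

theorem not_disjointImages_self (f : (⟨1⟩ : HoughtonCat k) ⟶ Y) : ¬ DisjointImages f f :=
  fun h => h (fun _ => 0, (0 : Fin 1)) _ rfl

/-- The index of the copy of `ℕ^k` that contains the image of all deep points of `ℕ^k`. -/
noncomputable def vertexCopy (f : (⟨1⟩ : HoughtonCat k) ⟶ Y) : Fin Y.rank :=
  leadingCopy (exists_isTame_map f).choose (map f) (0 : Fin 1)

/-- Every `k`-dimensional ray meets the orthant of points with all coordinates at least `b`, on
which `f` is a single translation. In particular `vertexCopy f` does not depend on the chosen `b`.
-/
theorem isLeadingCopy_iff (f : (⟨1⟩ : HoughtonCat k) ⟶ Y) (i : ℕ) :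
    IsLeadingCopy f i ↔ (vertexCopy f : ℕ) = i := by
  have hb := (exists_isTame_map f).choose_spec
  set b := (exists_isTame_map f).choose with hbdef
  have hv : vertexCopy f = (map f (fun _ => b, (0 : Fin 1))).2 := rfl
  have hsame : ∀ p : Cells k 1, (∀ j, b ≤ p.1 j) → SameCell b (fun _ => b, 0) p :=
    fun p hp => ⟨Subsingleton.elim _ _, fun j => by have := hp j; simp only; omega⟩
  constructor
  · rintro ⟨_, ⟨s, x, T, hT, rfl⟩, -, h⟩
    obtain rfl : T = Finset.univ := (Finset.card_eq_iff_eq_univ T).1 (by simpa using hT)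
    rw [hv, ← h (fun j => max (x j) b, s) ⟨rfl, fun j _ => le_max_left _ _, by simp⟩]
    exact congrArg _ (hb _ _ (hsame (fun j => max (x j) b, s) fun j => le_max_right _ _)).1.symm
  · rintro rfl
    refine ⟨_, ⟨(0 : Fin 1), fun _ => b, Finset.univ, by simp, rfl⟩,
      ⟨fun j => ((map f (fun _ => b, (0 : Fin 1))).1 j : ℤ) - b, ((vertexCopy f : ℕ) : ℤ), ?_⟩, ?_⟩
    · rintro p ⟨hp1, hp2, -⟩
      have := hb _ _ (hsame p fun j => hp2 j (Finset.mem_univ j))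
      refine ⟨fun j => ?_, ?_⟩
      · have := this.2 j
        simp only at this ⊢
        omega
      · rw [this.1, hv, hp1]
        simp
    · rintro p ⟨hp1, hp2, -⟩
      rw [(hb _ _ (hsame p fun j => hp2 j (Finset.mem_univ j))).1, hv]

/-- Both images would contain the point of the common copy all of whose coordinates are a
sufficiently large `B`. -/
theorem DisjointImages.vertexCopy_ne {f g : (⟨1⟩ : HoughtonCat k) ⟶ Y} (h : DisjointImages f g) :
    vertexCopy f ≠ vertexCopy g := by
  intro e
  have hf := (exists_isTame_map f).choose_spec
  have hg := (exists_isTame_map g).choose_spec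
  obtain ⟨B₁, hB₁⟩ := exists_apply_lt_of_le (b := (exists_isTame_map f).choose) (map f)
  obtain ⟨B₂, hB₂⟩ := exists_apply_lt_of_le (b := (exists_isTame_map g).choose) (map g)
  obtain ⟨y, hy⟩ := hf.exists_apply_eq_deep (B := max B₁ B₂)
    (fun c hc j => (hB₁ c hc j).trans_le (le_max_left _ _)) (0 : Fin 1)
  obtain ⟨y', hy'⟩ := hg.exists_apply_eq_deep (B := max B₁ B₂)
    (fun c hc j => (hB₂ c hc j).trans_le (le_max_right _ _)) (0 : Fin 1)
  refine h _ _ (hy.trans (Eq.trans ?_ hy'.symm))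
  exact congrArg (Prod.mk _) e

/-- Vertices far out in the copies of `ℕ^k`, with images disjoint from as many members of a finite
set of vertices as possible. -/
theorem exists_deep_vertices (hY : 2 ≤ Y.rank) (S : Set ((⟨1⟩ : HoughtonCat k) ⟶ Y))
    (hS : S.Finite) : ∃ ρ : Fin Y.rank → ((⟨1⟩ : HoughtonCat k) ⟶ Y),
      (∀ i, vertexCopy (ρ i) = i) ∧ (∀ i j, i ≠ j → DisjointImages (ρ i) (ρ j)) ∧
        ∀ f ∈ S, ∀ i, vertexCopy f ≠ i → DisjointImages f (ρ i) := by
  choose b hb using fun f : (⟨1⟩ : HoughtonCat k) ⟶ Y => exists_apply_lt_of_le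
    (b := (exists_isTame_map f).choose) (map f)
  -- All corners have images under members of `S` with coordinates below `D`. The vertices `ρ i` are
  -- the translations by `D` in every direction.
  obtain ⟨D, hD⟩ := (hS.image b).bddAbove
  have hD : ∀ f ∈ S, b f ≤ D := fun f hf => hD ⟨f, hf, rfl⟩
  have key : ∀ i : Fin Y.rank, ∃ f : (⟨1⟩ : HoughtonCat k) ⟶ Y,
      ∀ p, map f p = (fun j => p.1 j + D, i) := by
    intro i
    -- At least two copies are needed: one copy cannot be injected properly into one copy by a
    -- morphism.
    refine exists_map_eq (b := 0) (by exact hY) ?_ ?_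
    · intro p p' _
      exact ⟨rfl, fun j => by simp only; omega⟩
    · intro p p' h
      refine Prod.ext (funext fun j => ?_) (Subsingleton.elim (α := Fin 1) _ _)
      have := congrFun (Prod.ext_iff.1 h).1 j
      simp only at this
      omega
  choose ρ hρ using key
  refine ⟨ρ, fun i => ?_, fun i j hij p q e => ?_, fun f hf i hi p q e => ?_⟩
  · change (map (ρ i) _).2 = i
    rw [hρ]
  · rw [hρ, hρ] at e
    exact hij (Prod.ext_iff.1 e).2
  · rw [hρ] at e
    have ht := (exists_isTame_map f).choose_spec.apply_cellCorner p
    have hlt := hb f (cellCorner (exists_isTame_map f).choose p) fun j => min_le_right _ _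
    -- A point in the image of `f` with all coordinates at least `D` comes from the deepest class,
    -- so it lies in the leading copy of `f`.
    have hcorner : cellCorner (exists_isTame_map f).choose p =
        (fun _ => (exists_isTame_map f).choose, (0 : Fin 1)) := by
      refine Prod.ext (funext fun j => ?_) (Subsingleton.elim (α := Fin 1) _ _)
      have h1 := ht.2 j
      have h2 := hlt j
      have h3 := hD f hf
      have h4 := congrFun (Prod.ext_iff.1 e).1 j
      simp only at h4
      simp only [cellCorner]
      omega
    rw [hcorner, e] at ht
    exact hi ht.1.symm

/-! ### Simplices, connectivity and skeleta -/

section Faces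

variable {a n : ℕ}

/-- The vertices of the complex `S_n(a, 1)`. -/
abbrev Vertex (k a n : ℕ) : Type :=
  (⟨1⟩ : HoughtonCat k) ⟶ (⟨a⟩ : HoughtonCat k) ⊗ tensorPow (⟨1⟩ : HoughtonCat k) n

theorem rank_target (k a n : ℕ) :
    ((⟨a⟩ : HoughtonCat k) ⊗ tensorPow (⟨1⟩ : HoughtonCat k) n).rank = a + n :=
  congrArg (a + ·) (rank_tensorPow n)

/-- The summands occupy different copies of the source and the morphism is injective. Its existence
also bounds the number of summands by the number of copies in the target. -/
theorem pairwise_of_mem_faces {s : Finset (Vertex k a n)}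
    (hs : s ∈ (houghtonComplex k a n).faces) :
    (s : Set (Vertex k a n)).Pairwise DisjointImages ∧ s.card ≤ a + n := by
  obtain ⟨p, f, hcard, hsf⟩ := hs
  constructor
  · intro v hv w hw hvw
    rw [hsf] at hv hw
    obtain ⟨i, rfl⟩ := hv
    obtain ⟨j, rfl⟩ := hw
    intro x y e
    simp only [map_comp] at e
    have e' := map_injective f e
    rw [map_summand, map_summand] at e'
    refine hvw ?_
    have : i = j := Fin.cast_injective (rank_tensorPow (k := k) (p + 1)).symm (Prod.ext_iff.1 e').2
    rw [this]
  · have h1 := HoughtonHom.le f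
    rw [rank_target, rank_tensorPow] at h1
    omega

/-- Disjoint images assemble to one tame injection, which extends to a permutation because the
number of copies is strictly smaller. For `a + n` vertices the images would also have to cover the
target. -/
theorem mem_faces_of_pairwise {s : Finset (Vertex k a n)} (hne : s.Nonempty)
    (hs : (s : Set (Vertex k a n)).Pairwise DisjointImages) (hcard : s.card < a + n) :
    s ∈ (houghtonComplex k a n).faces := by
  obtain ⟨p, hp⟩ : ∃ p, s.card = p + 1 :=
    ⟨s.card - 1, by have := Finset.card_pos.2 hne; omega⟩
  let e : Fin (tensorPow (⟨1⟩ : HoughtonCat k) (p + 1)).rank ≃ s :=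
    (finCongr ((rank_tensorPow (p + 1)).trans hp.symm)).trans s.equivFin.symm
  choose b hb using fun f : Vertex k a n => exists_isTame_map f
  have hlt : (tensorPow (⟨1⟩ : HoughtonCat k) (p + 1)).rank <
      ((⟨a⟩ : HoughtonCat k) ⊗ tensorPow (⟨1⟩ : HoughtonCat k) n).rank := by
    rw [rank_target, rank_tensorPow]
    omega
  obtain ⟨f, hf⟩ := exists_map_eq hlt (b := s.sup b)
    (u := fun q => map (e q.2).1 (q.1, (0 : Fin 1)))
    (by
      intro q q' h
      have h1 := (hb (e q.2).1).mono (Finset.le_sup (e q.2).2) (q.1, (0 : Fin 1))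
        (q'.1, (0 : Fin 1)) ⟨rfl, h.2⟩
      simp only
      rw [h.1]
      exact h1)
    (by
      intro q q' h
      have h2 : q.2 = q'.2 := by
        by_contra hne
        refine hs (e q.2).2 (e q'.2).2 ?_ _ _ h
        exact fun h' => hne (e.injective (Subtype.ext h'))
      simp only at h
      rw [h2] at h
      exact Prod.ext (Prod.ext_iff.1 (map_injective _ h)).1 h2)
  have hvert : ∀ j, summand (isInitialUnit k) (⟨1⟩ : HoughtonCat k) (p + 1) j ≫ f =
      (e (Fin.cast (rank_tensorPow (p + 1)).symm j)).1 := by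
    intro j
    refine hom_ext fun x => ?_
    rw [map_comp, hf, map_summand]
    refine congrArg _ (Prod.ext rfl (Subsingleton.elim (α := Fin 1) _ _))
  refine ⟨p, f, hp, ?_⟩
  ext v
  constructor
  · intro hv
    refine ⟨Fin.cast (rank_tensorPow (p + 1)) (e.symm ⟨v, hv⟩), ?_⟩
    simp only [hvert]
    simp
  · rintro ⟨j, rfl⟩
    simp only [hvert]
    exact (e _).2

/-- Both connectivity claims are instances, as only the number `a + n` of copies in the target
matters. -/
theorem isConnectedUpTo_houghtonComplex (hn : 1 ≤ a + n) :
    IsConnectedUpTo ((((a + n : ℕ) : ℚ) - 3) / 2)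
      (Realization (houghtonComplex k a n).toPreAbstractSimplicialComplex) := by
  classical
  constructor
  · intro _
    have hle : 1 ≤ ((⟨a⟩ : HoughtonCat k) ⊗ tensorPow (⟨1⟩ : HoughtonCat k) n).rank := by
      rw [rank_target]
      exact hn
    let v : Vertex k a n := HoughtonHom.of hle 1
    refine ⟨⟨Finsupp.single v 1, fun i => ?_, by simp, ?_⟩⟩
    · exact (Finsupp.single_nonneg.2 zero_le_one) i
    · rw [Finsupp.support_single v one_ne_zero]
      exact (houghtonComplex k a n).singleton_mem v
  · intro i hi
    have hi' : 2 * i + 3 ≤ a + n := by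
      have h1 : (2 : ℚ) * i + 3 ≤ ((a + n : ℕ) : ℚ) := by linarith
      exact_mod_cast h1
    -- With `m = a + n - 2`, disjointness characterizes simplices with at most `m + 1` vertices, and
    -- those with `m + 2` vertices are the only others. Filling for `m` handles all spheres of
    -- dimension at most `a + n - 3`.
    obtain ⟨m, hm⟩ : ∃ m, a + n = m + 2 := ⟨a + n - 2, by omega⟩
    refine Realization.nullhomotopic_of_fills (m := m) (fun S => ?_) (by omega)
    obtain ⟨ρ, h1, h2, h3⟩ := exists_deep_vertices (k := k)
      (Y := (⟨a⟩ : HoughtonCat k) ⊗ tensorPow (⟨1⟩ : HoughtonCat k) n)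
      (by rw [rank_target]; omega) S S.finite_toSet
    -- The deep vertices are added to make the finite complex highly connected. `T` consists of
    -- those simplices on `S'` that have the maximal number of vertices.
    set S' := S ∪ Finset.univ.image ρ with hS'
    set T := S'.powerset.filter fun s => s ∈ (houghtonComplex k a n).faces ∧ s.card = m + 2 with hT
    refine ⟨pairwiseFaces DisjointImages S' (m + 1) ∪ (T : Set (Finset (Vertex k a n))), ?_, ?_, ?_, ?_⟩
    · rintro s (hs | hs)
      · exact mem_faces_of_pairwise hs.1 hs.2.2.1 (by have := hs.2.2.2; omega)
      · exact (Finset.mem_filter.1 hs).2.1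
    · refine S'.powerset.finite_toSet.subset ?_
      rintro s (hs | hs)
      · exact Finset.mem_coe.2 (Finset.mem_powerset.2 hs.2.1)
      · exact Finset.mem_coe.2 (Finset.mem_filter.1 hs).1
    · intro s hs hsS
      have hsS' : s ⊆ S' := hsS.trans Finset.subset_union_left
      have h4 := pairwise_of_mem_faces hs
      rcases (h4.2.trans hm.le).eq_or_lt with h5 | h5
      · exact Or.inr (Finset.mem_coe.2
          (Finset.mem_filter.2 ⟨Finset.mem_powerset.2 hsS', hs, h5⟩))
      · exact Or.inl ⟨((houghtonComplex k a n).isRelLowerSet_faces hs).1, hsS', h4.1, by omega⟩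
    · have hρinj : Function.Injective ρ := Function.LeftInverse.injective h1
      -- The only deep vertex whose image can meet that of `f` is the one in the leading copy of
      -- `f`.
      have hgen : ∀ f ∈ S', ∀ i, ¬ DisjointImages f (ρ i) → vertexCopy f = i := by
        intro f hf i hr
        rcases Finset.mem_union.1 hf with hf | hf
        · by_contra h
          exact hr (h3 f hf i h)
        · obtain ⟨j, -, rfl⟩ := Finset.mem_image.1 hf
          rw [h1]
          by_contra h
          exact hr (h2 j i h)
      refine fills_geo_union_of_card_eq (isDownClosed_pairwiseFaces _ _ _) (fun s hs => hs.1)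
        (fun s hs => hs.2.2.2) ?_ T ?_
      · refine fills_geo_pairwiseFaces (fun _ _ h => h.symm) not_disjointImages_self m S'
          (Finset.univ.image ρ) Finset.subset_union_right ?_ ?_
        · rw [Finset.card_image_of_injective _ hρinj, Finset.card_univ, Fintype.card_fin,
            rank_target]
          omega
        · intro f hf b hb b' hb' hr hr'
          obtain ⟨i, -, rfl⟩ := Finset.mem_image.1 hb
          obtain ⟨j, -, rfl⟩ := Finset.mem_image.1 hb'
          rw [← hgen f hf i hr, ← hgen f hf j hr']
      · intro σ hσ
        obtain ⟨h4, h5, h6⟩ := Finset.mem_filter.1 hσ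
        refine ⟨h6, fun τ hτ hne => ⟨hne, ?_, ?_, ?_⟩⟩
        · exact hτ.1.trans (Finset.mem_powerset.1 h4)
        · exact (pairwise_of_mem_faces h5).1.mono (Finset.coe_subset.2 hτ.1)
        · have := Finset.card_lt_card hτ
          omega

/-- The skeleton stops just below the dimension in which disjointness no longer suffices for a
simplex. -/
theorem mem_skeleton_houghtonComplex_iff {n : ℕ} (s : Finset (Vertex k 0 n)) (hn : 1 ≤ n) :
    s ∈ (skeleton ((n : ℤ) - 2) (houghtonComplex k 0 n).toPreAbstractSimplicialComplex).faces ↔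
      s.Nonempty ∧ (s : Set (Vertex k 0 n)).Pairwise DisjointImages ∧ s.card ≤ n - 1 := by
  constructor
  · rintro ⟨hs, hc⟩
    exact ⟨((houghtonComplex k 0 n).isRelLowerSet_faces hs).1, (pairwise_of_mem_faces hs).1,
      by omega⟩
  · rintro ⟨h1, h2, h3⟩
    exact ⟨mem_faces_of_pairwise h1 h2 (by omega), by omega⟩

theorem mem_skeleton_top_iff {n : ℕ} (s : Finset (Fin n)) (hn : 1 ≤ n) :
    s ∈ (skeleton ((n : ℤ) - 2) (⊤ : PreAbstractSimplicialComplex (Fin n))).faces ↔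
      s.Nonempty ∧ s.card ≤ n - 1 := by
  constructor
  · rintro ⟨hs, hc⟩
    exact ⟨hs, by omega⟩
  · rintro ⟨h1, h3⟩
    exact ⟨h1, by omega⟩

theorem isFinRetraction_vertexCopy {n : ℕ} (hn : 1 ≤ n) :
    IsFinRetraction
      (skeleton ((n : ℤ) - 2) (houghtonComplex k 0 n).toPreAbstractSimplicialComplex)
      (skeleton ((n : ℤ) - 2) (⊤ : PreAbstractSimplicialComplex (Fin n)))
      (fun f => Fin.cast ((rank_target k 0 n).trans (zero_add n)) (vertexCopy f)) := by
  -- For `n = 1` the deep translations need not underlie morphisms, but then both skeleta are empty.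
  rcases hn.eq_or_lt with rfl | hn'
  · have : Nonempty (Vertex k 0 1) := ⟨HoughtonHom.of le_rfl 1⟩
    refine isFinRetraction_of_isEmpty ?_ ?_
    · ext s
      rw [mem_skeleton_houghtonComplex_iff s hn]
      have := @Finset.card_pos _ s
      simp only [Set.mem_empty_iff_false, iff_false]
      rintro ⟨h1, -, h2⟩
      have := this.2 h1
      omega
    · ext s
      rw [mem_skeleton_top_iff s hn]
      have := @Finset.card_pos _ s
      simp only [Set.mem_empty_iff_false, iff_false]
      rintro ⟨h1, h2⟩
      have := this.2 h1
      omega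
  · have hr := (rank_target k 0 n).trans (zero_add n)
    refine isFinRetraction_of_sections (r := DisjointImages) (M := n - 1) (fun _ _ h => h.symm)
      (fun s => mem_skeleton_houghtonComplex_iff s hn) (fun s => mem_skeleton_top_iff s hn)
      (fun _ _ h e => h.vertexCopy_ne (Fin.cast_injective _ e)) fun S hS => ?_
    obtain ⟨ρ, h1, h2, h3⟩ := exists_deep_vertices (by rw [hr]; exact hn') S hS
    refine ⟨fun i => ρ (Fin.cast hr.symm i), fun i => ?_, fun i j hij => ?_, fun f hf i hi => ?_⟩
    · simp only [h1]
      simp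
    · exact h2 _ _ fun h => hij (Fin.cast_injective _ h)
    · refine h3 f hf _ fun h => hi ?_
      rw [h]
      simp

end Faces

end HoughtonCat

/-! ### The main theorem -/

theorem mainTheorem4 (k : ℕ) (hk : 1 ≤ k) :
    (∀ n : ℕ, 1 ≤ n → IsConnectedUpTo (((n : ℚ) - 3) / 2)
      (Realization (HoughtonCat.houghtonComplex k 0 n).toPreAbstractSimplicialComplex)) ∧
    (∀ n : ℕ, 1 ≤ n →
      ∃ π : ((⟨1⟩ : HoughtonCat k) ⟶ (⟨0⟩ : HoughtonCat k) ⊗ tensorPow (⟨1⟩ : HoughtonCat k) n) →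
          Fin n,
        (∀ f (i : Fin n), HoughtonCat.IsLeadingCopy f (i : ℕ) ↔ π f = i) ∧
        IsFinRetraction
          (skeleton ((n : ℤ) - 2) (HoughtonCat.houghtonComplex k 0 n).toPreAbstractSimplicialComplex)
          (skeleton ((n : ℤ) - 2) (⊤ : PreAbstractSimplicialComplex (Fin n))) π) ∧
    LH3 (HoughtonCat.isInitialUnit k) (⟨1⟩ : HoughtonCat k) (⟨1⟩ : HoughtonCat k) 2 := by
  refine ⟨fun n hn => ?_, fun n hn => ⟨_, fun f i => ?_,
    HoughtonCat.isFinRetraction_vertexCopy hn⟩, fun n hn => ?_⟩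
  · have := HoughtonCat.isConnectedUpTo_houghtonComplex (k := k) (a := 0) (n := n) (by omega)
    rwa [zero_add] at this
  · rw [HoughtonCat.isLeadingCopy_iff, Fin.ext_iff]
    rfl
  · have := HoughtonCat.isConnectedUpTo_houghtonComplex (k := k) (a := 1) (n := n) (by omega)
    -- The extra copy in the target `1 ⊕ n` turns `n - 3` into `n - 2`.
    have e : (((1 + n : ℕ) : ℚ) - 3) / 2 = ((n : ℚ) - 2) / (2 : ℕ) := by
      push_cast
      ring
    rwa [e] at this
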